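/- Knots are oriented and tame, and are considered up to isotopy; they are given by simple closed polygons in $\mathbb{R}^3$, two of which represent the same knot if an ambient isotopy of $\mathbb{R}^3$ carries one onto the other, preserving orientations. A knot is trivial if it is the knot of a triangle. A diagram $D$ of a knot $K$ is a polygon representing $K$ whose projection to the plane is regular: the projection has only finitely many multiple points, all of them are double points, and no vertex is projected to a double point. Let $c(D)$ be the number of crossings (double points) of $D$, and let $c(K)$ be the minimum of $c(D')$ over all diagrams $D'$ of $K$. A diagram $D$ of $K$ is minimal with respect to crossings if $c(D)=c(K)$. Each double point has two preimages on $D$, an overcrossing (the higher one) and an undercrossing (the lower one). If $c(D)\ge 1$, then there is a unique positive integer $k$ such that there are $2k$ points $s_1,f_1,s_2,f_2,\dots,s_k,f_k$, in this cyclic order along $D$ and none of them an overcrossing or an undercrossing, for which every closed arc $[s_i,f_i]$ of $D$ contains at least one overcrossing and no undercrossing (an overpass), and every closed arc $[f_i,s_{i+1}]$ (subscripts modulo $k$) contains at least one undercrossing and no overcrossing (an underpass). This $k$, the number of overpasses of $D$, is denoted by $b(D)$; if $c(D)=0$, put $b(D)=0$. Theorem 2.10. If $K$ is a nontrivial knot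 and $D$ is a minimal diagram of $K$ with respect to crossings, then $$1+\sqrt{1+c(D)}\ \le\ b(D)\ \le\ c(D).$$ -/

import Mathlib

open scoped unitInterval

namespace KnotDiag

/-- The plane that knots are projected to. -/
abbrev Plane : Type := ℝ × ℝ

/-- Three-dimensional space, written as plane times height; the regular projections below are
taken along the height coordinate, `Prod.fst : Space → Plane`. -/
abbrev Space : Type := Plane × ℝ

/-- An oriented polygonal knot: a simple closed polygon in space with vertices `v 0, …, v (n-1)`,
traversed in this order.  The real number `s` is the parameter of the point at fraction
`Int.fract s` of the edge from `v ⌊s⌋` to `v (⌊s⌋ + 1)` (indices modulo `n`), so parameters are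
counted modulo `n`; simplicity says that no point is visited twice in one turn. -/
structure PolygonalKnot where
  /-- the number of vertices -/
  n : ℕ
  three_le : 3 ≤ n
  /-- the vertices -/
  v : ZMod n → Space
  simple : Set.InjOn
    (fun s : ℝ => AffineMap.lineMap (k := ℝ) (v (⌊s⌋ : ℤ)) (v ((⌊s⌋ + 1 : ℤ))) (Int.fract s))
    (Set.Ico 0 (n : ℝ))

namespace PolygonalKnot

/-- The closed polygon as an `n`-periodic curve. -/
noncomputable def curve (P : PolygonalKnot) (s : ℝ) : Space :=
  AffineMap.lineMap (k := ℝ) (P.v (⌊s⌋ : ℤ)) (P.v ((⌊s⌋ + 1 : ℤ))) (Int.fract s)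

/-- The projection of the polygon to the plane. -/
noncomputable def shadow (P : PolygonalKnot) (s : ℝ) : Plane := (P.curve s).1

/-- The height of the polygon above the plane. -/
noncomputable def height (P : PolygonalKnot) (s : ℝ) : ℝ := (P.curve s).2

/-- The multiple points of the projection. -/
def multiplePoints (P : PolygonalKnot) : Set Plane :=
  {x | ∃ s ∈ Set.Ico (0 : ℝ) P.n, ∃ t ∈ Set.Ico (0 : ℝ) P.n,
    s ≠ t ∧ P.shadow s = x ∧ P.shadow t = x}

/-- `P` and `Q` are isotopic as oriented knots: there is an ambient isotopy `H` of space, from the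
identity to a homeomorphism that carries `P` onto `Q`, the orientation of `P` to that of `Q`. -/
def Isotopic (P Q : PolygonalKnot) : Prop :=
  ∃ H : I → (Space ≃ₜ Space),
    Continuous (fun p : I × Space => H p.1 p.2) ∧
    H 0 = Homeomorph.refl Space ∧
    ∃ φ : ℝ ≃o ℝ, ∀ s : ℝ, H 1 (P.curve s) = Q.curve (φ s)

theorem Isotopic.refl (P : PolygonalKnot) : P.Isotopic P :=
  ⟨fun _ => Homeomorph.refl Space, continuous_snd, rfl,
    OrderIso.refl ℝ, fun _ => rfl⟩

theorem Isotopic.symm {P Q : PolygonalKnot} (h : P.Isotopic Q) : Q.Isotopic P := by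
  obtain ⟨H, hc, h0, φ, hφ⟩ := h
  refine ⟨fun t => (H 1).symm.trans (H (unitInterval.symm t)), ?_, ?_, φ.symm, fun s => ?_⟩
  · have : Continuous (fun p : I × Space => ((unitInterval.symm p.1, (H 1).symm p.2) : I × Space)) :=
      (unitInterval.continuous_symm.comp continuous_fst).prodMk
        ((H 1).symm.continuous.comp continuous_snd)
    exact hc.comp this
  · ext1 x
    simp
  · have := hφ (φ.symm s)
    rw [φ.apply_symm_apply] at this
    simp [← this, h0]

theorem Isotopic.trans {P Q R : PolygonalKnot} (h : P.Isotopic Q) (h' : Q.Isotopic R) :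
    P.Isotopic R := by
  obtain ⟨H, hc, h0, φ, hφ⟩ := h
  obtain ⟨H', hc', h0', φ', hφ'⟩ := h'
  refine ⟨fun t => (H t).trans (H' t), ?_, ?_, φ.trans φ', fun s => ?_⟩
  · exact hc'.comp (continuous_fst.prodMk hc)
  · simp only [h0, h0']
    rfl
  · simp [hφ, hφ']

end PolygonalKnot

/-- A knot diagram: a polygonal knot whose projection is regular, that is, the projection has only
finitely many multiple points, all of them are double points, and no vertex lies over a double
point (so that the two branches at a double point cross transversally).  The heights record which
branch is the upper one. -/
structure KnotDiagram extends PolygonalKnot where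
  finite_multiplePoints : toPolygonalKnot.multiplePoints.Finite
  double : ∀ s ∈ Set.Ico (0 : ℝ) n, ∀ t ∈ Set.Ico (0 : ℝ) n, ∀ u ∈ Set.Ico (0 : ℝ) n,
    toPolygonalKnot.shadow s = toPolygonalKnot.shadow t →
    toPolygonalKnot.shadow t = toPolygonalKnot.shadow u → s = t ∨ t = u ∨ s = u
  vertex : ∀ i : ℕ, i < n → ∀ t ∈ Set.Ico (0 : ℝ) n,
    toPolygonalKnot.shadow t = toPolygonalKnot.shadow (i : ℝ) → t = i

namespace KnotDiagram

/-- The number `c(D)` of crossings, i.e. of double points of the projection. -/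
noncomputable def c (D : KnotDiagram) : ℕ := D.multiplePoints.ncard

/-- The point with parameter `s` is an overcrossing. -/
def IsOvercrossing (D : KnotDiagram) (s : ℝ) : Prop :=
  ∃ t : ℝ, D.shadow t = D.shadow s ∧ D.height t < D.height s

/-- The point with parameter `s` is an undercrossing. -/
def IsUndercrossing (D : KnotDiagram) (s : ℝ) : Prop :=
  ∃ t : ℝ, D.shadow t = D.shadow s ∧ D.height s < D.height t

/-- An over-underpass sequence `s₁, f₁, …, s_k, f_k` of `D`: `2k` points in cyclic order along `D`,
none of them an overcrossing or undercrossing, such that every closed arc `[s i, f i]` is an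
overpass (contains an overcrossing and no undercrossing) and every closed arc `[f i, s (i+1)]` is
an underpass (contains an undercrossing and no overcrossing).  The indices are counted modulo `k`
by letting the parameters, which are counted modulo `D.n`, grow by `D.n` (one full turn) when the
index grows by `k`. -/
structure IsOverUnderpassSequence (D : KnotDiagram) (k : ℕ) (s f : ℤ → ℝ) : Prop where
  s_add : ∀ i, s (i + k) = s i + D.n
  f_add : ∀ i, f (i + k) = f i + D.n
  s_lt_f : ∀ i, s i < f i
  f_lt_s : ∀ i, f i < s (i + 1)
  s_not : ∀ i, ¬ D.IsOvercrossing (s i) ∧ ¬ D.IsUndercrossing (s i)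
  f_not : ∀ i, ¬ D.IsOvercrossing (f i) ∧ ¬ D.IsUndercrossing (f i)
  overpass : ∀ i, (∃ x ∈ Set.Icc (s i) (f i), D.IsOvercrossing x) ∧
    ∀ x ∈ Set.Icc (s i) (f i), ¬ D.IsUndercrossing x
  underpass : ∀ i, (∃ x ∈ Set.Icc (f i) (s (i + 1)), D.IsUndercrossing x) ∧
    ∀ x ∈ Set.Icc (f i) (s (i + 1)), ¬ D.IsOvercrossing x

/-- The number `b(D)` of overpasses: the positive integer `k` such that `D` has an over-underpass
sequence of `2k` points (if `D` has a crossing, there is exactly one such `k`), and `0` if `D` has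
no crossing (then there is no such `k`, and the infimum of the empty set is `0`). -/
noncomputable def b (D : KnotDiagram) : ℕ :=
  sInf {k : ℕ | 1 ≤ k ∧ ∃ s f : ℤ → ℝ, D.IsOverUnderpassSequence k s f}

/-- Two diagrams are equivalent if they are isotopic as oriented knots in space. -/
instance isotopySetoid : Setoid KnotDiagram where
  r D D' := D.toPolygonalKnot.Isotopic D'.toPolygonalKnot
  iseqv := ⟨fun D => .refl D.toPolygonalKnot, fun h => h.symm, fun h h' => h.trans h'⟩

end KnotDiagram

/-- A knot: an isotopy knot type `[D]` for some knot diagram `D`. -/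
abbrev Knot : Type := Quotient KnotDiagram.isotopySetoid

/-- `D` is a diagram of the knot `K`. -/
def KnotDiagram.IsDiagramOf (D : KnotDiagram) (K : Knot) : Prop := (⟦D⟧ : Knot) = K

namespace Knot

/-- The crossing number `c(K)`: the minimum of `c(D)` over all diagrams `D` of `K`. -/
noncomputable def c (K : Knot) : ℕ :=
  sInf {m : ℕ | ∃ D : KnotDiagram, D.IsDiagramOf K ∧ D.c = m}

/-- A knot is trivial if its members are isotopic to (the boundary of) a triangle. -/
def IsTrivial (K : Knot) : Prop :=
  ∃ D : KnotDiagram, D.IsDiagramOf K ∧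
    ∃ T : PolygonalKnot, T.n = 3 ∧ D.toPolygonalKnot.Isotopic T

end Knot

/-- `D` is a minimal diagram of `K` with respect to crossings. -/
def KnotDiagram.IsMinimalDiagramOf (D : KnotDiagram) (K : Knot) : Prop :=
  D.IsDiagramOf K ∧ D.c = K.c

end KnotDiag

/-! The upper bound is a count: every overpass contains an overcrossing, and a crossing has only
one. For the lower bound it is enough to show `c ≤ k * (k - 2)` for a sequence of `k` overpasses,
since then `(k - 1)² ≥ 1 + c`. Each crossing belongs to one overpass and one underpass, so this
follows if in a minimal diagram an overpass and an underpass cross at most once, and not at all if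
they are adjacent: every overpass then crosses at most `k - 2` underpasses.

Suppose this fails. Then there is a bigon: a piece of an overpass and a piece of an underpass with
the same end points in the projection, which are two crossings, or one crossing and the common end
point of adjacent passes. The upper piece runs above all the rest, so it can be moved, above all the
rest, over any simple polygonal path with the same end points; the lower piece can be moved likewise
underneath. Hence the two pieces can exchange their shadows (`IsRegularCurve.swap`). The projection
stays the same as a set, and so do its double points, however often the two pieces meet each other
or the rest. But at a crossing in a corner of the bigon the strands now only touch, the upper one
turning a corner; cutting that corner removes the double point (`IsRegularCurve.cut_corner`). The
knot has a diagram with fewer crossings (`exists_fewer_of_bigon`), a contradiction.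

The ambient isotopies are composed of homeomorphisms of `X × ℝ` that are increasing on every
vertical line, up to inverses and changes of coordinates; such a map is joined to the identity
linearly. They give the move across a triangle, then the replacement of a level arc by a cone with
an apex above it (`exists_cone_isotopy`). Two arcs with the same end points are moved to the same
cone, hence to each other (`exists_replace_over`). The intermediate curves have polygonal shadows
but only continuous heights. `IsRegularCurve.exists_diagram` returns to polygons: heights may be
changed freely as long as the order over each double point is kept.

Nontriviality enters through `exists_isotopic_triangle`: a diagram without crossings can be
flattened and coned to a triangle. So there are crossings, over-underpass sequences exist, and `b`
is attained by one of them. -/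

namespace KnotDiag

/-! ### Ambient isotopies and vertical motions -/

/-- A self-homeomorphism that is the end of an ambient isotopy. -/
def IsotopicToId {Y : Type*} [TopologicalSpace Y] (F : Y ≃ₜ Y) : Prop :=
  ∃ H : I → (Y ≃ₜ Y), Continuous (fun p : I × Y => H p.1 p.2) ∧ H 0 = Homeomorph.refl Y ∧ H 1 = F

namespace IsotopicToId

variable {Y Z : Type*} [TopologicalSpace Y] [TopologicalSpace Z]

theorem refl : IsotopicToId (Homeomorph.refl Y) :=
  ⟨fun _ => Homeomorph.refl Y, continuous_snd, rfl, rfl⟩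

theorem trans {F G : Y ≃ₜ Y} (hF : IsotopicToId F) (hG : IsotopicToId G) :
    IsotopicToId (F.trans G) := by
  obtain ⟨H, hc, h0, h1⟩ := hF
  obtain ⟨H', hc', h0', h1'⟩ := hG
  refine ⟨fun t => (H t).trans (H' t), hc'.comp (continuous_fst.prodMk hc), ?_, ?_⟩
  · simp only [h0, h0']; rfl
  · simp only [h1, h1']

theorem symm {F : Y ≃ₜ Y} (hF : IsotopicToId F) : IsotopicToId F.symm := by
  obtain ⟨H, hc, h0, h1⟩ := hF
  refine ⟨fun t => (H 1).symm.trans (H (unitInterval.symm t)), ?_, ?_, ?_⟩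
  · have : Continuous (fun p : I × Y => ((unitInterval.symm p.1, (H 1).symm p.2) : I × Y)) :=
      (unitInterval.continuous_symm.comp continuous_fst).prodMk
        ((H 1).symm.continuous.comp continuous_snd)
    exact hc.comp this
  · ext1 x; simp
  · ext1 x; simp [h0, h1]

theorem conj {F : Y ≃ₜ Y} (hF : IsotopicToId F) (e : Z ≃ₜ Y) :
    IsotopicToId ((e.trans F).trans e.symm) := by
  obtain ⟨H, hc, h0, h1⟩ := hF
  refine ⟨fun t => (e.trans (H t)).trans e.symm, ?_, ?_, ?_⟩
  · exact e.symm.continuous.comp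
      (hc.comp (continuous_fst.prodMk (e.continuous.comp continuous_snd)))
  · ext1 x; simp [h0]
  · simp only [h1]

end IsotopicToId

section Fiber

variable {X : Type*} [TopologicalSpace X]

/-- A continuous family of increasing bijections of the line is a homeomorphism of the product. -/
noncomputable def fiberHomeo (Φ : X × ℝ → ℝ) (hc : Continuous Φ)
    (hm : ∀ x, StrictMono fun y => Φ (x, y)) (hs : ∀ x, Function.Surjective fun y => Φ (x, y)) :
    (X × ℝ) ≃ₜ (X × ℝ) where
  toFun p := (p.1, Φ p)
  invFun p := (p.1, ((hm p.1).orderIsoOfSurjective _ (hs p.1)).symm p.2)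
  left_inv p := by
    ext1
    · rfl
    · exact ((hm p.1).orderIsoOfSurjective _ (hs p.1)).symm_apply_apply p.2
  right_inv p := by
    ext1
    · rfl
    · exact ((hm p.1).orderIsoOfSurjective _ (hs p.1)).apply_symm_apply p.2
  continuous_toFun := continuous_fst.prodMk hc
  continuous_invFun := by
    refine continuous_fst.prodMk ?_
    rw [continuous_iff_continuousAt]
    rintro ⟨x, z⟩
    set e := fun x => (hm x).orderIsoOfSurjective _ (hs x) with he
    have hap : ∀ x y, e x y = Φ (x, y) := fun x y => rfl
    change ContinuousAt (fun p : X × ℝ => (e p.1).symm p.2) (x, z)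
    -- The inverse is above `a` at `p` exactly if `Φ (p.1, a) < p.2`, an open condition on `p`;
    -- below likewise.
    rw [ContinuousAt, tendsto_order]
    refine ⟨fun a ha => ?_, fun a ha => ?_⟩
    · have h1 : Φ (x, a) < z := by
        rw [← hap]; exact (e x).lt_symm_apply.1 ha
      have h2 : IsOpen {p : X × ℝ | Φ (p.1, a) < p.2} :=
        isOpen_lt (hc.comp (continuous_fst.prodMk continuous_const)) continuous_snd
      filter_upwards [h2.mem_nhds h1] with p hp
      rw [(e p.1).lt_symm_apply, hap]; exact hp
    · have h1 : z < Φ (x, a) := by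
        rw [← hap]; exact (e x).symm_apply_lt.1 ha
      have h2 : IsOpen {p : X × ℝ | p.2 < Φ (p.1, a)} :=
        isOpen_lt continuous_snd (hc.comp (continuous_fst.prodMk continuous_const))
      filter_upwards [h2.mem_nhds h1] with p hp
      rw [(e p.1).symm_apply_lt, hap]; exact hp

@[simp] theorem fiberHomeo_apply (Φ : X × ℝ → ℝ) (hc : Continuous Φ)
    (hm : ∀ x, StrictMono fun y => Φ (x, y)) (hs : ∀ x, Function.Surjective fun y => Φ (x, y))
    (p : X × ℝ) : fiberHomeo Φ hc hm hs p = (p.1, Φ p) := rfl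

/-- If `f y = z`, then the combination takes values on both sides of `z` at `y` and at `z`, so it
attains `z` in between. This makes every stage of the linear isotopy a fibrewise bijection. -/
theorem StrictMono.surjective_lineCombination {f : ℝ → ℝ} (hm : StrictMono f)
    (hs : Function.Surjective f) (hc : Continuous f) {t : ℝ} (h0 : 0 ≤ t) (h1 : t ≤ 1) :
    StrictMono (fun y => (1 - t) * y + t * f y) ∧
      Function.Surjective (fun y => (1 - t) * y + t * f y) := by
  constructor
  · intro a b hab
    have := hm hab
    dsimp only
    rcases eq_or_lt_of_le h0 with h | h
    · subst h; simpa using hab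
    · nlinarith [mul_lt_mul_of_pos_left this h, mul_le_mul_of_nonneg_left hab.le (sub_nonneg.2 h1)]
  · have hcont : Continuous (fun y => (1 - t) * y + t * f y) := by fun_prop
    intro z
    obtain ⟨y, hy⟩ := hs z
    have key : ∀ a b : ℝ, a ≤ b → (1 - t) * a + t * f a ≤ z → z ≤ (1 - t) * b + t * f b →
        ∃ y, (1 - t) * y + t * f y = z := by
      intro a b hab h2 h3
      obtain ⟨w, _, hw⟩ := intermediate_value_Icc hab hcont.continuousOn ⟨h2, h3⟩
      exact ⟨w, hw⟩
    rcases le_total y z with h | h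
    · refine key y z h ?_ ?_
      · rw [hy]; nlinarith
      · have := hm.monotone h
        rw [hy] at this
        nlinarith
    · refine key z y h ?_ ?_
      · have := hm.monotone h
        rw [hy] at this
        nlinarith
      · rw [hy]; nlinarith

theorem isotopicToId_fiberHomeo (Φ : X × ℝ → ℝ) (hc : Continuous Φ)
    (hm : ∀ x, StrictMono fun y => Φ (x, y)) (hs : ∀ x, Function.Surjective fun y => Φ (x, y)) :
    IsotopicToId (fiberHomeo Φ hc hm hs) := by
  have hx : ∀ x, Continuous fun y => Φ (x, y) := fun x => hc.comp (by fun_prop)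
  refine ⟨fun t => fiberHomeo (fun p => (1 - (t : ℝ)) * p.2 + t * Φ p) (by fun_prop)
    (fun x => (StrictMono.surjective_lineCombination (hm x) (hs x) (hx x) t.2.1 t.2.2).1)
    (fun x => (StrictMono.surjective_lineCombination (hm x) (hs x) (hx x) t.2.1 t.2.2).2),
    ?_, ?_, ?_⟩
  · simp only [fiberHomeo_apply]
    fun_prop
  · ext1 p; simp
  · ext1 p; simp

end Fiber

/-- The vertical shear `(x, y) ↦ (x, y + g x)`. -/
theorem exists_shear {X : Type*} [TopologicalSpace X] (g : X → ℝ) (hg : Continuous g) :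
    ∃ F : (X × ℝ) ≃ₜ (X × ℝ), IsotopicToId F ∧ ∀ p, F p = (p.1, p.2 + g p.1) :=
  ⟨fiberHomeo (fun p => p.2 + g p.1) (by fun_prop) (fun x a b h => by simpa using h)
    (fun x z => ⟨z - g x, by simp⟩), isotopicToId_fiberHomeo _ _ _ _, fun _ => rfl⟩

/-- A continuous function that is nonpositive on the zeros of `r ≥ 0` is bounded by a modulus of
continuity in `r`. -/
theorem exists_modulus {X : Type*} [TopologicalSpace X] [CompactSpace X] (D r : X → ℝ)
    (hD : Continuous D) (hr : Continuous r) (hr0 : ∀ x, 0 ≤ r x) (h : ∀ x, r x = 0 → D x ≤ 0) :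
    ∃ ω : ℝ → ℝ, Continuous ω ∧ Monotone ω ∧ ω 0 = 0 ∧ ∀ x, D x ≤ ω (r x) := by
  rcases isEmpty_or_nonempty X with hX | hX
  · exact ⟨fun _ => 0, continuous_const, monotone_const, rfl, fun x => (hX.false x).elim⟩
  -- The modulus is `ω ρ = sup_x q ρ x`. The fraction increases with `ρ`, vanishes at `ρ = 0` and is
  -- `1` at `ρ = r x > 0`. It is singular only where `r x = 0`; there the positive part of `D`
  -- vanishes and `0 ≤ q ≤ max (D x) 0` gives continuity.
  let q : ℝ → X → ℝ := fun ρ x => max (D x) 0 * (max ρ 0 / max ρ (r x))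
  have hfrac : ∀ ρ x, 0 ≤ max ρ 0 / max ρ (r x) ∧ max ρ 0 / max ρ (r x) ≤ 1 := by
    intro ρ x
    have h1 : max ρ 0 ≤ max ρ (r x) := max_le_max le_rfl (hr0 x)
    have h2 : 0 ≤ max ρ 0 := le_max_right _ _
    exact ⟨div_nonneg h2 (h2.trans h1), div_le_one_of_le₀ h1 (h2.trans h1)⟩
  have hD0 : ∀ x, 0 ≤ max (D x) 0 := fun x => le_max_right _ _
  have hq0 : ∀ ρ x, 0 ≤ q ρ x := fun ρ x => mul_nonneg (hD0 x) (hfrac ρ x).1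
  have hq1 : ∀ ρ x, q ρ x ≤ max (D x) 0 := fun ρ x =>
    mul_le_of_le_one_right (hD0 x) (hfrac ρ x).2
  have hqc : Continuous (Function.uncurry q) := by
    rw [continuous_iff_continuousAt]
    rintro ⟨ρ, x⟩
    rcases (lt_or_ge 0 (max ρ (r x))) with hp | hp
    · have h1 : ContinuousAt (fun p : ℝ × X => max p.1 (r p.2)) (ρ, x) := by fun_prop
      have h2 : ContinuousAt (fun p : ℝ × X => max p.1 0) (ρ, x) := by fun_prop
      have h3 : ContinuousAt (fun p : ℝ × X => max (D p.2) 0) (ρ, x) := by fun_prop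
      exact h3.mul (h2.div h1 hp.ne')
    · have hrx : r x = 0 := le_antisymm ((le_max_right _ _).trans hp) (hr0 x)
      have hDx : max (D x) 0 = 0 := max_eq_right (h x hrx)
      have hz : Function.uncurry q (ρ, x) = 0 := le_antisymm ((hq1 ρ x).trans hDx.le) (hq0 ρ x)
      rw [ContinuousAt, hz]
      refine squeeze_zero (fun p => hq0 p.1 p.2) (fun p => hq1 p.1 p.2) ?_
      have h3 : ContinuousAt (fun p : ℝ × X => max (D p.2) 0) (ρ, x) := by fun_prop
      rw [ContinuousAt, hDx] at h3
      exact h3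
  have hbdd : ∀ ρ, BddAbove (q ρ '' Set.univ) := fun ρ =>
    (isCompact_univ.image (by fun_prop)).bddAbove
  refine ⟨fun ρ => sSup (q ρ '' Set.univ), isCompact_univ.continuous_sSup hqc, ?_, ?_, ?_⟩
  · intro a b hab
    refine csSup_le (Set.univ_nonempty.image _) ?_
    rintro _ ⟨x, -, rfl⟩
    refine le_trans ?_ (le_csSup (hbdd b) ⟨x, trivial, rfl⟩)
    refine mul_le_mul_of_nonneg_left ?_ (hD0 x)
    rcases le_or_gt a 0 with ha | ha
    · rw [max_eq_right ha, zero_div]; exact (hfrac b x).1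
    · have hb : 0 < b := ha.trans_le hab
      have h1 : 0 < max a (r x) := lt_max_of_lt_left ha
      have h2 : 0 < max b (r x) := lt_max_of_lt_left hb
      rw [max_eq_left ha.le, max_eq_left hb.le, div_le_div_iff₀ h1 h2]
      rcases le_total b (r x) with h3 | h3
      · rw [max_eq_right h3, max_eq_right (hab.trans h3)]
        exact mul_le_mul_of_nonneg_right hab (hr0 x)
      · rw [max_eq_left h3, mul_comm]
        refine mul_le_mul_of_nonneg_left (le_max_left _ _) hb.le
  · have : q 0 = fun _ => 0 := by
      funext x
      simp [q]
    simp [this]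
  · intro x
    refine le_trans ?_ (le_csSup (hbdd (r x)) ⟨x, trivial, rfl⟩)
    rcases eq_or_lt_of_le (hr0 x) with h0 | h0
    · exact (h x h0.symm).trans (hq0 _ _)
    · simp only [q, max_self, max_eq_left h0.le, div_self h0.ne', mul_one]
      exact le_max_left _ _


theorem Monotone.strictMono_surjective_add_mul {f : ℝ → ℝ} (hf : Monotone f) (hc : Continuous f)
    {ε : ℝ} (hε : 0 < ε) : StrictMono (fun y => ε * y + f y) ∧
      Function.Surjective (fun y => ε * y + f y) := by
  refine ⟨fun a b h => ?_, fun z => ?_⟩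
  · have := hf h.le
    have := mul_lt_mul_of_pos_left h hε
    dsimp only; linarith
  · set M := |z - f 0| / ε with hM
    have hM0 : 0 ≤ M := by positivity
    have hεM : ε * M = |z - f 0| := by rw [hM]; field_simp
    have h1 := hf hM0
    have h2 := hf (neg_nonpos.2 hM0)
    have hcont : Continuous (fun y => ε * y + f y) := by fun_prop
    obtain ⟨w, _, hw⟩ := intermediate_value_Icc (by linarith : -M ≤ M) hcont.continuousOn
      (show z ∈ Set.Icc _ _ from ⟨by have := neg_abs_le (z - f 0); nlinarith,
        by have := le_abs_self (z - f 0); nlinarith⟩)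
    exact ⟨w, hw⟩

/-- Changing the heights of a compact family of points without reversing their vertical order is
an ambient isotopy. -/
theorem exists_vertical_isotopy {S X : Type*} [TopologicalSpace S] [CompactSpace S]
    [PseudoMetricSpace X] [T0Space X] (sh : S → X) (h h' : S → ℝ)
    (hsh : Continuous sh) (hh : Continuous h)
    (hh' : Continuous h') {ε : ℝ} (hε : 0 < ε)
    (H : ∀ s t, sh s = sh t → h s ≤ h t → ε * (h t - h s) ≤ h' t - h' s) :
    ∃ F : (X × ℝ) ≃ₜ (X × ℝ), IsotopicToId F ∧ ∀ s, F (sh s, h s) = (sh s, h' s) := by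
  rcases isEmpty_or_nonempty S with hS | hS
  · exact ⟨_, IsotopicToId.refl, fun s => (hS.false s).elim⟩
  -- By `H` the function `h' - ε * h` does not decrease upwards along a vertical line. The modulus
  -- makes this quantitative: going from `s` to `t`, it grows by at most `ω` of horizontal distance
  -- plus ascent.
  obtain ⟨ω, hω, hωm, hω0, hωD⟩ := exists_modulus (X := S × S)
    (fun p => (h' p.2 - ε * h p.2) - (h' p.1 - ε * h p.1))
    (fun p => dist (sh p.2) (sh p.1) + max (h p.2 - h p.1) 0) (by fun_prop) (by fun_prop)
    (fun p => by positivity) (by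
      rintro ⟨s, t⟩ hp
      dsimp only at hp ⊢
      have h1 : 0 ≤ dist (sh t) (sh s) := dist_nonneg
      have h2 : 0 ≤ max (h t - h s) 0 := le_max_right _ _
      have h3 : dist (sh t) (sh s) = 0 := by linarith
      have h4 : max (h t - h s) 0 = 0 := by linarith
      have h5 := H t s (by
        exact (Metric.inseparable_iff.2 h3).eq) (by linarith [le_max_left (h t - h s) 0])
      nlinarith)
  -- Extension of `h' - ε * h` from the compact family to all of `X × ℝ` as an infimum over `s`, in
  -- the manner of McShane. Counting only ascent makes it monotone in the height; adding `ε * y`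
  -- back makes it strictly increasing and onto.
  let q : X × ℝ → S → ℝ := fun p s =>
    (h' s - ε * h s) + ω (dist p.1 (sh s) + max (p.2 - h s) 0)
  have hqc : Continuous (Function.uncurry q) := by
    have : Function.uncurry q = fun p : (X × ℝ) × S =>
      (h' p.2 - ε * h p.2) + ω (dist p.1.1 (sh p.2) + max (p.1.2 - h p.2) 0) := rfl
    rw [this]; fun_prop
  have hqs : ∀ p, Continuous (q p) := fun p =>
    hqc.comp (continuous_const.prodMk continuous_id)
  have hbdd : ∀ p, BddBelow (q p '' Set.univ) := fun p =>
    (isCompact_univ.image (hqs p)).bddBelow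
  let Φ0 : X × ℝ → ℝ := fun p => sInf (q p '' Set.univ)
  have hΦ0 : Continuous Φ0 := isCompact_univ.continuous_sInf hqc
  have hmono : ∀ x, Monotone fun y => Φ0 (x, y) := by
    intro x a b hab
    refine le_csInf (Set.univ_nonempty.image _) ?_
    rintro _ ⟨s, -, rfl⟩
    refine (csInf_le (hbdd _) ⟨s, trivial, rfl⟩).trans ?_
    have : max (a - h s) 0 ≤ max (b - h s) 0 := max_le_max (by linarith) le_rfl
    exact add_le_add le_rfl (hωm (by dsimp only; linarith))
  have hval : ∀ s, Φ0 (sh s, h s) = h' s - ε * h s := by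
    intro s
    apply le_antisymm
    · refine (csInf_le (hbdd _) ⟨s, trivial, rfl⟩).trans ?_
      simp [q, hω0]
    · refine le_csInf (Set.univ_nonempty.image _) ?_
      rintro _ ⟨t, -, rfl⟩
      have := hωD (t, s)
      simp only [q]
      simp only at this
      linarith
  have hcx : ∀ x, Continuous fun y => Φ0 (x, y) := fun x => hΦ0.comp (by fun_prop)
  refine ⟨fiberHomeo (fun p => ε * p.2 + Φ0 p) (by fun_prop)
    (fun x => (Monotone.strictMono_surjective_add_mul (hmono x) (hcx x) hε).1)
    (fun x => (Monotone.strictMono_surjective_add_mul (hmono x) (hcx x) hε).2),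
    isotopicToId_fiberHomeo _ _ _ _, fun s => ?_⟩
  simp [hval]

/-! ### The elementary move across a triangle -/

/-- The tent function on the unit interval with peak `1` at `l`. -/
noncomputable def tent (l x : ℝ) : ℝ := max 0 (min (x / l) ((1 - x) / (1 - l)))

theorem continuous_tent (l : ℝ) : Continuous (tent l) := by unfold tent; fun_prop

theorem tent_nonneg (l x : ℝ) : 0 ≤ tent l x := le_max_left _ _

theorem tent_pos_iff {l x : ℝ} (h0 : 0 < l) (h1 : l < 1) : 0 < tent l x ↔ 0 < x ∧ x < 1 := by
  have : 0 < 1 - l := by linarith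
  simp [tent, div_pos_iff_of_pos_right, h0, this]

/-- The displacement that pushes `y = 0` up to `y = g x`, supported in a box around it. -/
noncomputable def bump (g u : ℝ → ℝ) (p : (ℝ × ℝ) × ℝ) : ℝ :=
  g p.1.1 * max 0 (1 - |p.1.2| / u p.1.1) *
    max 0 (min (1 + p.2 / u p.1.1) (1 - p.2 / (g p.1.1 + u p.1.1)))

section Bump

variable {g u : ℝ → ℝ}

theorem bump_nonneg (hg0 : ∀ x, 0 ≤ g x) (p) : 0 ≤ bump g u p :=
  mul_nonneg (mul_nonneg (hg0 _) (le_max_left _ _)) (le_max_left _ _)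

theorem bump_le (hg0 : ∀ x, 0 ≤ g x) (hu0 : ∀ x, 0 ≤ u x) (p) : bump g u p ≤ g p.1.1 := by
  obtain ⟨⟨x, z⟩, y⟩ := p
  have hx := hu0 x
  have hgx := hg0 x
  have h1 : max 0 (1 - |z| / u x) ≤ 1 := by
    have : 0 ≤ |z| / u x := div_nonneg (abs_nonneg z) hx
    exact max_le zero_le_one (by linarith)
  have h2 : max 0 (min (1 + y / u x) (1 - y / (g x + u x))) ≤ 1 := by
    refine max_le zero_le_one ?_
    rcases le_total 0 y with hy | hy
    · have : 0 ≤ y / (g x + u x) := div_nonneg hy (by linarith)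
      exact (min_le_right _ _).trans (by linarith)
    · have : y / u x ≤ 0 := div_nonpos_of_nonpos_of_nonneg hy hx
      exact (min_le_left _ _).trans (by linarith)
  exact (mul_le_of_le_one_right (mul_nonneg hgx (le_max_left _ _)) h2).trans
    (mul_le_of_le_one_right hgx h1)

/-- Where `g` vanishes, `u` may vanish as well and the quotients lose meaning; there `0 ≤ bump ≤ g`
gives continuity. -/
theorem continuous_bump (hgc : Continuous g) (huc : Continuous u) (hg0 : ∀ x, 0 ≤ g x)
    (hu0 : ∀ x, 0 ≤ u x) (hupos : ∀ x, 0 < g x → 0 < u x) : Continuous (bump g u) := by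
  rw [continuous_iff_continuousAt]
  rintro ⟨⟨x, z⟩, y⟩
  rcases eq_or_lt_of_le (hg0 x) with hx | hx
  · have hz : bump g u ((x, z), y) = 0 :=
      le_antisymm ((bump_le hg0 hu0 _).trans hx.ge) (bump_nonneg hg0 _)
    rw [ContinuousAt, hz]
    refine squeeze_zero (bump_nonneg hg0) (bump_le hg0 hu0) ?_
    have h3 : ContinuousAt (fun p : (ℝ × ℝ) × ℝ => g p.1.1) ((x, z), y) := by fun_prop
    rw [ContinuousAt] at h3
    simpa only [← hx] using h3
  · have hux := hupos x hx
    have e1 : ContinuousAt (fun p : (ℝ × ℝ) × ℝ => |p.1.2| / u p.1.1) ((x, z), y) :=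
      ContinuousAt.div (by fun_prop) (by fun_prop) hux.ne'
    have e2 : ContinuousAt (fun p : (ℝ × ℝ) × ℝ => p.2 / u p.1.1) ((x, z), y) :=
      ContinuousAt.div (by fun_prop) (by fun_prop) hux.ne'
    have e3 : ContinuousAt (fun p : (ℝ × ℝ) × ℝ => p.2 / (g p.1.1 + u p.1.1)) ((x, z), y) :=
      ContinuousAt.div (by fun_prop) (by fun_prop) (by dsimp only; linarith)
    have e4 : ContinuousAt (fun p : (ℝ × ℝ) × ℝ => g p.1.1) ((x, z), y) := by fun_prop
    exact (e4.mul (continuousAt_const.max (continuousAt_const.sub e1))).mul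
      (continuousAt_const.max ((continuousAt_const.add e2).min (continuousAt_const.sub e3)))

/-- In `y` the last factor falls with slope at most `1 / (g + u)`, and it is multiplied by at most
`g`; the loss `g / (g + u) < 1` is outweighed by the summand `y`. -/
theorem strictMono_add_bump (hg0 : ∀ x, 0 ≤ g x) (hupos : ∀ x, 0 < g x → 0 < u x) (b : ℝ × ℝ) :
    StrictMono fun y => y + bump g u (b, y) := by
  obtain ⟨x, z⟩ := b
  intro y₁ y₂ hy
  rcases eq_or_lt_of_le (hg0 x) with hx | hx
  · simpa [bump, ← hx] using hy
  have hux := hupos x hx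
  have hgu : 0 < g x + u x := by linarith
  obtain ⟨τ, hτ⟩ : ∃ τ, τ = g x * max 0 (1 - |z| / u x) := ⟨_, rfl⟩
  have hτ0 : 0 ≤ τ := hτ ▸ mul_nonneg (hg0 x) (le_max_left _ _)
  have hτg : τ ≤ g x := by
    have : 0 ≤ |z| / u x := div_nonneg (abs_nonneg z) hux.le
    exact hτ ▸ mul_le_of_le_one_right (hg0 x) (max_le zero_le_one (by linarith))
  obtain ⟨m, hm⟩ : ∃ m : ℝ → ℝ, m = fun y => max 0 (min (1 + y / u x) (1 - y / (g x + u x))) :=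
    ⟨_, rfl⟩
  have hb : ∀ y, bump g u ((x, z), y) = τ * m y := fun y => by rw [hτ, hm]; rfl
  have key : m y₁ - m y₂ ≤ (y₂ - y₁) / (g x + u x) := by
    have hpos : 0 ≤ (y₂ - y₁) / (g x + u x) := div_nonneg (by linarith) hgu.le
    have hdu : y₁ / u x ≤ y₂ / u x := div_le_div_of_nonneg_right hy.le hux.le
    rw [sub_div] at hpos ⊢
    rw [hm]
    dsimp only
    rcases le_total (1 + y₂ / u x) (1 - y₂ / (g x + u x)) with hc | hc
    · have : max 0 (min (1 + y₁ / u x) (1 - y₁ / (g x + u x))) ≤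
          max 0 (min (1 + y₂ / u x) (1 - y₂ / (g x + u x))) := by
        refine max_le_max le_rfl ?_
        rw [min_eq_left hc]
        exact (min_le_left _ _).trans (by linarith)
      linarith
    · rw [min_eq_right hc]
      have e2 : max 0 (min (1 + y₁ / u x) (1 - y₁ / (g x + u x))) ≤
        max 0 (1 - y₁ / (g x + u x)) := max_le_max le_rfl (min_le_right _ _)
      have e3 : max 0 (1 - y₁ / (g x + u x)) ≤
          max 0 (1 - y₂ / (g x + u x)) + (y₂ / (g x + u x) - y₁ / (g x + u x)) := by
        refine max_le ?_ ?_
        · have := le_max_left 0 (1 - y₂ / (g x + u x)); linarith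
        · have := le_max_right 0 (1 - y₂ / (g x + u x)); linarith
      linarith
  have e1 : τ * (m y₁ - m y₂) ≤ τ * ((y₂ - y₁) / (g x + u x)) :=
    mul_le_mul_of_nonneg_left key hτ0
  have e2 : τ * ((y₂ - y₁) / (g x + u x)) < y₂ - y₁ := by
    rw [← mul_div_assoc, div_lt_iff₀ hgu, mul_comm]
    exact mul_lt_mul_of_pos_left (by linarith) (by linarith)
  dsimp only
  rw [hb, hb]
  linarith [mul_sub τ (m y₁) (m y₂)]

theorem surjective_add_bump (hgc : Continuous g) (huc : Continuous u) (hg0 : ∀ x, 0 ≤ g x)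
    (hu0 : ∀ x, 0 ≤ u x) (hupos : ∀ x, 0 < g x → 0 < u x) (b : ℝ × ℝ) :
    Function.Surjective fun y => y + bump g u (b, y) := by
  intro w
  have hb := continuous_bump hgc huc hg0 hu0 hupos
  have hc : Continuous fun y => y + bump g u (b, y) :=
    continuous_id.add (hb.comp (continuous_const.prodMk continuous_id))
  obtain ⟨y, -, hy⟩ := intermediate_value_Icc (by linarith [hg0 b.1] : w - g b.1 ≤ w)
    hc.continuousOn (show w ∈ Set.Icc _ _ from
      ⟨by have := bump_le hg0 hu0 (b, w - g b.1); dsimp only at this ⊢; linarith,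
       by have := bump_nonneg (u := u) hg0 (b, w); linarith⟩)
  exact ⟨y, hy⟩

theorem bump_eq_zero {x y z : ℝ} (hgx : 0 < g x) (hux : 0 < u x)
    (h : ¬ (|z| < u x ∧ -u x < y ∧ y < g x + u x)) : bump g u ((x, z), y) = 0 := by
  by_contra hne
  refine h ⟨?_, ?_, ?_⟩
  · by_contra hz
    refine hne ?_
    have : 1 ≤ |z| / u x := (one_le_div hux).2 (not_lt.1 hz)
    rw [bump]
    dsimp only
    rw [max_eq_left (by linarith), mul_zero, zero_mul]
  · by_contra hy
    refine hne (mul_eq_zero_of_right _ (max_eq_left ((min_le_left _ _).trans ?_)))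
    have : y / u x ≤ -1 := by rw [div_le_iff₀ hux]; linarith
    dsimp only
    linarith
  · by_contra hy
    refine hne (mul_eq_zero_of_right _ (max_eq_left ((min_le_right _ _).trans ?_)))
    have : 1 ≤ y / (g x + u x) := (one_le_div (by linarith)).2 (not_lt.1 hy)
    dsimp only
    linarith

end Bump

/-- The straight segment of the unit interval in the plane of the first and last coordinate is
pushed to the graph of the tent function, keeping fixed a closed set that meets the triangle
between them only in the end points. -/
theorem exists_push_tent {l : ℝ} (h0 : 0 < l) (h1 : l < 1) (R : Set ((ℝ × ℝ) × ℝ))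
    (hRc : IsClosed R) (hRn : R.Nonempty)
    (hR : ∀ x y, 0 < x → x < 1 → 0 ≤ y → y ≤ tent l x → ((x, 0), y) ∉ R) :
    ∃ F : ((ℝ × ℝ) × ℝ) ≃ₜ ((ℝ × ℝ) × ℝ), IsotopicToId F ∧ (∀ p ∈ R, F p = p) ∧
      ∀ x, F ((x, 0), 0) = ((x, 0), tent l x) := by
  have hgc : Continuous (tent l) := continuous_tent l
  have hg0 : ∀ x, 0 ≤ tent l x := tent_nonneg l
  obtain ⟨q, hqd⟩ : ∃ q : ℝ → ℝ → ℝ, q = fun x t =>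
    Metric.infDist (((x, 0), t * tent l x) : (ℝ × ℝ) × ℝ) R := ⟨_, rfl⟩
  have hq : Continuous (Function.uncurry q) := by
    have : Function.uncurry q = fun p : ℝ × ℝ =>
      Metric.infDist (((p.1, 0), p.2 * tent l p.1) : (ℝ × ℝ) × ℝ) R := by rw [hqd]; rfl
    rw [this]
    exact (Metric.continuous_infDist_pt R).comp (by fun_prop)
  -- The distance from `R` to the vertical segment of the triangle over `x`: the bump then acts only
  -- within distance `u x` of that segment and cannot reach `R`.
  obtain ⟨u, hud⟩ : ∃ u : ℝ → ℝ, u = fun x => sInf (q x '' Set.Icc 0 1) := ⟨_, rfl⟩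
  have hu : Continuous u := by rw [hud]; exact isCompact_Icc.continuous_sInf hq
  have hqx : ∀ x, Continuous (q x) := fun x =>
    hq.comp (continuous_const.prodMk continuous_id)
  have hule : ∀ x t, 0 ≤ t → t ≤ 1 → u x ≤ q x t := fun x t ht ht' => by
    rw [hud]; exact csInf_le (isCompact_Icc.image (hqx x)).bddBelow ⟨t, ⟨ht, ht'⟩, rfl⟩
  have hupos : ∀ x, 0 < tent l x → 0 < u x := by
    intro x hx
    obtain ⟨hx0, hx1⟩ := (tent_pos_iff h0 h1).1 hx
    obtain ⟨t, ht, hte⟩ := isCompact_Icc.exists_sInf_image_eq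
      (Set.nonempty_Icc.2 (zero_le_one' ℝ)) (hqx x).continuousOn
    rw [hud]
    dsimp only
    rw [hte, hqd]
    refine (hRc.notMem_iff_infDist_pos hRn).1 ?_
    exact hR x _ hx0 hx1 (mul_nonneg ht.1 (hg0 x)) (mul_le_of_le_one_left (hg0 x) ht.2)
  have hu0 : ∀ x, 0 ≤ u x := by
    intro x
    rw [hud]
    refine le_csInf ((Set.nonempty_Icc.2 (zero_le_one' ℝ)).image _) ?_
    rintro _ ⟨t, -, rfl⟩
    rw [hqd]
    exact Metric.infDist_nonneg
  have hbc := continuous_bump hgc hu hg0 hu0 hupos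
  refine ⟨fiberHomeo (fun p => p.2 + bump (tent l) u p) (continuous_snd.add hbc)
    (strictMono_add_bump hg0 hupos) (surjective_add_bump hgc hu hg0 hu0 hupos),
    isotopicToId_fiberHomeo _ _ _ _, ?_, ?_⟩
  · rintro ⟨⟨x, z⟩, y⟩ hp
    suffices hd : bump (tent l) u ((x, z), y) = 0 by simp [hd]
    rcases eq_or_lt_of_le (hg0 x) with hgx | hgx
    · simp [bump, ← hgx]
    have hux := hupos x hgx
    refine bump_eq_zero hgx hux ?_
    rintro ⟨hz, hy1, hy2⟩
    -- The height in the segment over `x` that is closest to `y`; in the maximum metric the box of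
    -- the bump is within `u x` of the segment.
    obtain ⟨c, hc⟩ : ∃ c, c = max 0 (min y (tent l x)) := ⟨_, rfl⟩
    have hc0 : 0 ≤ c := hc ▸ le_max_left _ _
    have hcg : c ≤ tent l x := hc ▸ max_le hgx.le (min_le_right _ _)
    have hcy : |c - y| < u x := by
      rw [hc, abs_lt]
      rcases le_total y (tent l x) with h | h
      · rw [min_eq_left h]
        rcases le_total 0 y with h' | h'
        · rw [max_eq_right h']; constructor <;> linarith
        · rw [max_eq_left h']; constructor <;> linarith
      · rw [min_eq_right h, max_eq_right hgx.le]; constructor <;> linarith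
    have h3 := hule x (c / tent l x) (div_nonneg hc0 hgx.le) ((div_le_one hgx).2 hcg)
    have h4 : q x (c / tent l x) ≤ dist (((x, 0), c) : (ℝ × ℝ) × ℝ) ((x, z), y) := by
      rw [hqd]
      dsimp only
      rw [div_mul_cancel₀ _ hgx.ne']
      exact Metric.infDist_le_dist_of_mem hp
    have h5 : dist (((x, 0), c) : (ℝ × ℝ) × ℝ) ((x, z), y) < u x := by
      simp only [Prod.dist_eq, dist_self, Real.dist_eq, zero_sub, abs_neg]
      exact max_lt (max_lt hux hz) hcy
    linarith
  · intro x
    simp [bump]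

open Module in
/-- The elementary move across a triangle `a b c`: the edge from `a` to `b` is carried to the path
from `a` through `c` to `b`, the point at fraction `l` to `c`, keeping fixed a closed set that meets
the triangle only in `a` and `b`. -/
theorem exists_triangle_move {a b c : Space} (hli : LinearIndependent ℝ ![b - a, c - a]) {l : ℝ}
    (h0 : 0 < l) (h1 : l < 1) (R : Set Space) (hRc : IsClosed R)
    (hR : ∀ β γ : ℝ, 0 ≤ β → 0 ≤ γ → β + γ ≤ 1 → a + β • (b - a) + γ • (c - a) ∈ R →
      γ = 0 ∧ (β = 0 ∨ β = 1)) :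
    ∃ F : Space ≃ₜ Space, IsotopicToId F ∧ (∀ p ∈ R, F p = p) ∧
      (∀ r, 0 ≤ r → r ≤ l → F (a + r • (b - a)) = a + (r / l) • (c - a)) ∧
      ∀ r, l ≤ r → r ≤ 1 → F (a + r • (b - a)) = c + ((r - l) / (1 - l)) • (b - c) := by
  have hl1 : 0 < 1 - l := by linarith
  -- `Metric.infDist` to the empty set is `0`, so an empty `R` is replaced by `{a}`.
  wlog hRn : R.Nonempty generalizing R
  · obtain ⟨F, hF1, -, hF3⟩ := this {a} isClosed_singleton (by
      intro β γ _ _ _ hm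
      have : β • (b - a) + γ • (c - a) = 0 := by
        rw [Set.mem_singleton_iff, add_assoc, add_eq_left] at hm; exact hm
      obtain ⟨rfl, rfl⟩ := LinearIndependent.pair_iff.1 hli β γ this
      simp) (Set.singleton_nonempty a)
    exact ⟨F, hF1, fun p hp => (hRn ⟨p, hp⟩).elim, hF3⟩
  set w := c - a - l • (b - a) with hw
  have hli2 : LinearIndependent ℝ ![b - a, w] := by
    rw [LinearIndependent.pair_iff] at hli ⊢
    intro s t hst
    obtain ⟨h2, h3⟩ := hli (s - t * l) t (by rw [← hst, hw]; module)
    subst h3; exact ⟨by linarith, rfl⟩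
  obtain ⟨n, hn⟩ := exists_linearIndependent_cons_of_lt_finrank hli2 (by
    simp [Module.finrank_prod])
  let B := basisOfLinearIndependentOfCardEqFinrank hn (by simp [Module.finrank_prod])
  have hB : ⇑B = Fin.cons n ![b - a, w] := coe_basisOfLinearIndependentOfCardEqFinrank _ _
  let L := B.equivFun
  have hLs : ∀ f, L.symm f = f 0 • n + f 1 • (b - a) + f 2 • w := by
    intro f
    simp only [L, Basis.equivFun_symm_apply, hB]
    exact Fin.sum_univ_three _
  have hLc : Continuous L := L.toLinearMap.continuous_of_finiteDimensional
  have hLsc : Continuous L.symm := L.symm.toLinearMap.continuous_of_finiteDimensional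
  let e : Space ≃ₜ ((ℝ × ℝ) × ℝ) :=
    { toFun := fun p => ((L (p - a) 1, L (p - a) 0), L (p - a) 2)
      invFun := fun q => a + L.symm ![q.1.2, q.1.1, q.2]
      left_inv := fun p => by
        have : ![L (p - a) 0, L (p - a) 1, L (p - a) 2] = L (p - a) := by
          ext i; fin_cases i <;> rfl
        simp only [this, L.symm_apply_apply]
        abel
      right_inv := fun q => by
        simp
      continuous_toFun := by
        have : Continuous fun p : Space => L (p - a) := hLc.comp (by fun_prop)
        fun_prop
      continuous_invFun := by
        refine continuous_const.add (hLsc.comp ?_)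
        refine continuous_pi fun i => ?_
        fin_cases i <;> simp <;> fun_prop }
  have hes : ∀ x z y, e.symm ((x, z), y) = a + (z • n + x • (b - a) + y • w) := by
    intro x z y
    change a + L.symm ![z, x, y] = _
    rw [hLs]
    simp
  obtain ⟨F, hF, hFR, hFx⟩ := exists_push_tent h0 h1 (e.symm ⁻¹' R)
    (hRc.preimage e.symm.continuous) (hRn.preimage e.symm.surjective) (by
      intro x y hx hx' hy hyt hm
      have hy1 : y ≤ max 0 (min (x / l) ((1 - x) / (1 - l))) := hyt
      rw [max_eq_right (by rw [le_min_iff]; constructor <;> apply div_nonneg <;> linarith),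
        le_min_iff, le_div_iff₀ h0, le_div_iff₀ hl1] at hy1
      rw [Set.mem_preimage, hes] at hm
      -- The coordinates `(x, y)` along `b - a` and `w` are rewritten along `b - a` and `c - a`.
      obtain ⟨h5, h6⟩ := hR (x - l * y) y (by nlinarith) hy (by nlinarith) (by
        convert hm using 1
        rw [hw]; module)
      subst h5
      rcases h6 with h6 | h6 <;> linarith)
  have hval : ∀ r, e ( a + r • (b - a)) = ((r, 0), 0) := by
    intro r
    rw [← e.apply_symm_apply ((r, 0), 0), hes]
    congr 1
    module
  refine ⟨(e.trans F).trans e.symm, hF.conj e, ?_, ?_, ?_⟩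
  · intro p hp
    have := hFR (e p) (by simpa using hp)
    simp [this]
  · intro r hr hr'
    have ht : tent l r = r / l := by
      have e1 : r / l ≤ 1 := (div_le_one h0).2 hr'
      have e2 : 1 ≤ (1 - r) / (1 - l) := (one_le_div hl1).2 (by linarith)
      rw [tent, min_eq_left (e1.trans e2), max_eq_right (div_nonneg hr h0.le)]
    simp only [Homeomorph.trans_apply, hval, hFx, hes, ht, hw]
    have : r = r / l * l := by field_simp
    match_scalars <;> first | ring1 | (field_simp; try ring1)
  · intro r hr hr'
    have ht : tent l r = (1 - r) / (1 - l) := by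
      have e1 : 1 ≤ r / l := (one_le_div h0).2 hr
      have e2 : (1 - r) / (1 - l) ≤ 1 := (div_le_one hl1).2 (by linarith)
      rw [tent, min_eq_right (e2.trans e1), max_eq_right (div_nonneg (by linarith) hl1.le)]
    simp only [Homeomorph.trans_apply, hval, hFx, hes, ht, hw]
    match_scalars <;> (field_simp; try ring1)


/-! ### Polygonal arcs and cones over them -/

/-- `f` is affine on every subinterval of `[a, b]` without interior point in `B`. -/
def PLOn {E : Type*} [AddCommGroup E] [Module ℝ E] (f : ℝ → E) (B : Set ℝ) (a b : ℝ) : Prop :=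
  ∀ c d, a ≤ c → c < d → d ≤ b → (∀ x ∈ B, ¬(c < x ∧ x < d)) →
    ∀ s ∈ Set.Icc c d, f s = AffineMap.lineMap (k := ℝ) (f c) (f d) ((s - c) / (d - c))

theorem PLOn.affine_comb {E : Type*} [AddCommGroup E] [Module ℝ E] {f : ℝ → E} {B : Set ℝ}
    {a b c d : ℝ} (h : PLOn f B a b) (hac : a ≤ c) (hcd : c < d) (hdb : d ≤ b)
    (hB : ∀ x ∈ B, ¬(c < x ∧ x < d)) {r : ℝ} (h0 : 0 ≤ r) (h1 : r ≤ 1) :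
    f (c + r * (d - c)) = f c + r • (f d - f c) := by
  rw [h c d hac hcd hdb hB _ ⟨by nlinarith, by nlinarith⟩, AffineMap.lineMap_apply_module',
    add_sub_cancel_left, mul_div_cancel_right₀ _ (by linarith), add_comm]

/-- A level arc can be replaced by the two edges to an apex above it, keeping fixed a closed set
that is not above the level and meets the arc at most in its end points. -/
theorem exists_cone_isotopy {A : ℝ → Plane} (hA : Continuous A) {a b : ℝ} (hab : a < b)
    {B : Set ℝ} (hB : B.Finite) (hPL : PLOn A B a b) (hinj : Set.InjOn A (Set.Icc a b))
    {R : Set Space} (hRc : IsClosed R) (hR : ∀ p ∈ R, p.2 ≤ 0)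
    (hRA : ∀ s ∈ Set.Icc a b, ((A s, 0) : Space) ∈ R → s = a ∨ s = b) (z : Plane) :
    ∃ m₀, a < m₀ ∧ m₀ ≤ b ∧ ∀ m, a < m → m < m₀ → ∃ F : Space ≃ₜ Space, IsotopicToId F ∧
      (∀ p ∈ R, F p = p) ∧
      (∀ s ∈ Set.Icc a m, F (A s, 0) =
        AffineMap.lineMap (k := ℝ) ((A a, 0) : Space) (z, 1) ((s - a) / (m - a))) ∧
      ∀ s ∈ Set.Icc m b, F (A s, 0) =
        AffineMap.lineMap (k := ℝ) ((z, 1) : Space) (A b, 0) ((s - m) / (b - m)) := by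
  have hcurve : ∀ t, IsClosed ((fun s => ((A s, 0) : Space)) '' Set.Icc t b) := fun t =>
    (isCompact_Icc.image (by fun_prop)).isClosed
  obtain ⟨t₁, ht₁, ht₁b, ht₁B⟩ : ∃ t₁, a < t₁ ∧ t₁ ≤ b ∧ ∀ x ∈ B, ¬(a < x ∧ x < t₁) := by
    have hfin : (insert b (B ∩ Set.Ioc a b)).Finite := (hB.inter_of_left _).insert b
    obtain ⟨t, ht, htm⟩ := hfin.exists_minimal (Set.insert_nonempty _ _)
    have htmem : a < t ∧ t ≤ b := by
      rcases ht with rfl | ht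
      · exact ⟨hab, le_rfl⟩
      · exact ht.2
    refine ⟨t, htmem.1, htmem.2, fun x hx hxt => ?_⟩
    exact absurd (htm (Set.mem_insert_of_mem _ ⟨hx, hxt.1, hxt.2.le.trans htmem.2⟩) hxt.2.le)
      (not_le.2 hxt.2)
  -- The parameter `m` of the apex may be any interior parameter of the first edge; this freedom
  -- allows two arcs to be coned with the same `m`. Below, `P t` says that the part up to `t` has
  -- become the two edges from `A a` over the apex to `A t`, while the part after `t` is untouched.
  refine ⟨t₁, ht₁, ht₁b, fun m ham hmt => ?_⟩
  let P : ℝ → Prop := fun t => ∃ F : Space ≃ₜ Space, IsotopicToId F ∧ (∀ p ∈ R, F p = p) ∧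
      (∀ s ∈ Set.Icc a m, F (A s, 0) =
        AffineMap.lineMap (k := ℝ) ((A a, 0) : Space) (z, 1) ((s - a) / (m - a))) ∧
      (∀ s ∈ Set.Icc m t, F (A s, 0) =
        AffineMap.lineMap (k := ℝ) ((z, 1) : Space) (A t, 0) ((s - m) / (t - m))) ∧
      ∀ s ∈ Set.Icc t b, F (A s, 0) = (A s, 0)
  have hbase : P t₁ := by
    have hne : A t₁ - A a ≠ 0 := fun h => ht₁.ne' (hinj ⟨ht₁.le, ht₁b⟩ ⟨le_rfl, hab.le⟩
      (sub_eq_zero.1 h))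
    have hpos : 0 < t₁ - a := by linarith
    obtain ⟨F, hF, hFR, hF1, hF2⟩ := exists_triangle_move (a := (A a, 0)) (b := (A t₁, 0))
      (c := (z, 1)) (l := (m - a) / (t₁ - a)) (by
        rw [LinearIndependent.pair_iff]
        intro s t hst
        have h2 := congrArg Prod.snd hst
        have h1 := congrArg Prod.fst hst
        simp only [Prod.smul_mk, Prod.mk_sub_mk, Prod.mk_add_mk, smul_eq_mul, sub_self, mul_zero,
          sub_zero, mul_one, zero_add, Prod.snd_zero, Prod.fst_zero] at h1 h2
        subst h2
        simpa [hne] using h1) (div_pos (by linarith) hpos)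
        ((div_lt_one hpos).2 (by linarith)) (R ∪ (fun s => ((A s, 0) : Space)) '' Set.Icc t₁ b)
        (hRc.union (hcurve t₁)) (by
        intro β γ hβ hγ hβγ hm
        have hpt : ((A a, 0) : Space) + β • (((A t₁, 0) : Space) - (A a, 0)) +
            γ • (((z, 1) : Space) - (A a, 0)) =
            (A a + β • (A t₁ - A a) + γ • (z - A a), γ) := by
          ext <;> simp
        rw [hpt] at hm
        have hγ0 : γ = 0 := by
          rcases hm with hm | ⟨s, -, hs⟩
          · exact le_antisymm (hR _ hm) hγ
          · exact (congrArg Prod.snd hs).symm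
        subst hγ0
        refine ⟨rfl, ?_⟩
        rw [zero_smul, add_zero, ← hPL.affine_comb le_rfl ht₁ ht₁b ht₁B hβ (by linarith)] at hm
        have hs1 : a ≤ a + β * (t₁ - a) := by nlinarith
        have hs2 : a + β * (t₁ - a) ≤ t₁ := by nlinarith
        have hs3 : a + β * (t₁ - a) = a ∨ t₁ ≤ a + β * (t₁ - a) := by
          rcases hm with hm | ⟨s, hs, hs'⟩
          · rcases hRA _ ⟨hs1, hs2.trans ht₁b⟩ hm with h | h
            · exact Or.inl h
            · right; linarith
          · have := hinj ⟨ht₁.le.trans hs.1, hs.2⟩ ⟨hs1, hs2.trans ht₁b⟩ (congrArg Prod.fst hs')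
            right; linarith [hs.1]
        rcases hs3 with h | h
        · left; nlinarith
        · right; nlinarith)
    have hpt : ∀ s ∈ Set.Icc a t₁, ((A s, 0) : Space) =
        (A a, 0) + ((s - a) / (t₁ - a)) • (((A t₁, 0) : Space) - (A a, 0)) := by
      intro s hs
      have := hPL.affine_comb le_rfl ht₁ ht₁b ht₁B (r := (s - a) / (t₁ - a))
        (div_nonneg (by linarith [hs.1]) hpos.le) ((div_le_one hpos).2 (by linarith [hs.2]))
      rw [div_mul_cancel₀ _ hpos.ne', add_sub_cancel] at this
      ext <;> simp [this]
    refine ⟨F, hF, fun p hp => hFR p (Or.inl hp), ?_, ?_, fun s hs => hFR _ (Or.inr ⟨s, hs, rfl⟩)⟩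
    · intro s hs
      rw [hpt s ⟨hs.1, by linarith [hs.2]⟩, hF1 _ (div_nonneg (by linarith [hs.1]) hpos.le)
        (div_le_div_of_nonneg_right (by linarith [hs.2]) hpos.le),
        div_div_div_cancel_right₀ hpos.ne', AffineMap.lineMap_apply_module', add_comm]
    · intro s hs
      rw [hpt s ⟨by linarith [hs.1], hs.2⟩,
        hF2 _ (div_le_div_of_nonneg_right (by linarith [hs.1]) hpos.le)
        ((div_le_one hpos).2 (by linarith [hs.2])),
        AffineMap.lineMap_apply_module', add_comm]
      congr 2
      rw [← sub_div, one_sub_div hpos.ne', div_div_div_cancel_right₀ hpos.ne']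
      congr 1 <;> ring
  -- The edges from the apex to `A t` and on to `A t'` are shortened to the edge from the apex to `A
  -- t'`. This is the inverse of a triangle move, whence `F.symm`. The triangle reaches level `0`
  -- only in its base, so `R` and the remaining arc can meet it only there.
  have hstep : ∀ t t', t₁ ≤ t → t < t' → t' ≤ b → (∀ x ∈ B, ¬(t < x ∧ x < t')) → P t → P t' := by
    intro t t' ht htt ht'b htB hPt
    obtain ⟨G, hG, hGR, hG1, hG2, hG3⟩ := hPt
    have hat : a < t := by linarith
    have hne : A t' - A t ≠ 0 := fun h => htt.ne' (hinj ⟨by linarith, ht'b⟩ ⟨by linarith, by linarith⟩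
      (sub_eq_zero.1 h))
    have hmt' : 0 < t - m := by linarith
    have hpos : 0 < t' - m := by linarith
    have hpos' : 0 < t' - t := by linarith
    have hseg : ∀ β γ : ℝ, 0 ≤ β → 0 ≤ γ → β + γ = 1 →
        A (t + β * (t' - t)) = β • A t' + γ • A t := by
      intro β γ hβ hγ h
      rw [hPL.affine_comb hat.le htt ht'b htB hβ (by linarith)]
      obtain rfl : γ = 1 - β := by linarith
      module
    have hsegmem : ∀ β γ : ℝ, 0 ≤ β → 0 ≤ γ → β + γ = 1 →
        t ≤ t + β * (t' - t) ∧ t + β * (t' - t) ≤ t' := by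
      intro β γ hβ hγ h
      constructor <;> nlinarith
    have hend : ∀ β γ : ℝ, 0 ≤ β → 0 ≤ γ → β + γ = 1 → t' ≤ t + β * (t' - t) →
        γ = 0 ∧ (β = 0 ∨ β = 1) := by
      intro β γ hβ hγ h ht
      have : β = 1 := by nlinarith
      exact ⟨by linarith, Or.inr this⟩
    obtain ⟨F, hF, hFR, hF1, hF2⟩ := exists_triangle_move (a := (z, 1)) (b := (A t', 0))
      (c := (A t, 0)) (l := (t - m) / (t' - m)) (by
        rw [LinearIndependent.pair_iff]
        intro x y hst
        have h2 := congrArg Prod.snd hst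
        have h1 := congrArg Prod.fst hst
        simp only [Prod.smul_mk, Prod.mk_sub_mk, Prod.mk_add_mk, smul_eq_mul, Prod.snd_zero,
          Prod.fst_zero] at h1 h2
        obtain rfl : y = -x := by linarith
        have h3 : x • (A t' - A t) = 0 := by rw [← h1]; module
        have : x = 0 := by simpa [hne] using h3
        simp [this]) (div_pos hmt' hpos)
        ((div_lt_one hpos).2 (by linarith))
        ((R ∪ (fun r : ℝ => AffineMap.lineMap (k := ℝ) ((A a, 0) : Space) (z, 1) r) ''
          Set.Icc 0 1) ∪ (fun s => ((A s, 0) : Space)) '' Set.Icc t' b)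
        ((hRc.union (isCompact_Icc.image AffineMap.lineMap_continuous).isClosed).union
          (hcurve t')) (by
        intro β γ hβ hγ hβγ hm
        have hpt : ((z, 1) : Space) + β • (((A t', 0) : Space) - (z, 1)) +
            γ • (((A t, 0) : Space) - (z, 1)) =
            (β • A t' + γ • A t + (1 - β - γ) • z, 1 - β - γ) := by
          ext <;> simp <;> ring
        rw [hpt] at hm
        rcases hm with (hm | ⟨r, hr, hm⟩) | ⟨s, hs, hm⟩
        · have h1 : β + γ = 1 := by have := hR _ hm; dsimp only at this; linarith
          have h2 : 1 - β - γ = 0 := by linarith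
          rw [h2, zero_smul, add_zero, ← hseg β γ hβ hγ h1] at hm
          have h3 := hsegmem β γ hβ hγ h1
          refine hend β γ hβ hγ h1 ?_
          rcases hRA _ ⟨by linarith [h3.1], by linarith [h3.2]⟩ hm with h | h <;> linarith
        -- The triangle meets the edge from `A a` to the apex in the apex alone: any other common
        -- point, projected from the apex to the level `0`, would put `A a` on the segment from `A
        -- t` to `A t'`, against injectivity.
        · dsimp only at hm
          rw [AffineMap.lineMap_apply_module'] at hm
          have e2 : r = 1 - β - γ := by simpa using congrArg Prod.snd hm
          have e1 : r • (z - A a) + A a = β • A t' + γ • A t + (1 - β - γ) • z := by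
            simpa using congrArg Prod.fst hm
          subst e2
          have e3 : (β + γ) • A a = β • A t' + γ • A t := by
            have : (β + γ) • A a = ((1 - β - γ) • (z - A a) + A a) - (1 - β - γ) • z := by module
            rw [this, e1]; module
          rcases eq_or_lt_of_le (add_nonneg hβ hγ) with h0 | h0
          · exact ⟨by linarith, Or.inl (by linarith)⟩
          · exfalso
            have h5 : β / (β + γ) + γ / (β + γ) = 1 := by rw [← add_div, div_self h0.ne']
            have h4 := hseg (β / (β + γ)) (γ / (β + γ)) (div_nonneg hβ h0.le)
              (div_nonneg hγ h0.le) h5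
            have h6 : A (t + β / (β + γ) * (t' - t)) = A a := by
              rw [h4, div_eq_inv_mul, div_eq_inv_mul, mul_smul, mul_smul, ← smul_add, ← e3,
                smul_smul, inv_mul_cancel₀ h0.ne', one_smul]
            have h7 := hsegmem _ _ (div_nonneg hβ h0.le) (div_nonneg hγ h0.le) h5
            have := hinj ⟨by linarith [h7.1], by linarith [h7.2]⟩ ⟨le_rfl, hab.le⟩ h6
            linarith [h7.1]
        · have e2 : 0 = 1 - β - γ := congrArg Prod.snd hm
          have e1 : A s = β • A t' + γ • A t + (1 - β - γ) • z := congrArg Prod.fst hm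
          have h1 : β + γ = 1 := by linarith
          rw [← e2, zero_smul, add_zero, ← hseg β γ hβ hγ h1] at e1
          have h3 := hsegmem β γ hβ hγ h1
          have := hinj ⟨by linarith [hs.1], hs.2⟩ ⟨by linarith [h3.1], by linarith [h3.2]⟩ e1
          exact hend β γ hβ hγ h1 (by linarith [hs.1]))
    have hback : ∀ p q, F p = q → F.symm q = p := fun p q h => by rw [← h, F.symm_apply_apply]
    refine ⟨G.trans F.symm, hG.trans hF.symm, ?_, ?_, ?_, ?_⟩
    · intro p hp
      rw [Homeomorph.trans_apply, hGR p hp]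
      exact hback _ _ (hFR _ (Or.inl (Or.inl hp)))
    · intro s hs
      rw [Homeomorph.trans_apply, hG1 s hs]
      refine hback _ _ (hFR _ (Or.inl (Or.inr ⟨_, ⟨?_, ?_⟩, rfl⟩)))
      · exact div_nonneg (by linarith [hs.1]) (by linarith)
      · exact (div_le_one (by linarith)).2 (by linarith [hs.2])
    · intro s hs
      rw [Homeomorph.trans_apply]
      apply hback
      rw [AffineMap.lineMap_apply_module', add_comm]
      rcases le_total s t with h | h
      · rw [hG2 s ⟨hs.1, h⟩, hF1 _ (div_nonneg (by linarith [hs.1]) hpos.le)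
          (div_le_div_of_nonneg_right (by linarith) hpos.le), div_div_div_cancel_right₀ hpos.ne',
          AffineMap.lineMap_apply_module', add_comm]
      · rw [hG3 s ⟨h, hs.2.trans ht'b⟩, hF2 _ (div_le_div_of_nonneg_right (by linarith) hpos.le)
          ((div_le_one hpos).2 (by linarith [hs.2]))]
        have e1 : ((s - m) / (t' - m) - (t - m) / (t' - m)) / (1 - (t - m) / (t' - m)) =
            (s - t) / (t' - t) := by
          rw [← sub_div, one_sub_div hpos.ne', div_div_div_cancel_right₀ hpos.ne']
          congr 1 <;> ring
        rw [e1]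
        have := hPL.affine_comb hat.le htt ht'b htB (r := (s - t) / (t' - t))
          (div_nonneg (by linarith) hpos'.le) ((div_le_one hpos').2 (by linarith [hs.2]))
        rw [div_mul_cancel₀ _ hpos'.ne', add_sub_cancel] at this
        ext <;> simp [this]
    · intro s hs
      rw [Homeomorph.trans_apply, hG3 s ⟨by linarith [hs.1], hs.2⟩]
      exact hback _ _ (hFR _ (Or.inr ⟨s, hs, rfl⟩))
  have hind : ∀ n : ℕ, ∀ t, t₁ ≤ t → t ≤ b → (B ∩ Set.Ioo t b).ncard = n → P t → P b := by
    intro n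
    induction n using Nat.strong_induction_on with
    | _ n ih =>
      intro t ht htb hn hPt
      rcases eq_or_lt_of_le htb with rfl | htb
      · exact hPt
      have hfin : (B ∩ Set.Ioo t b).Finite := hB.inter_of_left _
      rcases (B ∩ Set.Ioo t b).eq_empty_or_nonempty with he | hne
      · refine hstep t b ht htb le_rfl (fun x hx hx' => ?_) hPt
        exact (Set.eq_empty_iff_forall_notMem.1 he x) ⟨hx, hx'⟩
      · obtain ⟨t', ht', htm⟩ := hfin.exists_minimal hne
        refine ih _ ?_ t' (ht.trans ht'.2.1.le) ht'.2.2.le rfl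
          (hstep t t' ht ht'.2.1 ht'.2.2.le (fun x hx hx' => ?_) hPt)
        · rw [← hn]
          refine Set.ncard_lt_ncard ?_ hfin
          refine ⟨fun x hx => ⟨hx.1, ht'.2.1.trans hx.2.1, hx.2.2⟩, fun h => ?_⟩
          exact lt_irrefl _ (h ht').2.1
        · exact absurd (htm ⟨hx, hx'.1, hx'.2.trans ht'.2.2⟩ hx'.2.le) (not_le.2 hx'.2)
  obtain ⟨F, hF, hFR, hF1, hF2, -⟩ := hind _ t₁ le_rfl ht₁b rfl hbase
  exact ⟨F, hF, hFR, hF1, hF2⟩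


/-! ### Moving arcs that pass above or below all the rest -/

/-- If an arc of a curve passes above all the rest, then its heights extend to a function on the
plane whose graph lies above the rest. -/
theorem exists_graph_above {sh : ℝ → Plane} {h : ℝ → ℝ} (hsh : Continuous sh) (hh : Continuous h)
    {a b : ℝ} (hab : a ≤ b) (hinj : Set.InjOn sh (Set.Icc a b)) {K : Set ℝ} (hK : IsCompact K)
    (habove : ∀ t ∈ K, ∀ s ∈ Set.Icc a b, sh t = sh s → h t < h s ∨ t = s) :
    ∃ g : Plane → ℝ, Continuous g ∧ (∀ s ∈ Set.Icc a b, g (sh s) = h s) ∧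
      ∀ t ∈ K, t ∉ Set.Icc a b → h t < g (sh t) := by
  let e : Set.Icc a b → Plane := fun s => sh s
  have he : Topology.IsClosedEmbedding e :=
    (hsh.comp continuous_subtype_val).isClosedEmbedding fun s t hst =>
      Subtype.ext (hinj s.2 t.2 hst)
  obtain ⟨g₀, hg₀⟩ := ContinuousMap.exists_extension' he
    ⟨fun s : Set.Icc a b => h s, hh.comp continuous_subtype_val⟩
  have hg₀' : ∀ s ∈ Set.Icc a b, g₀ (sh s) = h s := fun s hs => congrFun hg₀ ⟨s, hs⟩
  obtain ⟨C, hC⟩ : ∃ C, C = sh '' Set.Icc a b := ⟨_, rfl⟩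
  have hCc : IsClosed C := by rw [hC]; exact (isCompact_Icc.image hsh).isClosed
  have hCn : C.Nonempty := by rw [hC]; exact (Set.nonempty_Icc.2 hab).image _
  have hC0 : ∀ x, Metric.infDist x C = 0 ↔ x ∈ C := fun x =>
    (hCc.mem_iff_infDist_zero hCn).symm
  have : CompactSpace K := isCompact_iff_compactSpace.1 hK
  -- A Tietze extension `g₀` of the heights need not be above the rest. Over the shadow `C` of the
  -- arc nothing exceeds it, so the excess elsewhere is bounded by a modulus in the distance to `C`.
  obtain ⟨ω, hω, hωm, hω0, hωD⟩ := exists_modulus (X := K) (fun t => h t - g₀ (sh t))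
    (fun t => Metric.infDist (sh t) C) (by fun_prop)
    ((Metric.continuous_infDist_pt C).comp (by fun_prop)) (fun t => Metric.infDist_nonneg) (by
      rintro ⟨t, ht⟩ h0
      rw [hC0, hC] at h0
      obtain ⟨s, hs, hst⟩ := h0
      dsimp only at hst ⊢
      rw [← hst, hg₀' s hs]
      rcases habove t ht s hs hst.symm with h1 | h1
      · linarith
      · simp [h1])
  have hdc : Continuous fun x => Metric.infDist x C := Metric.continuous_infDist_pt C
  -- The last summand makes the inequality strict away from `C`.
  refine ⟨fun x => g₀ x + ω (Metric.infDist x C) + Metric.infDist x C,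
    by fun_prop, fun s hs => ?_, fun t ht hts => ?_⟩
  · have h1 : Metric.infDist (sh s) C = 0 := (hC0 _).2 (hC ▸ ⟨s, hs, rfl⟩)
    simp [h1, hω0, hg₀' s hs]
  · have h1 := hωD ⟨t, ht⟩
    dsimp only at h1 ⊢
    rcases eq_or_lt_of_le (Metric.infDist_nonneg (x := sh t) (s := C)) with h0 | h0
    · rw [← h0, hω0, add_zero, add_zero]
      have h2 := (hC0 _).1 h0.symm
      rw [hC] at h2
      obtain ⟨s, hs, hst⟩ := h2
      rw [← hst, hg₀' s hs]
      rcases habove t ht s hs hst.symm with h3 | h3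
      · exact h3
      · exact absurd (h3 ▸ hs) hts
    · linarith

/-- An arc that passes above all the rest of a curve can be replaced by an arc over any simple
polygonal path in the plane with the same end points, again above all the rest. -/
theorem exists_replace_over {sh : ℝ → Plane} {h : ℝ → ℝ} (hsh : Continuous sh)
    (hh : Continuous h) {a b : ℝ} (hab : a < b) {B : Set ℝ} (hB : B.Finite) (hPL : PLOn sh B a b)
    (hinj : Set.InjOn sh (Set.Icc a b)) {K : Set ℝ} (hK : IsCompact K)
    (hKab : ∀ t ∈ K, t ∈ Set.Icc a b → t = a ∨ t = b)
    (habove : ∀ t ∈ K, ∀ s ∈ Set.Icc a b, sh t = sh s → h t < h s ∨ t = s)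
    {τ : ℝ → Plane} (hτ : Continuous τ) {B' : Set ℝ} (hB' : B'.Finite) (hPL' : PLOn τ B' a b)
    (hinj' : Set.InjOn τ (Set.Icc a b)) (ha : τ a = sh a) (hb : τ b = sh b) :
    ∃ (F : Space ≃ₜ Space) (k : ℝ → ℝ), IsotopicToId F ∧ Continuous k ∧ k a = h a ∧ k b = h b ∧
      (∀ t ∈ K, F (sh t, h t) = (sh t, h t)) ∧ (∀ s ∈ Set.Icc a b, F (sh s, h s) = (τ s, k s)) ∧
      ∀ t ∈ K, t ∉ Set.Icc a b → ∀ s, sh t = τ s → h t < k s := by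
  obtain ⟨g, hg, hgab, hgK⟩ := exists_graph_above hsh hh hab.le hinj hK habove
  -- The shear brings the graph of `g` to level `0`. The arc becomes a level arc and the rest lies
  -- below, touching the level only at the end points of the arc.
  obtain ⟨S, hS, hSp⟩ := exists_shear (fun x => -g x) hg.neg
  have hSsymm : ∀ x y, S.symm (x, y) = (x, y + g x) := fun x y => by
    rw [S.symm_apply_eq, hSp]; simp
  obtain ⟨R, hR⟩ : ∃ R, R = (fun t => S (sh t, h t)) '' K := ⟨_, rfl⟩
  have hRc : IsClosed R := by
    rw [hR]; exact (hK.image (S.continuous.comp (by fun_prop))).isClosed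
  have hRK : ∀ t ∈ K, S (sh t, h t) ∈ R := fun t ht => hR ▸ ⟨t, ht, rfl⟩
  have hlevel : ∀ t ∈ K, h t ≤ g (sh t) ∧ (h t = g (sh t) → t = a ∨ t = b) := by
    intro t ht
    by_cases hts : t ∈ Set.Icc a b
    · exact ⟨(hgab t hts).ge, fun _ => hKab t ht hts⟩
    · exact ⟨(hgK t ht hts).le, fun he => absurd he (hgK t ht hts).ne⟩
  have hR0 : ∀ p ∈ R, p.2 ≤ 0 := by
    rw [hR]
    rintro _ ⟨t, ht, rfl⟩
    dsimp only
    rw [hSp]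
    have := (hlevel t ht).1
    dsimp only; linarith
  have hRA : ∀ A : ℝ → Plane, Set.InjOn A (Set.Icc a b) → A a = sh a → A b = sh b →
      ∀ s ∈ Set.Icc a b, ((A s, 0) : Space) ∈ R → s = a ∨ s = b := by
    intro A hA hAa hAb s hs hm
    rw [hR] at hm
    obtain ⟨t, ht, hts⟩ := hm
    dsimp only at hts
    rw [hSp] at hts
    have h1 : sh t = A s := congrArg Prod.fst hts
    have h2 : h t + -g (sh t) = 0 := congrArg Prod.snd hts
    rcases (hlevel t ht).2 (by linarith) with rfl | rfl
    · exact Or.inl (hA hs ⟨le_rfl, hab.le⟩ (by rw [← h1, hAa]))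
    · exact Or.inr (hA hs ⟨hab.le, le_rfl⟩ (by rw [← h1, hAb]))
  obtain ⟨m₁, hm₁, hm₁b, h₁⟩ := exists_cone_isotopy hsh hab hB hPL hinj hRc hR0
    (hRA sh hinj rfl rfl) 0
  obtain ⟨m₂, hm₂, hm₂b, h₂⟩ := exists_cone_isotopy hτ hab hB' hPL' hinj' hRc hR0
    (hRA τ hinj' ha hb) 0
  obtain ⟨m, hma, hmm⟩ := exists_between (lt_min hm₁ hm₂)
  obtain ⟨F₁, hF₁, hF₁R, hF₁a, hF₁b⟩ := h₁ m hma (hmm.trans_le (min_le_left _ _))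
  obtain ⟨F₂, hF₂, hF₂R, hF₂a, hF₂b⟩ := h₂ m hma (hmm.trans_le (min_le_right _ _))
  -- From the given arc up to the cone and down to the arc over `τ`. The new arc lies on the graph
  -- of `g`, hence its height `g (τ s)`.
  refine ⟨(((S.trans F₁).trans F₂.symm).trans S.symm), fun s => g (τ s),
    ((hS.trans hF₁).trans hF₂.symm).trans hS.symm, by fun_prop, ?_, ?_, ?_, ?_, ?_⟩
  · dsimp only; rw [ha, hgab a ⟨le_rfl, hab.le⟩]
  · dsimp only; rw [hb, hgab b ⟨hab.le, le_rfl⟩]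
  · intro t ht
    have h1 := hF₁R _ (hRK t ht)
    have h2 : F₂.symm (S (sh t, h t)) = S (sh t, h t) := by
      rw [F₂.symm_apply_eq, hF₂R _ (hRK t ht)]
    simp only [Homeomorph.trans_apply, h1, h2, Homeomorph.symm_apply_apply]
  · intro s hs
    have h1 : S (sh s, h s) = (sh s, 0) := by rw [hSp, hgab s hs]; simp
    have h2 : F₁ (sh s, 0) = F₂ (τ s, 0) := by
      rcases le_total s m with hsm | hsm
      · rw [hF₁a s ⟨hs.1, hsm⟩, hF₂a s ⟨hs.1, hsm⟩, ha]
      · rw [hF₁b s ⟨hsm, hs.2⟩, hF₂b s ⟨hsm, hs.2⟩, hb]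
    simp only [Homeomorph.trans_apply, h1, h2, Homeomorph.symm_apply_apply, hSsymm, zero_add]
  · intro t ht hts s hst
    dsimp only
    rw [← hst]
    exact hgK t ht hts

/-- The reflection in the plane. -/
def mirror : Space ≃ₜ Space := (Homeomorph.refl Plane).prodCongr (Homeomorph.neg ℝ)

@[simp] theorem mirror_apply (p : Space) : mirror p = (p.1, -p.2) := rfl

@[simp] theorem mirror_symm_apply (p : Space) : mirror.symm p = (p.1, -p.2) := rfl

/-- An arc that passes below all the rest of a curve can be replaced by an arc over any simple
polygonal path in the plane with the same end points, again below all the rest. -/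
theorem exists_replace_under {sh : ℝ → Plane} {h : ℝ → ℝ} (hsh : Continuous sh)
    (hh : Continuous h) {a b : ℝ} (hab : a < b) {B : Set ℝ} (hB : B.Finite) (hPL : PLOn sh B a b)
    (hinj : Set.InjOn sh (Set.Icc a b)) {K : Set ℝ} (hK : IsCompact K)
    (hKab : ∀ t ∈ K, t ∈ Set.Icc a b → t = a ∨ t = b)
    (hbelow : ∀ t ∈ K, ∀ s ∈ Set.Icc a b, sh t = sh s → h s < h t ∨ t = s)
    {τ : ℝ → Plane} (hτ : Continuous τ) {B' : Set ℝ} (hB' : B'.Finite) (hPL' : PLOn τ B' a b)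
    (hinj' : Set.InjOn τ (Set.Icc a b)) (ha : τ a = sh a) (hb : τ b = sh b) :
    ∃ (F : Space ≃ₜ Space) (k : ℝ → ℝ), IsotopicToId F ∧ Continuous k ∧ k a = h a ∧ k b = h b ∧
      (∀ t ∈ K, F (sh t, h t) = (sh t, h t)) ∧ (∀ s ∈ Set.Icc a b, F (sh s, h s) = (τ s, k s)) ∧
      ∀ t ∈ K, t ∉ Set.Icc a b → ∀ s, sh t = τ s → k s < h t := by
  obtain ⟨F, k, hF, hk, hka, hkb, h1, h2, h3⟩ := exists_replace_over (h := fun s => -h s) hsh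
    hh.neg hab hB hPL hinj hK
    hKab (fun t ht s hs hst => (hbelow t ht s hs hst).imp (fun h => neg_lt_neg h) id)
    hτ hB' hPL' hinj' ha hb
  refine ⟨(mirror.trans F).trans mirror.symm, fun s => -k s, hF.conj mirror, hk.neg,
    by simp [hka], by simp [hkb], fun t ht => ?_, fun s hs => ?_, fun t ht hts s hst => ?_⟩
  · simp [h1 t ht]
  · simp [h2 s hs]
  · have := h3 t ht hts s hst
    dsimp only at this ⊢; linarith


/-! ### Reparametrizing and splicing polygonal curves -/

theorem PLOn.mono {E : Type*} [AddCommGroup E] [Module ℝ E] {f : ℝ → E} {B B' : Set ℝ}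
    {a b a' b' : ℝ} (h : PLOn f B a b) (ha : a ≤ a') (hb : b' ≤ b) (hB : B ⊆ B') :
    PLOn f B' a' b' := fun c d hc hcd hd hx =>
  h c d (ha.trans hc) hcd (hd.trans hb) fun x hxB => hx x (hB hxB)

theorem PLOn.congr {E : Type*} [AddCommGroup E] [Module ℝ E] {f g : ℝ → E} {B : Set ℝ}
    {a b : ℝ} (h : PLOn f B a b) (hfg : ∀ s ∈ Set.Icc a b, g s = f s) : PLOn g B a b := by
  intro c d hc hcd hd hx s hs
  rw [hfg s ⟨hc.trans hs.1, hs.2.trans hd⟩, hfg c ⟨hc, hcd.le.trans hd⟩,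
    hfg d ⟨hc.trans hcd.le, hd⟩]
  exact h c d hc hcd hd hx s hs

theorem PLOn.comp_affine {E : Type*} [AddCommGroup E] [Module ℝ E] {f : ℝ → E} {B : Set ℝ}
    {a b a' b' u w : ℝ} (h : PLOn f B a' b') (hw : w ≠ 0)
    (hmap : ∀ s ∈ Set.Icc a b, u + w * s ∈ Set.Icc a' b') :
    PLOn (fun s => f (u + w * s)) ((fun s => u + w * s) ⁻¹' B) a b := by
  intro c d hc hcd hd hx s hs
  have hdc : d - c ≠ 0 := by linarith
  dsimp only
  rcases lt_or_gt_of_ne hw with hw | hw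
  · rw [h (u + w * d) (u + w * c) (hmap d ⟨by linarith, hd⟩).1 (by nlinarith)
      (hmap c ⟨hc, by linarith⟩).2 ?_ (u + w * s) ⟨by nlinarith [hs.2], by nlinarith [hs.1]⟩]
    · have : (u + w * s - (u + w * d)) / (u + w * c - (u + w * d)) =
          1 - (s - c) / (d - c) := by
        rw [eq_sub_iff_add_eq, div_add_div _ _ _ hdc, div_eq_one_iff_eq]
        · ring
        · exact mul_ne_zero (by nlinarith) hdc
        · nlinarith
      rw [this, AffineMap.lineMap_apply_one_sub]
    · intro x hxB hx'
      refine hx ((x - u) / w) ?_ ⟨?_, ?_⟩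
      · rw [Set.mem_preimage, mul_div_cancel₀ _ hw.ne, add_sub_cancel]; exact hxB
      · rw [lt_div_iff_of_neg hw]; linarith
      · rw [div_lt_iff_of_neg hw]; linarith
  · rw [h (u + w * c) (u + w * d) (hmap c ⟨hc, by linarith⟩).1 (by nlinarith)
      (hmap d ⟨by linarith, hd⟩).2 ?_ (u + w * s) ⟨by nlinarith [hs.1], by nlinarith [hs.2]⟩]
    · have : (u + w * s - (u + w * c)) / (u + w * d - (u + w * c)) = (s - c) / (d - c) := by
        have e1 : u + w * s - (u + w * c) = w * (s - c) := by ring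
        have e2 : u + w * d - (u + w * c) = w * (d - c) := by ring
        rw [e1, e2, mul_div_mul_left _ _ hw.ne']
      rw [this]
    · intro x hxB hx'
      refine hx ((x - u) / w) ?_ ⟨?_, ?_⟩
      · rw [Set.mem_preimage, mul_div_cancel₀ _ hw.ne', add_sub_cancel]; exact hxB
      · rw [lt_div_iff₀ hw]; linarith
      · rw [div_lt_iff₀ hw]; linarith

theorem PLOn.id_affine {E : Type*} [AddCommGroup E] [Module ℝ E] (x y : E) (a b u w : ℝ) :
    PLOn (fun s => AffineMap.lineMap (k := ℝ) x y ((s - u) / w)) ∅ a b := by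
  intro c d hc hcd hd _ s hs
  have hdc : d - c ≠ 0 := by linarith
  simp only [AffineMap.lineMap_apply_module']
  rcases eq_or_ne w 0 with rfl | hw
  · simp
  · match_scalars <;> field_simp <;> ring

/-- The function `f` with its values on `[a, b]` replaced by those of `g`. -/
noncomputable def splice {E : Type*} (f g : ℝ → E) (a b : ℝ) (s : ℝ) : E :=
  if s ≤ a then f s else if s ≤ b then g s else f s

section Splice

variable {E : Type*} {f g : ℝ → E} {a b s : ℝ}

theorem splice_of_le (hs : s ≤ a) : splice f g a b s = f s := by simp [splice, hs]

theorem splice_of_mem (ha : g a = f a) (hs : s ∈ Set.Icc a b) : splice f g a b s = g s := by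
  rcases eq_or_lt_of_le hs.1 with rfl | h
  · simp [splice, ha]
  · simp [splice, not_le.2 h, hs.2]

theorem splice_of_ge (hb : g b = f b) (hs : b ≤ s) : splice f g a b s = f s := by
  rcases eq_or_lt_of_le hs with rfl | h
  · simp [splice, hb]
  · simp [splice, not_le.2 h]

theorem splice_of_notMem (hs : s ∉ Set.Icc a b) : splice f g a b s = f s := by
  rw [Set.mem_Icc, not_and_or, not_le, not_le] at hs
  rcases hs with hs | hs
  · exact splice_of_le hs.le
  · simp [splice, not_le.2 hs]

theorem continuous_splice [TopologicalSpace E] (hf : Continuous f) (hg : Continuous g)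
    (hab : a < b) (ha : g a = f a) (hb : g b = f b) : Continuous (splice f g a b) := by
  refine Continuous.if_le hf ?_ continuous_id continuous_const ?_
  · exact Continuous.if_le hg hf continuous_id continuous_const (by rintro x rfl; exact hb)
  · rintro x rfl
    simp [hab.le, ha]

/-- Since `a` and `b` count as breakpoints, an interval without breakpoints inside lies entirely in
`[a, b]` or entirely on one side. Breakpoints of `f` inside the replaced arc can be forgotten. -/
theorem PLOn.splice [AddCommGroup E] [Module ℝ E] {B B₁ B₂ : Set ℝ} {l u : ℝ}
    (hf : PLOn f B₁ l u) (hg : PLOn g B₂ a b) (ha : g a = f a) (hb : g b = f b)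
    (haB : a ∈ B) (hbB : b ∈ B) (hB₁ : ∀ x ∈ B₁, x ∉ Set.Ioo a b → x ∈ B)
    (hB₂ : ∀ x ∈ B₂, x ∈ Set.Ioo a b → x ∈ B) :
    PLOn (KnotDiag.splice f g a b) B l u := by
  intro c d hc hcd hd hx s hs
  have hca := hx a haB
  have hcb := hx b hbB
  rw [not_and_or, not_lt, not_lt] at hca hcb
  have key : d ≤ a ∨ b ≤ c ∨ (a ≤ c ∧ d ≤ b) := by
    rcases hca with h1 | h1
    · rcases hcb with h2 | h2
      · exact Or.inr (Or.inl h2)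
      · exact Or.inr (Or.inr ⟨h1, h2⟩)
    · exact Or.inl h1
  rcases key with h | h | ⟨h1, h2⟩
  · rw [splice_of_le (hs.2.trans h), splice_of_le (hcd.le.trans h), splice_of_le h]
    exact hf c d hc hcd hd (fun x hxB hxc => hx x (hB₁ x hxB fun hh => by linarith [hh.1, hxc.2])
      hxc) s hs
  · rw [splice_of_ge hb (h.trans hs.1), splice_of_ge hb h,
      splice_of_ge hb (h.trans hcd.le)]
    exact hf c d hc hcd hd (fun x hxB hxc => hx x (hB₁ x hxB fun hh => by linarith [hh.2, hxc.1])
      hxc) s hs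
  · rw [splice_of_mem ha ⟨h1.trans hs.1, hs.2.trans h2⟩, splice_of_mem ha ⟨h1, hcd.le.trans h2⟩,
      splice_of_mem ha ⟨h1.trans hcd.le, h2⟩]
    exact hg c d h1 hcd h2 (fun x hxB hxc => hx x (hB₂ x hxB ⟨h1.trans_lt hxc.1,
      hxc.2.trans_le h2⟩) hxc) s hs

end Splice

theorem homeo_apply_splice {F : Space ≃ₜ Space} {sh τ : ℝ → Plane} {h k : ℝ → ℝ} {T a b : ℝ}
    (hF : ∀ t ∈ Set.Icc 0 a ∪ Set.Icc b T, F (sh t, h t) = (sh t, h t))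
    (hF' : ∀ s ∈ Set.Icc a b, F (sh s, h s) = (τ s, k s)) (ha : τ a = sh a) (hka : k a = h a) :
    ∀ s ∈ Set.Icc 0 T, F (sh s, h s) = (splice sh τ a b s, splice h k a b s) := by
  intro s hs
  by_cases hsab : s ∈ Set.Icc a b
  · rw [splice_of_mem ha hsab, splice_of_mem hka hsab, hF' s hsab]
  · rw [splice_of_notMem hsab, splice_of_notMem hsab, hF]
    rw [Set.mem_Icc, not_and_or, not_le, not_le] at hsab
    exact hsab.imp (fun h => ⟨hs.1, h.le⟩) (fun h => ⟨h.le, hs.2⟩)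

theorem mem_ends {T a b t : ℝ} (ht : t ∈ Set.Icc 0 a ∪ Set.Icc b T) (ht' : t ∈ Set.Icc a b) :
    t = a ∨ t = b :=
  ht.imp (fun h => le_antisymm h.2 ht'.1) (fun h => le_antisymm ht'.2 h.1)

/-! ### Regular curves; cutting a corner at a touching point -/

/-- The multiple points of a closed plane curve with parameter in `[0, T)`. -/
def doublePoints (T : ℝ) (sh : ℝ → Plane) : Set Plane :=
  {x | ∃ s ∈ Set.Ico 0 T, ∃ t ∈ Set.Ico 0 T, s ≠ t ∧ sh s = x ∧ sh t = x}

/-- A closed curve in space with parameter in `[0, T]`, given by its shadow and its height, whose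
shadow is polygonal with vertices in `B` and regular, except that there may be vertices over the
double points in `E`. -/
structure IsRegularCurve (T : ℝ) (sh : ℝ → Plane) (h : ℝ → ℝ) (B : Set ℝ) (E : Set Plane) :
    Prop where
  pos : 0 < T
  cont_sh : Continuous sh
  cont_h : Continuous h
  closed_sh : sh T = sh 0
  closed_h : h T = h 0
  finite_B : B.Finite
  zero_mem : 0 ∈ B
  pl : PLOn sh B 0 T
  inj : ∀ s ∈ Set.Ico 0 T, ∀ t ∈ Set.Ico 0 T, sh s = sh t → h s = h t → s = t
  finite : (doublePoints T sh).Finite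
  double : ∀ s ∈ Set.Ico 0 T, ∀ t ∈ Set.Ico 0 T, ∀ u ∈ Set.Ico 0 T,
    sh s = sh t → sh t = sh u → s = t ∨ t = u ∨ s = u
  vertex : ∀ b ∈ B, b ∈ Set.Ico 0 T → ∀ t ∈ Set.Ico 0 T, sh t = sh b → t = b ∨ sh b ∈ E

theorem inj_of_homeo {T : ℝ} {sh sh' : ℝ → Plane} {h h' : ℝ → ℝ}
    (hinj : ∀ s ∈ Set.Ico 0 T, ∀ t ∈ Set.Ico 0 T, sh s = sh t → h s = h t → s = t)
    (F : Space ≃ₜ Space) (hF : ∀ s ∈ Set.Icc 0 T, F (sh s, h s) = (sh' s, h' s)) :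
    ∀ s ∈ Set.Ico 0 T, ∀ t ∈ Set.Ico 0 T, sh' s = sh' t → h' s = h' t → s = t := by
  intro s hs t ht h1 h2
  have h3 : F (sh s, h s) = F (sh t, h t) := by
    rw [hF s ⟨hs.1, hs.2.le⟩, hF t ⟨ht.1, ht.2.le⟩, h1, h2]
  have h4 := F.injective h3
  exact hinj s hs t ht (congrArg Prod.fst h4) (congrArg Prod.snd h4)

theorem coord_unique {a₁ a₂ : Plane} (hli : LinearIndependent ℝ ![a₁, a₂]) {p : Plane}
    {x y x' y' : ℝ} (h : p + x • a₁ + y • a₂ = p + x' • a₁ + y' • a₂) : x = x' ∧ y = y' := by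
  rw [LinearIndependent.pair_iff] at hli
  have h0 : (x - x') • a₁ + (y - y') • a₂ = 0 := by
    have : (x - x') • a₁ + (y - y') • a₂ =
      (p + x • a₁ + y • a₂) - (p + x' • a₁ + y' • a₂) := by module
    rw [this, h, sub_self]
  obtain ⟨h1, h2⟩ := hli _ _ h0
  exact ⟨by linarith, by linarith⟩

/-- Local form of a touching double point with parameters `α`, `μ`: a corner at `α`, and near `μ`
a strand outside the sector of that corner. -/
def IsTouchingAt (sh : ℝ → Plane) (α μ : ℝ) : Prop :=
  ∃ δ > 0, ∃ a₁ a₂ : Plane, LinearIndependent ℝ ![a₁, a₂] ∧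
    (∀ r, 0 ≤ r → r ≤ δ → sh (α - r) = sh α + r • a₁ ∧ sh (α + r) = sh α + r • a₂) ∧
    ∀ r, |r| ≤ δ → ∃ x y : ℝ, sh (μ + r) = sh α + x • a₁ + y • a₂ ∧ (r ≠ 0 → x < 0 ∨ y < 0)

/-- A touching double point with the corner on top is removed by cutting the corner. -/
theorem IsRegularCurve.cut_corner {T : ℝ} {sh : ℝ → Plane} {h : ℝ → ℝ} {B : Set ℝ} {E : Set Plane}
    (hC : IsRegularCurve T sh h B E) {α μ : ℝ} (hα : α ∈ Set.Ioo 0 T) (hμ : μ ∈ Set.Ioo 0 T)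
    (hne : α ≠ μ) (hαμ : sh α = sh μ) (hh : h μ < h α) (hloc : IsTouchingAt sh α μ) {η : ℝ}
    (hη : 0 < η) :
    ∃ (F : Space ≃ₜ Space) (sh' : ℝ → Plane) (h' : ℝ → ℝ) (B' : Set ℝ), IsotopicToId F ∧
      (∀ s ∈ Set.Icc 0 T, F (sh s, h s) = (sh' s, h' s)) ∧
      IsRegularCurve T sh' h' B' (E \ {sh α}) ∧
      doublePoints T sh' = doublePoints T sh \ {sh α} ∧
      ∀ s, η ≤ |s - α| → sh' s = sh s ∧ h' s = h s := by
  obtain ⟨δ, hδ, a₁, a₂, hli, hα', hμ'⟩ := hloc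
  obtain ⟨p, hp⟩ : ∃ p, p = sh α := ⟨_, rfl⟩
  rw [← hp] at hα' hμ'
  have hW : IsCompact {s | s ∈ Set.Icc 0 T ∧ δ ≤ |s - α| ∧ δ ≤ |s - μ|} :=
    isCompact_Icc.inter_right
      ((isClosed_le continuous_const (continuous_abs.comp (continuous_id.sub continuous_const))).inter
        (isClosed_le continuous_const (continuous_abs.comp (continuous_id.sub continuous_const))))
  -- Only `α` and `μ` lie over `p`, so by compactness the curve outside their neighbourhoods stays
  -- away from `p`.
  obtain ⟨ρ, hρ, hρW⟩ : ∃ ρ > 0, ∀ s ∈ {s | s ∈ Set.Icc 0 T ∧ δ ≤ |s - α| ∧ δ ≤ |s - μ|},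
      ρ ≤ dist (sh s) p := by
    rcases Set.eq_empty_or_nonempty {s | s ∈ Set.Icc 0 T ∧ δ ≤ |s - α| ∧ δ ≤ |s - μ|} with he | he
    · exact ⟨1, one_pos, fun s hs => by rw [he] at hs; exact hs.elim⟩
    · obtain ⟨s, hs, hsm⟩ := hW.exists_isMinOn he
        (f := fun s => dist (sh s) p) (by have := hC.cont_sh; fun_prop)
      refine ⟨dist (sh s) p, dist_pos.2 fun hsp => ?_, fun t ht => hsm ht⟩
      have key : ∀ s ∈ Set.Ico 0 T, s ≠ α → s ≠ μ → sh s ≠ p := by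
        intro s hs h1 h2 h3
        rcases hC.double s hs α ⟨hα.1.le, hα.2⟩ μ ⟨hμ.1.le, hμ.2⟩ (h3.trans hp) hαμ with h | h | h
        exacts [h1 h, hne h, h2 h]
      rcases eq_or_lt_of_le hs.1.2 with rfl | hsT
      · rw [hC.closed_sh] at hsp
        exact key 0 ⟨le_rfl, hC.pos⟩ hα.1.ne hμ.1.ne hsp
      · refine key s ⟨hs.1.1, hsT⟩ ?_ ?_ hsp
        · rintro rfl; have := hs.2.1; simp at this; linarith
        · rintro rfl; have := hs.2.2; simp at this; linarith
  have hN : 0 < ‖a₁‖ + ‖a₂‖ + 1 := by positivity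
  -- The triangle cut off has the sides `ε • a₁`, `ε • a₂` at `p`. The bound by `ρ` keeps it in the
  -- region where only the strands at `α` and `μ` occur, the others keep the arc inside `(0, T)`,
  -- away from `μ` and within `η` of `α`.
  obtain ⟨ε, hε, hεlt⟩ := exists_between (show 0 < min δ (min η (min α (min (T - α)
    (min |α - μ| (ρ / (‖a₁‖ + ‖a₂‖ + 1)))))) by
      have h1 := hα.1
      have h2 := hα.2
      have h3 : 0 < |α - μ| := abs_pos.2 (sub_ne_zero.2 hne)
      have h4 : 0 < T - α := by linarith
      have h5 : 0 < ρ / (‖a₁‖ + ‖a₂‖ + 1) := div_pos hρ hN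
      simp only [lt_min_iff]
      exact ⟨hδ, hη, h1, h4, h3, h5⟩)
  simp only [lt_min_iff] at hεlt
  obtain ⟨hεδ, hεη, hεα, hεT, hεμ, hερ⟩ := hεlt
  rw [lt_div_iff₀ hN] at hερ
  have hμarc : μ ∉ Set.Icc (α - ε) (α + ε) := by
    intro hm
    have : |α - μ| ≤ ε := abs_le.2 ⟨by linarith [hm.2], by linarith [hm.1]⟩
    linarith
  -- Outside the arc around `α` the curve meets the small triangle only at `μ`, in the corner `p`.
  -- So the new edge, which avoids `p`, meets nothing.
  have hstar : ∀ t ∈ Set.Icc 0 T, t ∉ Set.Icc (α - ε) (α + ε) → ∀ x y : ℝ, 0 ≤ x → 0 ≤ y →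
      x + y ≤ ε → sh t = p + x • a₁ + y • a₂ → t = μ ∧ x = 0 ∧ y = 0 := by
    intro t ht htarc x y hx hy hxy he
    have htα : ε < |t - α| := by
      by_contra hcon
      have := abs_le.1 (not_lt.1 hcon)
      exact htarc ⟨by linarith [this.1], by linarith [this.2]⟩
    have hnear : dist (sh t) p < ρ := by
      rw [he, dist_eq_norm]
      have : p + x • a₁ + y • a₂ - p = x • a₁ + y • a₂ := by abel
      rw [this]
      have e1 : ‖x • a₁ + y • a₂‖ ≤ x * ‖a₁‖ + y * ‖a₂‖ := by
        refine (norm_add_le _ _).trans ?_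
        rw [norm_smul, norm_smul, Real.norm_of_nonneg hx, Real.norm_of_nonneg hy]
      have := norm_nonneg a₁
      have := norm_nonneg a₂
      nlinarith
    have hnW : ¬ (t ∈ Set.Icc 0 T ∧ δ ≤ |t - α| ∧ δ ≤ |t - μ|) := fun hm => by
      have := hρW t hm; linarith
    have hcase : |t - α| < δ ∨ |t - μ| < δ := by
      by_contra hcon
      rw [not_or, not_lt, not_lt] at hcon
      exact hnW ⟨ht, hcon⟩
    rcases hcase with hlt | hlt
    · exfalso
      rcases le_total t α with h1 | h1
      · rw [abs_of_nonpos (by linarith)] at hlt htα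
        have h2 := (hα' (α - t) (by linarith) (by linarith)).1
        rw [sub_sub_cancel, he] at h2
        have h3 := coord_unique hli (h2.trans (by module :
          p + (α - t) • a₁ = p + (α - t) • a₁ + (0 : ℝ) • a₂))
        linarith [h3.1]
      · rw [abs_of_nonneg (by linarith)] at hlt htα
        have h2 := (hα' (t - α) (by linarith) (by linarith)).2
        rw [add_sub_cancel, he] at h2
        have h3 := coord_unique hli (h2.trans (by module :
          p + (t - α) • a₂ = p + (0 : ℝ) • a₁ + (t - α) • a₂))
        linarith [h3.2]
    · obtain ⟨x', y', h1, h2⟩ := hμ' (t - μ) hlt.le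
      rw [add_sub_cancel, he] at h1
      obtain ⟨rfl, rfl⟩ := coord_unique hli h1
      by_cases htμ : t = μ
      · refine ⟨htμ, ?_⟩
        rw [htμ, ← hαμ, ← hp] at he
        have h3 := coord_unique hli ((by module : p + (0 : ℝ) • a₁ + (0 : ℝ) • a₂ = p).trans he)
        exact ⟨h3.1.symm, h3.2.symm⟩
      · rcases h2 (sub_ne_zero.2 htμ) with h | h <;> linarith
  have harc : ∀ s ∈ Set.Icc (α - ε) (α + ε), ∃ x y : ℝ, 0 ≤ x ∧ 0 ≤ y ∧ x + y ≤ ε ∧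
      sh s = p + x • a₁ + y • a₂ ∧ s = α - x + y ∧ (x = 0 ∨ y = 0) := by
    intro s hs
    rcases le_total s α with h1 | h1
    · refine ⟨α - s, 0, by linarith, le_rfl, by linarith [hs.1], ?_, by ring, Or.inr rfl⟩
      have h2 := (hα' (α - s) (by linarith) (by linarith [hs.1])).1
      rw [sub_sub_cancel] at h2
      rw [h2]; module
    · refine ⟨0, s - α, le_rfl, by linarith, by linarith [hs.2], ?_, by ring, Or.inl rfl⟩
      have h2 := (hα' (s - α) (by linarith) (by linarith [hs.2])).2
      rw [add_sub_cancel] at h2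
      rw [h2]; module
  have hinj : Set.InjOn sh (Set.Icc (α - ε) (α + ε)) := by
    intro s hs t ht hst
    obtain ⟨x, y, -, -, -, h1, h2, -⟩ := harc s hs
    obtain ⟨x', y', -, -, -, h1', h2', -⟩ := harc t ht
    obtain ⟨rfl, rfl⟩ := coord_unique hli ((h1.symm.trans hst).trans h1')
    rw [h2, h2']
  -- The chord that cuts the corner.
  obtain ⟨τ, hτ⟩ : ∃ τ : ℝ → Plane, τ = fun s => AffineMap.lineMap (k := ℝ) (sh (α - ε))
    (sh (α + ε)) ((s - (α - ε)) / (2 * ε)) := ⟨_, rfl⟩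
  have hτc : Continuous τ := by
    rw [hτ]; exact AffineMap.lineMap_continuous.comp (by fun_prop)
  have hτa : τ (α - ε) = sh (α - ε) := by simp [hτ]
  have hτb : τ (α + ε) = sh (α + ε) := by
    have : (α + ε - (α - ε)) / (2 * ε) = 1 := by field_simp; ring
    simp only [hτ, this, AffineMap.lineMap_apply_one]
  have hτpl : PLOn τ ∅ (α - ε) (α + ε) := by rw [hτ]; exact PLOn.id_affine _ _ _ _ _ _
  have hτxy : ∀ s, τ s = p + ((α + ε - s) / 2) • a₁ + ((s - (α - ε)) / 2) • a₂ := by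
    intro s
    rw [hτ]
    dsimp only
    rw [AffineMap.lineMap_apply_module', (hα' ε hε.le hεδ.le).1, (hα' ε hε.le hεδ.le).2]
    match_scalars <;> field_simp <;> ring
  have hτinj : Set.InjOn τ (Set.Icc (α - ε) (α + ε)) := by
    intro s _ t _ hst
    rw [hτxy, hτxy] at hst
    linarith [(coord_unique hli hst).2]
  have hK01 : ∀ t, t ∈ Set.Icc 0 (α - ε) ∪ Set.Icc (α + ε) T → t ∈ Set.Icc 0 T := by
    rintro t (ht | ht)
    · exact ⟨ht.1, by linarith [ht.2]⟩
    · exact ⟨by linarith [ht.1], ht.2⟩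
  obtain ⟨F, k, hF, hk, hka, hkb, hFK, hFarc, hkK⟩ := exists_replace_over hC.cont_sh hC.cont_h
    (by linarith : α - ε < α + ε) hC.finite_B
    (hC.pl.mono (by linarith) (by linarith) subset_rfl) hinj
    (K := Set.Icc 0 (α - ε) ∪ Set.Icc (α + ε) T) (isCompact_Icc.union isCompact_Icc)
    (fun _ => mem_ends) (by
      intro t ht s hs hst
      by_cases htarc : t ∈ Set.Icc (α - ε) (α + ε)
      · exact Or.inr (hinj htarc hs hst)
      · left
        obtain ⟨x, y, h1, h2, h3, h4, h5, -⟩ := harc s hs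
        obtain ⟨rfl, rfl, rfl⟩ := hstar t (hK01 t ht) htarc x y h1 h2 h3 (hst.trans h4)
        rw [h5, sub_zero, add_zero]; exact hh) hτc Set.finite_empty hτpl hτinj hτa hτb
  have hεε : α - ε < α + ε := by linarith
  have hFall := homeo_apply_splice hFK hFarc hτa hka
  -- Every coincidence of the new shadow is an old one away from `p`; the regularity conditions and
  -- the new set of double points all follow from this.
  have hpair : ∀ s ∈ Set.Ico 0 T, ∀ t ∈ Set.Ico 0 T,
      splice sh τ (α - ε) (α + ε) s = splice sh τ (α - ε) (α + ε) t → s = t ∨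
      (splice sh τ (α - ε) (α + ε) s = sh s ∧ splice sh τ (α - ε) (α + ε) t = sh t ∧
        sh s ≠ p) := by
    have hmix : ∀ s ∈ Set.Icc (α - ε) (α + ε), ∀ t ∈ Set.Ico 0 T, t ∉ Set.Icc (α - ε) (α + ε) →
        τ s ≠ sh t := by
      intro s hs t ht htarc hst
      rw [hτxy] at hst
      obtain ⟨-, h1, h2⟩ := hstar t ⟨ht.1, ht.2.le⟩ htarc _ _ (by linarith [hs.2])
        (by linarith [hs.1]) (by linarith) hst.symm
      linarith
    intro s hs t ht hst
    by_cases hsarc : s ∈ Set.Icc (α - ε) (α + ε) <;>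
      by_cases htarc : t ∈ Set.Icc (α - ε) (α + ε)
    · rw [splice_of_mem hτa hsarc, splice_of_mem hτa htarc] at hst
      exact Or.inl (hτinj hsarc htarc hst)
    · rw [splice_of_mem hτa hsarc, splice_of_notMem htarc] at hst
      exact absurd hst (hmix s hsarc t ht htarc)
    · rw [splice_of_notMem hsarc, splice_of_mem hτa htarc] at hst
      exact absurd hst.symm (hmix t htarc s hs hsarc)
    · rw [splice_of_notMem hsarc, splice_of_notMem htarc] at hst ⊢
      by_cases hsp : sh s = p
      · left
        have h0 : (p : Plane) = p + (0 : ℝ) • a₁ + (0 : ℝ) • a₂ := by module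
        have h1 := (hstar s ⟨hs.1, hs.2.le⟩ hsarc 0 0 le_rfl le_rfl (by linarith)
          (hsp.trans h0)).1
        have h2 := (hstar t ⟨ht.1, ht.2.le⟩ htarc 0 0 le_rfl le_rfl (by linarith)
          ((hst.symm.trans hsp).trans h0)).1
        rw [h1, h2]
      · exact Or.inr ⟨rfl, rfl, hsp⟩
  have hdp : doublePoints T (splice sh τ (α - ε) (α + ε)) = doublePoints T sh \ {sh α} := by
    ext x
    constructor
    · rintro ⟨s, hs, t, ht, hst, h1, h2⟩
      rcases hpair s hs t ht (h1.trans h2.symm) with h3 | ⟨h3, h4, h5⟩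
      · exact absurd h3 hst
      · rw [h3] at h1
        rw [h4] at h2
        refine ⟨⟨s, hs, t, ht, hst, h1, h2⟩, ?_⟩
        rw [Set.mem_singleton_iff, ← h1, ← hp]
        exact h5
    · rintro ⟨⟨s, hs, t, ht, hst, h1, h2⟩, hx⟩
      rw [Set.mem_singleton_iff, ← hp] at hx
      have hno : ∀ s ∈ Set.Ico 0 T, ∀ t ∈ Set.Ico 0 T, s ≠ t → sh s = x → sh t = x →
          s ∉ Set.Icc (α - ε) (α + ε) := by
        intro s hs t ht hst h1 h2 hsarc
        by_cases htarc : t ∈ Set.Icc (α - ε) (α + ε)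
        · exact hst (hinj hsarc htarc (h1.trans h2.symm))
        · obtain ⟨x', y', e1, e2, e3, e4, -⟩ := harc s hsarc
          obtain ⟨-, rfl, rfl⟩ := hstar t ⟨ht.1, ht.2.le⟩ htarc x' y' e1 e2 e3
            (h2.trans (h1.symm.trans e4))
          apply hx
          rw [← h1, e4]; module
      refine ⟨s, hs, t, ht, hst, ?_, ?_⟩
      · rw [splice_of_notMem (hno s hs t ht hst h1 h2), h1]
      · rw [splice_of_notMem (hno t ht s hs hst.symm h2 h1), h2]
  refine ⟨F, splice sh τ (α - ε) (α + ε), splice h k (α - ε) (α + ε),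
    B ∪ {α - ε, α + ε}, hF, hFall, ?_, hdp, ?_⟩
  · refine ⟨hC.pos, continuous_splice hC.cont_sh hτc hεε hτa hτb,
      continuous_splice hC.cont_h hk hεε hka hkb, ?_, ?_, ?_, Or.inl hC.zero_mem, ?_,
      inj_of_homeo hC.inj F hFall, ?_, ?_, ?_⟩
    · rw [splice_of_ge hτb (by linarith), splice_of_le (by linarith), hC.closed_sh]
    · rw [splice_of_ge hkb (by linarith), splice_of_le (by linarith), hC.closed_h]
    · exact hC.finite_B.union (Set.toFinite _)
    · exact hC.pl.splice hτpl hτa hτb (by simp) (by simp) (fun x hx _ => Or.inl hx)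
        (fun x hx => hx.elim)
    · rw [hdp]; exact hC.finite.subset Set.sdiff_subset
    · intro s hs t ht u hu h1 h2
      rcases hpair s hs t ht h1 with h3 | ⟨h3, h4, -⟩
      · exact Or.inl h3
      rcases hpair t ht u hu h2 with h5 | ⟨-, h6, -⟩
      · exact Or.inr (Or.inl h5)
      rw [h3, h4] at h1
      rw [h4, h6] at h2
      exact hC.double s hs t ht u hu h1 h2
    · intro b hb hbT t ht hbt
      rcases hpair t ht b hbT hbt with h3 | ⟨h3, h4, h5⟩
      · exact Or.inl h3
      rw [h3, h4] at hbt
      rw [h4]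
      rcases hb with hb | hb
      · refine (hC.vertex b hb hbT t ht hbt).imp id fun hE => ⟨hE, ?_⟩
        rw [Set.mem_singleton_iff, ← hp, ← hbt]; exact h5
      · left
        have hbarc : b ∈ Set.Icc (α - ε) (α + ε) := by
          rcases hb with rfl | rfl
          · exact ⟨le_rfl, hεε.le⟩
          · exact ⟨hεε.le, le_rfl⟩
        by_cases htarc : t ∈ Set.Icc (α - ε) (α + ε)
        · exact hinj htarc hbarc hbt
        · obtain ⟨x', y', e1, e2, e3, e4, -⟩ := harc b hbarc
          obtain ⟨-, rfl, rfl⟩ := hstar t ⟨ht.1, ht.2.le⟩ htarc x' y' e1 e2 e3 (hbt.trans e4)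
          exfalso
          apply h5
          rw [hbt, e4]; module
  · intro s hs
    have hsarc : s ∉ Set.Icc (α - ε) (α + ε) := fun hm => by
      have : |s - α| ≤ ε := abs_le.2 ⟨by linarith [hm.1], by linarith [hm.2]⟩
      linarith
    exact ⟨splice_of_notMem hsarc, splice_of_notMem hsarc⟩


/-! ### Exchanging the shadows of an upper and a lower arc -/

/-- The involution that exchanges `[α, β]` and `[ν, μ]` by the affine map `s ↦ u + w * s`. -/
noncomputable def swapParam (α β ν μ u w s : ℝ) : ℝ :=
  open Classical in
  if s ∈ Set.Icc α β then u + w * s else if s ∈ Set.Icc ν μ then (s - u) / w else s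

/-- The affine map `s ↦ u + w * s` carries `[α, β]` onto `[ν, μ]`, where the second interval is to
the right of the first one; if they have a common point, then it is a fixed point. -/
structure IsSwap (T α β ν μ u w : ℝ) : Prop where
  zero_lt : 0 < α
  lt₁ : α < β
  le : β ≤ ν
  lt₂ : ν < μ
  lt_T : μ < T
  map : (0 < w ∧ β < ν ∧ u + w * α = ν ∧ u + w * β = μ) ∨
    (w < 0 ∧ u + w * α = μ ∧ u + w * β = ν)

namespace IsSwap

variable {T α β ν μ u w : ℝ}

theorem swapParam_mem₁ {s : ℝ} (hs : s ∈ Set.Icc α β) : swapParam α β ν μ u w s = u + w * s := by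
  rw [swapParam, if_pos hs]

theorem swapParam_notMem {s : ℝ} (h₁ : s ∉ Set.Icc α β) (h₂ : s ∉ Set.Icc ν μ) :
    swapParam α β ν μ u w s = s := by
  rw [swapParam, if_neg h₁, if_neg h₂]

variable (H : IsSwap T α β ν μ u w)

include H

theorem w_ne : w ≠ 0 := by
  rcases H.map with h | h
  · exact h.1.ne'
  · exact h.1.ne

theorem map_mem {s : ℝ} (hs : s ∈ Set.Icc α β) : u + w * s ∈ Set.Icc ν μ := by
  rcases H.map with ⟨h, -, h1, h2⟩ | ⟨h, h1, h2⟩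
  · exact ⟨by nlinarith [hs.1], by nlinarith [hs.2]⟩
  · exact ⟨by nlinarith [hs.2], by nlinarith [hs.1]⟩

theorem inv_mem {s : ℝ} (hs : s ∈ Set.Icc ν μ) : (s - u) / w ∈ Set.Icc α β := by
  rcases H.map with ⟨h, -, h1, h2⟩ | ⟨h, h1, h2⟩
  · constructor
    · rw [le_div_iff₀ h]; linarith [hs.1]
    · rw [div_le_iff₀ h]; linarith [hs.2]
  · constructor
    · rw [le_div_iff_of_neg h]; linarith [hs.2]
    · rw [div_le_iff_of_neg h]; linarith [hs.1]

theorem map_inv (s : ℝ) : u + w * ((s - u) / w) = s := by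
  rw [mul_div_cancel₀ _ H.w_ne]; ring

theorem inv_map (s : ℝ) : (u + w * s - u) / w = s := by
  rw [add_sub_cancel_left, mul_div_cancel_left₀ _ H.w_ne]

/-- The intervals overlap only if `β = ν`; then the map reverses the direction and fixes `β`. Hence
the two rules in `swapParam` agree. -/
theorem fixed {s : ℝ} (hs : s ∈ Set.Icc α β) (hs' : u + w * s ∈ Set.Icc α β) :
    u + w * s = s := by
  have h1 := H.map_mem hs
  have hle := H.le
  have h3 : u + w * s = β := le_antisymm hs'.2 (hle.trans h1.1)
  have h4 : β = ν := le_antisymm hle (h1.1.trans hs'.2)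
  rcases H.map with ⟨-, h, -, -⟩ | ⟨h, -, h2⟩
  · exact absurd h4 h.ne
  · have : w * (s - β) = 0 := by linarith
    rcases mul_eq_zero.1 this with h5 | h5
    · exact absurd h5 h.ne
    · linarith

theorem swapParam_mem₂ {s : ℝ} (hs : s ∈ Set.Icc ν μ) :
    swapParam α β ν μ u w s = (s - u) / w := by
  by_cases h : s ∈ Set.Icc α β
  · have h1 : s = β := le_antisymm h.2 (H.le.trans hs.1)
    have h2 := H.inv_mem hs
    have h3 := H.fixed h2 (by rw [H.map_inv]; exact h)
    rw [H.map_inv] at h3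
    rw [swapParam_mem₁ h, ← h3]
    nth_rw 1 [h3]
    rw [H.map_inv]
  · rw [swapParam, if_neg h, if_pos hs]

theorem involutive : Function.Involutive (swapParam α β ν μ u w) := by
  intro s
  by_cases h₁ : s ∈ Set.Icc α β
  · rw [swapParam_mem₁ h₁, H.swapParam_mem₂ (H.map_mem h₁), H.inv_map]
  · by_cases h₂ : s ∈ Set.Icc ν μ
    · rw [H.swapParam_mem₂ h₂, swapParam_mem₁ (H.inv_mem h₂), H.map_inv]
    · rw [swapParam_notMem h₁ h₂, swapParam_notMem h₁ h₂]

theorem swapParam_mem {s : ℝ} (hs : s ∈ Set.Ico 0 T) : swapParam α β ν μ u w s ∈ Set.Ico 0 T := by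
  have h0 := H.zero_lt
  have h1 := H.lt₁
  have h2 := H.le
  have h3 := H.lt₂
  have h4 := H.lt_T
  by_cases h₁ : s ∈ Set.Icc α β
  · rw [swapParam_mem₁ h₁]
    have := H.map_mem h₁
    exact ⟨by linarith [this.1], by linarith [this.2]⟩
  · by_cases h₂ : s ∈ Set.Icc ν μ
    · rw [H.swapParam_mem₂ h₂]
      have := H.inv_mem h₂
      exact ⟨by linarith [this.1], by linarith [this.2]⟩
    · rw [swapParam_notMem h₁ h₂]; exact hs

end IsSwap

/-- Equal heights over the same point mean equal parameters, so "not higher" improves to "lower or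
the same point", and two points of the arc cannot lie over each other. -/
theorem IsRegularCurve.injOn_over {T : ℝ} {sh : ℝ → Plane} {h : ℝ → ℝ} {B : Set ℝ} {E : Set Plane}
    (hC : IsRegularCurve T sh h B E) {a b : ℝ} (h0 : 0 < a) (hT : b < T)
    (hO : ∀ s ∈ Set.Icc a b, ∀ t ∈ Set.Ico 0 T, sh t = sh s → h t ≤ h s) :
    Set.InjOn sh (Set.Icc a b) ∧
      ∀ t ∈ Set.Icc 0 T, ∀ s ∈ Set.Icc a b, sh t = sh s → h t < h s ∨ t = s := by
  have hmem : ∀ s ∈ Set.Icc a b, s ∈ Set.Ico 0 T := fun s hs =>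
    ⟨by linarith [hs.1], by linarith [hs.2]⟩
  have key : ∀ t ∈ Set.Ico 0 T, ∀ s ∈ Set.Icc a b, sh t = sh s → h t < h s ∨ t = s := by
    intro t ht s hs hst
    rcases eq_or_lt_of_le (hO s hs t ht hst) with h1 | h1
    · exact Or.inr (hC.inj t ht s (hmem s hs) hst h1)
    · exact Or.inl h1
  refine ⟨fun s hs t ht hst => ?_, fun t ht s hs hst => ?_⟩
  · exact hC.inj s (hmem s hs) t (hmem t ht) hst
      (le_antisymm (hO t ht s (hmem s hs) hst) (hO s hs t (hmem t ht) hst.symm))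
  · rcases eq_or_lt_of_le ht.2 with rfl | h1
    · rw [hC.closed_sh] at hst
      rcases key 0 ⟨le_rfl, hC.pos⟩ s hs hst with h2 | h2
      · rw [hC.closed_h]; exact Or.inl h2
      · linarith [hs.1]
    · exact key t ⟨ht.1, h1⟩ s hs hst

theorem IsRegularCurve.mirror {T : ℝ} {sh : ℝ → Plane} {h : ℝ → ℝ} {B : Set ℝ} {E : Set Plane}
    (hC : IsRegularCurve T sh h B E) : IsRegularCurve T sh (fun s => -h s) B E :=
  { hC with
    cont_h := hC.cont_h.neg
    closed_h := by rw [hC.closed_h]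
    inj := fun s hs t ht h1 h2 => hC.inj s hs t ht h1 (neg_injective h2) }

theorem IsRegularCurve.injOn_under {T : ℝ} {sh : ℝ → Plane} {h : ℝ → ℝ} {B : Set ℝ}
    {E : Set Plane} (hC : IsRegularCurve T sh h B E) {a b : ℝ} (h0 : 0 < a) (hT : b < T)
    (hU : ∀ s ∈ Set.Icc a b, ∀ t ∈ Set.Ico 0 T, sh t = sh s → h s ≤ h t) :
    Set.InjOn sh (Set.Icc a b) ∧
      ∀ t ∈ Set.Icc 0 T, ∀ s ∈ Set.Icc a b, sh t = sh s → h s < h t ∨ t = s := by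
  obtain ⟨h1, h2⟩ := hC.mirror.injOn_over h0 hT
    (fun s hs t ht hst => neg_le_neg (hU s hs t ht hst))
  exact ⟨h1, fun t ht s hs hst => (h2 t ht s hs hst).imp neg_lt_neg_iff.1 id⟩

/-- An arc above the rest of the curve and an arc below it that have the same end points in the
projection can exchange their shadows. -/
theorem IsRegularCurve.swap {T : ℝ} {sh : ℝ → Plane} {h : ℝ → ℝ} {B : Set ℝ}
    (hC : IsRegularCurve T sh h B ∅) {α β ν μ u w : ℝ} (H : IsSwap T α β ν μ u w)
    (hα : sh (u + w * α) = sh α) (hβ : sh (u + w * β) = sh β)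
    (hO : ∀ s ∈ Set.Icc α β, ∀ t ∈ Set.Ico 0 T, sh t = sh s → h t ≤ h s)
    (hU : ∀ s ∈ Set.Icc ν μ, ∀ t ∈ Set.Ico 0 T, sh t = sh s → h s ≤ h t) :
    ∃ (F : Space ≃ₜ Space) (sh' : ℝ → Plane) (h' : ℝ → ℝ) (B' : Set ℝ), IsotopicToId F ∧
      (∀ s ∈ Set.Icc 0 T, F (sh s, h s) = (sh' s, h' s)) ∧
      IsRegularCurve T sh' h' B' {sh α, sh β} ∧
      doublePoints T sh' = doublePoints T sh ∧
      (∀ s ∈ Set.Icc α β, sh' s = sh (u + w * s)) ∧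
      (∀ s ∈ Set.Icc ν μ, sh' s = sh ((s - u) / w)) ∧
      ∀ s, s ∉ Set.Ioo α β → s ∉ Set.Ioo ν μ → sh' s = sh s ∧ h' s = h s := by
  have h0 := H.zero_lt
  have h1 := H.lt₁
  have h2 := H.le
  have h3 := H.lt₂
  have h4 := H.lt_T
  have hαT : α < T := by linarith
  have hβT : β < T := by linarith
  have hν0 : 0 < ν := by linarith
  have hw := H.w_ne
  obtain ⟨hinj₁, hab₁⟩ := hC.injOn_over h0 hβT hO
  obtain ⟨hinj₂, hab₂⟩ := hC.injOn_under hν0 h4 hU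
  have hK01 : ∀ {a b t : ℝ}, 0 < a → a ≤ T → 0 ≤ b → t ∈ Set.Icc 0 a ∪ Set.Icc b T →
      t ∈ Set.Icc 0 T := by
    rintro a b t ha haT hb (ht | ht)
    · exact ⟨ht.1, ht.2.trans haT⟩
    · exact ⟨hb.trans ht.1, ht.2⟩
  -- the upper arc
  obtain ⟨τ, hτ⟩ : ∃ τ : ℝ → Plane, τ = fun s => sh (u + w * s) := ⟨_, rfl⟩
  have hτc : Continuous τ := by rw [hτ]; exact hC.cont_sh.comp (by fun_prop)
  have hτα : τ α = sh α := by rw [hτ]; exact hα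
  have hτβ : τ β = sh β := by rw [hτ]; exact hβ
  have hτinj : Set.InjOn τ (Set.Icc α β) := by
    intro s hs t ht hst
    rw [hτ] at hst
    have := hinj₂ (H.map_mem hs) (H.map_mem ht) hst
    exact mul_left_cancel₀ hw (add_left_cancel this)
  have hτpl : PLOn τ ((fun s => u + w * s) ⁻¹' B) α β := by
    rw [hτ]
    exact (hC.pl.mono hν0.le h4.le subset_rfl).comp_affine hw fun s hs => H.map_mem hs
  have hinjlin : Function.Injective fun s : ℝ => u + w * s := fun s t hst =>
    mul_left_cancel₀ hw (add_left_cancel hst)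
  obtain ⟨F₁, k₁, hF₁, hk₁, hk₁α, hk₁β, hF₁K, hF₁arc, hk₁K⟩ :=
    exists_replace_over hC.cont_sh hC.cont_h h1 hC.finite_B
    (hC.pl.mono h0.le hβT.le subset_rfl) hinj₁
    (K := Set.Icc 0 α ∪ Set.Icc β T) (isCompact_Icc.union isCompact_Icc) (fun _ => mem_ends)
    (fun t ht => hab₁ t (hK01 h0 hαT.le (by linarith) ht)) hτc
    (hC.finite_B.preimage hinjlin.injOn) hτpl hτinj hτα hτβ
  obtain ⟨sh₁, hsh₁⟩ : ∃ f, f = splice sh τ α β := ⟨_, rfl⟩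
  obtain ⟨g₁, hg₁⟩ : ∃ f, f = splice h k₁ α β := ⟨_, rfl⟩
  have hF₁all : ∀ s ∈ Set.Icc 0 T, F₁ (sh s, h s) = (sh₁ s, g₁ s) := by
    rw [hsh₁, hg₁]; exact homeo_apply_splice hF₁K hF₁arc hτα hk₁α
  have hsh₁c : Continuous sh₁ := by rw [hsh₁]; exact continuous_splice hC.cont_sh hτc h1 hτα hτβ
  have hg₁c : Continuous g₁ := by rw [hg₁]; exact continuous_splice hC.cont_h hk₁ h1 hk₁α hk₁β
  have hsh₁ge : ∀ s, β ≤ s → sh₁ s = sh s := fun s hs => by rw [hsh₁, splice_of_ge hτβ hs]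
  have hg₁ge : ∀ s, β ≤ s → g₁ s = h s := fun s hs => by rw [hg₁, splice_of_ge hk₁β hs]
  -- the lower arc
  obtain ⟨τ', hτ'⟩ : ∃ τ : ℝ → Plane, τ = fun s => sh (-u / w + w⁻¹ * s) := ⟨_, rfl⟩
  have hinv : ∀ s, -u / w + w⁻¹ * s = (s - u) / w := fun s => by field_simp; ring
  have hτ'c : Continuous τ' := by rw [hτ']; exact hC.cont_sh.comp (by fun_prop)
  have hend : sh ((ν - u) / w) = sh ν ∧ sh ((μ - u) / w) = sh μ := by
    rcases H.map with ⟨-, -, e1, e2⟩ | ⟨-, e1, e2⟩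
    · rw [← e1, ← e2, H.inv_map, H.inv_map]; exact ⟨hα.symm, hβ.symm⟩
    · rw [← e1, ← e2, H.inv_map, H.inv_map]; exact ⟨hβ.symm, hα.symm⟩
  have hτ'ν : τ' ν = sh₁ ν := by rw [hτ', hsh₁ge ν h2]; dsimp only; rw [hinv]; exact hend.1
  have hτ'μ : τ' μ = sh₁ μ := by
    rw [hτ', hsh₁ge μ (by linarith)]; dsimp only; rw [hinv]; exact hend.2
  have hτ'inj : Set.InjOn τ' (Set.Icc ν μ) := by
    intro s hs t ht hst
    rw [hτ'] at hst
    dsimp only at hst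
    rw [hinv, hinv] at hst
    have := hinj₁ (H.inv_mem hs) (H.inv_mem ht) hst
    rw [div_left_inj' hw] at this
    linarith
  have hτ'pl : PLOn τ' ((fun s => -u / w + w⁻¹ * s) ⁻¹' B) ν μ := by
    rw [hτ']
    refine (hC.pl.mono h0.le hβT.le subset_rfl).comp_affine (inv_ne_zero hw) fun s hs => ?_
    rw [hinv]; exact H.inv_mem hs
  have hinjlin' : Function.Injective fun s : ℝ => -u / w + w⁻¹ * s := fun s t hst =>
    mul_left_cancel₀ (inv_ne_zero hw) (add_left_cancel hst)
  obtain ⟨F₂, k₂, hF₂, hk₂, hk₂ν, hk₂μ, hF₂K, hF₂arc, -⟩ :=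
    exists_replace_under hsh₁c hg₁c h3 hC.finite_B
    ((hC.pl.mono hν0.le h4.le subset_rfl).congr fun s hs => hsh₁ge s (h2.trans hs.1))
    (fun s hs t ht hst => hinj₂ hs ht (by
      rwa [hsh₁ge s (h2.trans hs.1), hsh₁ge t (h2.trans ht.1)] at hst))
    (K := Set.Icc 0 ν ∪ Set.Icc μ T) (isCompact_Icc.union isCompact_Icc) (fun _ => mem_ends)
    (by
      intro t ht s hs hst
      have ht01 := hK01 hν0 (by linarith) (by linarith) ht
      have hs01 : s ∈ Set.Icc 0 T := ⟨by linarith [hs.1], by linarith [hs.2]⟩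
      rw [hsh₁ge s (h2.trans hs.1)] at hst
      rw [hg₁ge s (h2.trans hs.1)]
      -- The lower arc must still be below everything after the first move. Against the moved upper
      -- arc, this holds since that arc was put above all the rest; the two arcs share at most the
      -- point with parameter `β = ν`.
      by_cases hta : t ∈ Set.Icc α β
      · rw [hsh₁, splice_of_mem hτα hta] at hst
        rw [hg₁, splice_of_mem hk₁α hta]
        by_cases hsa : s ∈ Set.Icc α β
        · right
          have hsβ : s = β := le_antisymm hsa.2 (h2.trans hs.1)
          rw [hsβ, ← hτβ] at hst
          rw [hsβ]
          exact hτinj hta ⟨h1.le, le_rfl⟩ hst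
        · exact Or.inl (hk₁K s (Or.inr ⟨h2.trans hs.1, hs01.2⟩) hsa t hst.symm)
      · rw [hsh₁, splice_of_notMem hta] at hst
        rw [hg₁, splice_of_notMem hta]
        exact hab₂ t ht01 s hs hst)
    hτ'c (hC.finite_B.preimage hinjlin'.injOn) hτ'pl hτ'inj hτ'ν hτ'μ
  obtain ⟨sh₂, hsh₂⟩ : ∃ f, f = splice sh₁ τ' ν μ := ⟨_, rfl⟩
  obtain ⟨g₂, hg₂⟩ : ∃ f, f = splice g₁ k₂ ν μ := ⟨_, rfl⟩
  have hF₂all : ∀ s ∈ Set.Icc 0 T, F₂ (sh₁ s, g₁ s) = (sh₂ s, g₂ s) := by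
    rw [hsh₂, hg₂]; exact homeo_apply_splice hF₂K hF₂arc hτ'ν hk₂ν
  have hFall : ∀ s ∈ Set.Icc 0 T, (F₁.trans F₂) (sh s, h s) = (sh₂ s, g₂ s) := fun s hs => by
    rw [Homeomorph.trans_apply, hF₁all s hs, hF₂all s hs]
  have hval₂ : ∀ s ∈ Set.Icc ν μ, sh₂ s = sh ((s - u) / w) := fun s hs => by
    rw [hsh₂, splice_of_mem hτ'ν hs, hτ', ← hinv]
  have hval₁ : ∀ s ∈ Set.Icc α β, sh₂ s = sh (u + w * s) := fun s hs => by
    by_cases hs' : s ∈ Set.Icc ν μ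
    · rw [hval₂ s hs', ← H.swapParam_mem₂ hs', IsSwap.swapParam_mem₁ hs]
    · rw [hsh₂, splice_of_notMem hs', hsh₁, splice_of_mem hτα hs, hτ]
  have hout : ∀ s, s ∉ Set.Ioo α β → s ∉ Set.Ioo ν μ → sh₂ s = sh s ∧ g₂ s = h s := by
    intro s hs hs'
    have e1 : sh₂ s = sh₁ s ∧ g₂ s = g₁ s := by
      rw [hsh₂, hg₂]
      rcases le_or_gt s ν with h | h
      · exact ⟨splice_of_le h, splice_of_le h⟩
      · have : μ ≤ s := by by_contra hc; exact hs' ⟨h, not_le.1 hc⟩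
        exact ⟨splice_of_ge hτ'μ this, splice_of_ge hk₂μ this⟩
    have e2 : sh₁ s = sh s ∧ g₁ s = h s := by
      rw [hsh₁, hg₁]
      rcases le_or_gt s α with h | h
      · exact ⟨splice_of_le h, splice_of_le h⟩
      · have : β ≤ s := by by_contra hc; exact hs ⟨h, not_le.1 hc⟩
        exact ⟨splice_of_ge hτβ this, splice_of_ge hk₁β this⟩
    exact ⟨e1.1.trans e2.1, e1.2.trans e2.2⟩
  -- The new shadow is the old one composed with an involution of the parameters. So the double
  -- points are unchanged and no triple point arises.
  obtain ⟨ρ, hρ⟩ : ∃ ρ, ρ = swapParam α β ν μ u w := ⟨_, rfl⟩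
  have hρρ : Function.Involutive ρ := hρ ▸ H.involutive
  have hρmem : ∀ s ∈ Set.Ico 0 T, ρ s ∈ Set.Ico 0 T := fun s hs => hρ ▸ H.swapParam_mem hs
  have hval : ∀ s, sh₂ s = sh (ρ s) := by
    intro s
    rw [hρ]
    by_cases hs₁ : s ∈ Set.Icc α β
    · rw [hval₁ s hs₁, IsSwap.swapParam_mem₁ hs₁]
    · by_cases hs₂ : s ∈ Set.Icc ν μ
      · rw [hval₂ s hs₂, H.swapParam_mem₂ hs₂]
      · rw [IsSwap.swapParam_notMem hs₁ hs₂]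
        exact (hout s (fun h => hs₁ (Set.Ioo_subset_Icc_self h))
          (fun h => hs₂ (Set.Ioo_subset_Icc_self h))).1
  have hdp : doublePoints T sh₂ = doublePoints T sh := by
    ext x
    constructor
    · rintro ⟨s, hs, t, ht, hst, e1, e2⟩
      exact ⟨ρ s, hρmem s hs, ρ t, hρmem t ht, fun h => hst (hρρ.injective h),
        by rw [← hval, e1], by rw [← hval, e2]⟩
    · rintro ⟨s, hs, t, ht, hst, e1, e2⟩
      exact ⟨ρ s, hρmem s hs, ρ t, hρmem t ht, fun h => hst (hρρ.injective h),
        by rw [hval, hρρ, e1], by rw [hval, hρρ, e2]⟩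
  refine ⟨F₁.trans F₂, sh₂, g₂, ρ ⁻¹' B ∪ {α, β, ν, μ}, hF₁.trans hF₂, hFall, ?_, hdp, hval₁, hval₂,
    hout⟩
  have hρout : ∀ x, x ∉ Set.Ioo α β → x ∉ Set.Ioo ν μ → x ∈ B → x ∈ ρ ⁻¹' B ∪ {α, β, ν, μ} := by
    intro x hx hx' hxB
    by_cases hx1 : x ∈ Set.Icc α β
    · right
      rcases Set.eq_endpoints_or_mem_Ioo_of_mem_Icc hx1 with h | h | h
      · simp [h]
      · simp [h]
      · exact absurd h hx
    · by_cases hx2 : x ∈ Set.Icc ν μ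
      · right
        rcases Set.eq_endpoints_or_mem_Ioo_of_mem_Icc hx2 with h | h | h
        · simp [h]
        · simp [h]
        · exact absurd h hx'
      · left
        rw [Set.mem_preimage, hρ, IsSwap.swapParam_notMem hx1 hx2]; exact hxB
  have h0o : (0 : ℝ) ∉ Set.Ioo α β ∧ (0 : ℝ) ∉ Set.Ioo ν μ :=
    ⟨fun h => by linarith [h.1], fun h => by linarith [h.1]⟩
  have hTo : T ∉ Set.Ioo α β ∧ T ∉ Set.Ioo ν μ :=
    ⟨fun h => by linarith [h.2], fun h => by linarith [h.2]⟩
  refine ⟨hC.pos, by rw [hsh₂]; exact continuous_splice hsh₁c hτ'c h3 hτ'ν hτ'μ,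
    by rw [hg₂]; exact continuous_splice hg₁c hk₂ h3 hk₂ν hk₂μ, ?_, ?_, ?_, ?_, ?_,
    inj_of_homeo hC.inj _ hFall, ?_, ?_, ?_⟩
  · rw [(hout T hTo.1 hTo.2).1, (hout 0 h0o.1 h0o.2).1, hC.closed_sh]
  · rw [(hout T hTo.1 hTo.2).2, (hout 0 h0o.1 h0o.2).2, hC.closed_h]
  · exact (hC.finite_B.preimage hρρ.injective.injOn).union (Set.toFinite _)
  · exact hρout 0 h0o.1 h0o.2 hC.zero_mem
  · have e1 : PLOn sh₁ ((ρ ⁻¹' B ∪ {α, β, ν, μ}) ∪ (B \ Set.Ioo α β)) 0 T := by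
      rw [hsh₁]
      refine hC.pl.splice hτpl hτα hτβ (by simp) (by simp) (fun x hx hx' => Or.inr ⟨hx, hx'⟩) ?_
      intro x hx hx'
      left; left
      rw [Set.mem_preimage, hρ, IsSwap.swapParam_mem₁ (Set.Ioo_subset_Icc_self hx')]; exact hx
    rw [hsh₂]
    refine e1.splice hτ'pl hτ'ν hτ'μ (by simp) (by simp) ?_ ?_
    · rintro x (hx | hx) hx'
      · exact hx
      · exact hρout x hx.2 hx' hx.1
    · intro x hx hx'
      left
      rw [Set.mem_preimage, hinv] at hx
      rw [Set.mem_preimage, hρ, H.swapParam_mem₂ (Set.Ioo_subset_Icc_self hx')]; exact hx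
  · rw [hdp]; exact hC.finite
  · intro s hs t ht v hv e1 e2
    rw [hval, hval] at e1 e2
    exact (hC.double _ (hρmem s hs) _ (hρmem t ht) _ (hρmem v hv) e1 e2).imp
      (fun h => hρρ.injective h) (Or.imp (fun h => hρρ.injective h) (fun h => hρρ.injective h))
  · rintro b (hb | hb) hbT t ht hbt
    · left
      rw [hval, hval] at hbt
      rcases hC.vertex (ρ b) hb (hρmem b hbT) (ρ t) (hρmem t ht) hbt with h | h
      · exact hρρ.injective h
      · exact h.elim
    · right
      -- The ends of the exchanged arcs are new breakpoints that may lie over double points; these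
      -- are the exceptions allowed.
      have hends : sh ν ∈ ({sh α, sh β} : Set Plane) ∧ sh μ ∈ ({sh α, sh β} : Set Plane) := by
        rcases H.map with ⟨-, -, e1, e2⟩ | ⟨-, e1, e2⟩
        · rw [← e1, ← e2, hα, hβ]; simp
        · rw [← e1, ← e2, hα, hβ]; simp
      rcases hb with rfl | rfl | rfl | rfl
      · rw [hval₁ _ ⟨le_rfl, h1.le⟩, hα]; simp
      · rw [hval₁ _ ⟨h1.le, le_rfl⟩, hβ]; simp
      · rw [hval₂ _ ⟨le_rfl, h3.le⟩, hend.1]; exact hends.1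
      · rw [hval₂ _ ⟨h3.le, le_rfl⟩, hend.2]; exact hends.2

/-- The vertex condition can fail only over double points, so exceptions elsewhere are vacuous. -/
theorem IsRegularCurve.restrict_exceptions {T : ℝ} {sh : ℝ → Plane} {h : ℝ → ℝ} {B : Set ℝ}
    {E E' : Set Plane} (hC : IsRegularCurve T sh h B E) (hE : E ∩ doublePoints T sh ⊆ E') :
    IsRegularCurve T sh h B E' :=
  { hC with
    vertex := fun b hb hbT t ht hbt => by
      by_cases htb : t = b
      · exact Or.inl htb
      · exact (hC.vertex b hb hbT t ht hbt).imp id fun hbE =>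
          hE ⟨hbE, t, ht, b, hbT, htb, hbt, rfl⟩ }


/-! ### The local picture at a crossing; removing a bigon -/

/-- A crossing lies over no vertex, so the breakpoints, being finite in number, keep a distance from
its parameters. -/
theorem IsRegularCurve.local_affine {T : ℝ} {sh : ℝ → Plane} {h : ℝ → ℝ} {B : Set ℝ}
    (hC : IsRegularCurve T sh h B ∅) {s t : ℝ} (hs : s ∈ Set.Ico 0 T) (ht : t ∈ Set.Ico 0 T)
    (hst : s ≠ t) (he : sh t = sh s) :
    ∃ δ > 0, ∃ v : Plane, δ < s ∧ δ < T - s ∧ ∀ r, |r| ≤ δ → sh (s + r) = sh s + r • v := by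
  have hsB : s ∉ B := fun hsB => by
    rcases hC.vertex s hsB hs t ht he with h | h
    · exact hst h.symm
    · exact h.elim
  have hs0 : 0 < s := lt_of_le_of_ne hs.1 fun h => hsB (h ▸ hC.zero_mem)
  obtain ⟨δ₀, hδ₀, hball⟩ := Metric.isOpen_iff.1 hC.finite_B.isClosed.isOpen_compl s hsB
  obtain ⟨δ, hδ, hδlt⟩ := exists_between (show 0 < min δ₀ (min s (T - s)) by
    simp only [lt_min_iff]; exact ⟨hδ₀, hs0, by linarith [hs.2]⟩)
  simp only [lt_min_iff] at hδlt
  obtain ⟨hδδ, hδs, hδT⟩ := hδlt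
  have key := hC.pl (s - δ) (s + δ) (by linarith) (by linarith) (by linarith) (fun x hx hx' => by
    refine (hball (?_ : x ∈ Metric.ball s δ₀)) hx
    rw [Metric.mem_ball, Real.dist_eq, abs_lt]
    constructor <;> linarith [hx'.1, hx'.2])
  have hlin : ∀ r, |r| ≤ δ → sh (s + r) =
      ((r + δ) / (2 * δ)) • (sh (s + δ) - sh (s - δ)) + sh (s - δ) := by
    intro r hr
    obtain ⟨h1, h2⟩ := abs_le.1 hr
    rw [key (s + r) ⟨by linarith, by linarith⟩, AffineMap.lineMap_apply_module']
    congr 3 <;> ring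
  have hmid := hlin 0 (by simpa using hδ.le)
  rw [add_zero] at hmid
  refine ⟨δ, hδ, (1 / (2 * δ)) • (sh (s + δ) - sh (s - δ)), hδs, hδT, fun r hr => ?_⟩
  rw [hlin r hr, hmid]
  match_scalars <;> field_simp <;> ring

/-- Parallel strands through one point would share a segment, giving infinitely many double points.
A zero direction is excluded because a constant piece has triple points. -/
theorem IsRegularCurve.transversal {T : ℝ} {sh : ℝ → Plane} {h : ℝ → ℝ} {B : Set ℝ}
    {E : Set Plane}
    (hC : IsRegularCurve T sh h B E) {s t : ℝ}
    (hst : s ≠ t) (he : sh t = sh s) {δ : ℝ} (hδ : 0 < δ) {v v' : Plane}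
    (hs0 : δ < s) (hsT : δ < T - s) (ht0 : δ < t) (htT : δ < T - t)
    (hv : ∀ r, |r| ≤ δ → sh (s + r) = sh s + r • v)
    (hv' : ∀ r, |r| ≤ δ → sh (t + r) = sh t + r • v') : LinearIndependent ℝ ![v, v'] := by
  have hmem : ∀ {s}, δ < s → δ < T - s → ∀ r, |r| ≤ δ → s + r ∈ Set.Ico 0 T := by
    intro s h1 h2 r hr
    obtain ⟨h3, h4⟩ := abs_le.1 hr
    exact ⟨by linarith, by linarith⟩
  have hne0 : ∀ {s v}, δ < s → δ < T - s → (∀ r, |r| ≤ δ → sh (s + r) = sh s + r • v) →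
      v ≠ 0 := by
    rintro s v h1 h2 h3 rfl
    have e : ∀ r, |r| ≤ δ → sh (s + r) = sh s := fun r hr => by rw [h3 r hr]; simp
    have a0 : |(0 : ℝ)| ≤ δ := by simpa using hδ.le
    have a1 : |δ| ≤ δ := (abs_of_pos hδ).le
    have a2 : |δ / 2| ≤ δ := by rw [abs_of_pos (by linarith)]; linarith
    rcases hC.double _ (hmem h1 h2 _ a0) _ (hmem h1 h2 _ a1) _ (hmem h1 h2 _ a2)
      (by rw [e _ a0, e _ a1]) (by rw [e _ a1, e _ a2]) with h | h | h <;> linarith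
  have hv0 := hne0 hs0 hsT hv
  have hv0' := hne0 ht0 htT hv'
  rw [LinearIndependent.pair_iff' hv0]
  rintro c rfl
  have hc : c ≠ 0 := fun h => hv0' (by simp [h])
  -- For `r ≤ ε` the parameters `s + r` and `t + r / c` stay in the affine range and remain
  -- distinct.
  obtain ⟨ε, hε, hεlt⟩ := exists_between (show 0 < min δ (min (δ * |c|)
      (|s - t| / (1 + |c|⁻¹))) by
    have : 0 < |s - t| := abs_pos.2 (sub_ne_zero.2 hst)
    simp only [lt_min_iff]; exact ⟨hδ, by positivity, by positivity⟩)
  simp only [lt_min_iff] at hεlt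
  obtain ⟨hεδ, hεc, hεst⟩ := hεlt
  have hc0 : 0 < |c| := abs_pos.2 hc
  rw [lt_div_iff₀ (by positivity)] at hεst
  have hinf : (Set.Icc 0 ε).Infinite := Set.Icc_infinite hε
  refine (hinf.image (f := fun r : ℝ => sh s + r • v) ?_) (hC.finite.subset ?_)
  · intro r _ r' _ hrr
    have : (r - r') • v = 0 := by
      rw [sub_smul, sub_eq_zero]; exact add_left_cancel hrr
    rcases smul_eq_zero.1 this with h | h
    · linarith
    · exact absurd h hv0
  · rintro _ ⟨r, hr, rfl⟩
    have hr1 : |r| ≤ δ := by rw [abs_of_nonneg hr.1]; linarith [hr.2]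
    have hr3 : |r / c| ≤ ε * |c|⁻¹ := by
      rw [abs_div, div_eq_mul_inv]
      exact mul_le_mul_of_nonneg_right (by rw [abs_of_nonneg hr.1]; exact hr.2) (by positivity)
    have hr2 : |r / c| ≤ δ := by
      refine hr3.trans ?_
      rw [← div_eq_mul_inv, div_le_iff₀ hc0]; exact hεc.le
    refine ⟨s + r, hmem hs0 hsT r hr1, t + r / c, hmem ht0 htT _ hr2, fun h => ?_, hv r hr1, ?_⟩
    · have h1 : s - t = r / c - r := by linarith
      have h2 : |s - t| ≤ |r / c| + |r| := by rw [h1]; exact abs_sub _ _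
      rw [abs_of_nonneg hr.1] at h2
      nlinarith [hr.2]
    · rw [hv' _ hr2, he, smul_smul, div_mul_cancel₀ _ hc]

/-- Both rays of the second strand have a negative coordinate with respect to the corner directions,
so they leave the closed sector at once. -/
theorem IsTouchingAt.of_rays {sh : ℝ → Plane} {α μ δ : ℝ} (hδ : 0 < δ) {a₁ a₂ : Plane}
    (hli : LinearIndependent ℝ ![a₁, a₂])
    (h₁ : ∀ r, 0 ≤ r → r ≤ δ → sh (α - r) = sh α + r • a₁)
    (h₂ : ∀ r, 0 ≤ r → r ≤ δ → sh (α + r) = sh α + r • a₂)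
    {x₁ y₁ x₂ y₂ : ℝ} (hxy₁ : x₁ < 0 ∨ y₁ < 0) (hxy₂ : x₂ < 0 ∨ y₂ < 0)
    (h₃ : ∀ r, 0 ≤ r → r ≤ δ → sh (μ + r) = sh α + r • (x₁ • a₁ + y₁ • a₂))
    (h₄ : ∀ r, 0 ≤ r → r ≤ δ → sh (μ - r) = sh α + r • (x₂ • a₁ + y₂ • a₂)) :
    IsTouchingAt sh α μ := by
  refine ⟨δ, hδ, a₁, a₂, hli, fun r h0 h1 => ⟨h₁ r h0 h1, h₂ r h0 h1⟩, fun r hr => ?_⟩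
  have hneg : ∀ {r x y : ℝ}, 0 ≤ r → (x < 0 ∨ y < 0) → r ≠ 0 → r * x < 0 ∨ r * y < 0 := by
    intro r x y h0 hxy hne
    have : 0 < r := lt_of_le_of_ne h0 hne.symm
    exact hxy.imp (fun h => mul_neg_of_pos_of_neg this h) (fun h => mul_neg_of_pos_of_neg this h)
  obtain ⟨hr1, hr2⟩ := abs_le.1 hr
  rcases le_total 0 r with h0 | h0
  · refine ⟨r * x₁, r * y₁, ?_, hneg h0 hxy₁⟩
    rw [h₃ r h0 hr2]; module
  · refine ⟨-r * x₂, -r * y₂, ?_, fun hne => hneg (neg_nonneg.2 h0) hxy₂ (neg_ne_zero.2 hne)⟩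
    have := h₄ (-r) (neg_nonneg.2 h0) (by linarith)
    rw [sub_neg_eq_add] at this
    rw [this]; module

theorem IsTouchingAt.congr {sh sh' : ℝ → Plane} {α μ : ℝ} (h : IsTouchingAt sh α μ) {η : ℝ}
    (hη : 0 < η) (hα : ∀ s, |s - α| ≤ η → sh' s = sh s) (hμ : ∀ s, |s - μ| ≤ η → sh' s = sh s) :
    IsTouchingAt sh' α μ := by
  obtain ⟨δ, hδ, a₁, a₂, hli, h1, h2⟩ := h
  have h0 : sh' α = sh α := hα α (by simpa using hη.le)
  refine ⟨min δ η, lt_min hδ hη, a₁, a₂, hli, fun r hr hr' => ?_, fun r hr => ?_⟩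
  · obtain ⟨hr1, hr2⟩ := le_min_iff.1 hr'
    rw [h0, hα _ (by rw [sub_sub_cancel_left, abs_neg, abs_of_nonneg hr]; exact hr2),
      hα _ (by rw [add_sub_cancel_left, abs_of_nonneg hr]; exact hr2)]
    exact h1 r hr hr1
  · obtain ⟨hr1, hr2⟩ := le_min_iff.1 hr
    rw [h0, hμ _ (by rw [add_sub_cancel_left]; exact hr2)]
    exact h2 r hr1

/-- A curve on which an upper and a lower arc have two double points in common, or one double point
and a common end point, can be simplified. -/
theorem IsRegularCurve.simplify {T : ℝ} {sh : ℝ → Plane} {h : ℝ → ℝ} {B : Set ℝ}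
    (hC : IsRegularCurve T sh h B ∅) {α β ν μ u w : ℝ} (H : IsSwap T α β ν μ u w)
    (hα : sh (u + w * α) = sh α) (hβ : sh (u + w * β) = sh β)
    (hO : ∀ s ∈ Set.Icc α β, ∀ t ∈ Set.Ico 0 T, sh t = sh s → h t ≤ h s)
    (hU : ∀ s ∈ Set.Icc ν μ, ∀ t ∈ Set.Ico 0 T, sh t = sh s → h s ≤ h t)
    (hβν : β < ν ∨ sh β ∉ doublePoints T sh) :
    ∃ (F : Space ≃ₜ Space) (sh' : ℝ → Plane) (h' : ℝ → ℝ) (B' : Set ℝ), IsotopicToId F ∧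
      (∀ s ∈ Set.Icc 0 T, F (sh s, h s) = (sh' s, h' s)) ∧ IsRegularCurve T sh' h' B' ∅ ∧
      doublePoints T sh' ⊂ doublePoints T sh := by
  have h0 := H.zero_lt
  have h1 := H.lt₁
  have h2 := H.le
  have h3 := H.lt₂
  have h4 := H.lt_T
  have hw := H.w_ne
  obtain ⟨F, sh', h', B', hF, hFs, hC', hdp, hval₁, hval₂, hout⟩ := hC.swap H hα hβ hO hU
  -- the two parameters of the double point over an end point of the first arc
  have hend : ∀ A, A = α ∨ A = β → A ∈ Set.Icc α β := by
    rintro A (rfl | rfl)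
    exacts [⟨le_rfl, h1.le⟩, ⟨h1.le, le_rfl⟩]
  have hendQ : ∀ A, A = α ∨ A = β → u + w * A = ν ∨ u + w * A = μ := by
    rintro A (rfl | rfl) <;> rcases H.map with ⟨-, -, e1, e2⟩ | ⟨-, e1, e2⟩ <;> simp [e1, e2]
  have hnotA : ∀ A, A = α ∨ A = β → A ∉ Set.Ioo α β ∧ A ∉ Set.Ioo ν μ := by
    rintro A (rfl | rfl)
    · exact ⟨fun h => lt_irrefl _ h.1, fun h => by linarith [h.1]⟩
    · exact ⟨fun h => lt_irrefl _ h.2, fun h => by linarith [h.1]⟩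
  have hnotQ : ∀ Q, Q = ν ∨ Q = μ → Q ∉ Set.Ioo α β ∧ Q ∉ Set.Ioo ν μ := by
    rintro Q (rfl | rfl)
    · exact ⟨fun h => by linarith [h.2], fun h => lt_irrefl _ h.1⟩
    · exact ⟨fun h => by linarith [h.2], fun h => lt_irrefl _ h.2⟩
  have hAT : ∀ A, A = α ∨ A = β → A ∈ Set.Ioo 0 T := by
    rintro A (rfl | rfl) <;> constructor <;> linarith
  have hQT : ∀ Q, Q = ν ∨ Q = μ → Q ∈ Set.Ioo 0 T := by
    rintro A (rfl | rfl) <;> constructor <;> linarith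
  have hheight : ∀ A, A = α ∨ A = β → sh (u + w * A) = sh A → u + w * A ≠ A →
      h' (u + w * A) < h' A := by
    intro A hA hsh hne
    rw [(hout _ (hnotA A hA).1 (hnotA A hA).2).2,
      (hout _ (hnotQ _ (hendQ A hA)).1 (hnotQ _ (hendQ A hA)).2).2]
    refine lt_of_le_of_ne (hO A (hend A hA) _ (Set.Ioo_subset_Ico_self (hQT _ (hendQ A hA))) hsh)
      fun heq => hne ?_
    exact hC.inj _ (Set.Ioo_subset_Ico_self (hQT _ (hendQ A hA))) _
      (Set.Ioo_subset_Ico_self (hAT A hA)) hsh heq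
  have hshA : ∀ A, A = α ∨ A = β → sh' A = sh A := fun A hA =>
    (hout _ (hnotA A hA).1 (hnotA A hA).2).1
  have hshQ : ∀ A, A = α ∨ A = β → sh' (u + w * A) = sh (u + w * A) := fun A hA =>
    (hout _ (hnotQ _ (hendQ A hA)).1 (hnotQ _ (hendQ A hA)).2).1
  have hlocal : ∀ A, A = α ∨ A = β → sh (u + w * A) = sh A → u + w * A ≠ A →
      ∃ δ > 0, ∃ o v : Plane, LinearIndependent ℝ ![o, v] ∧
        (∀ r, |r| ≤ δ → sh (A + r) = sh A + r • o) ∧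
        (∀ r, |r| ≤ δ → sh (u + w * A + r) = sh A + r • v) ∧ δ < A ∧ δ < T - (u + w * A) := by
    intro A hA hsh hne
    have m1 := Set.Ioo_subset_Ico_self (hAT A hA)
    have m2 := Set.Ioo_subset_Ico_self (hQT _ (hendQ A hA))
    obtain ⟨δ₁, hδ₁, o, e1, e2, e3⟩ := hC.local_affine m1 m2 hne.symm hsh
    obtain ⟨δ₂, hδ₂, v, e4, e5, e6⟩ := hC.local_affine m2 m1 hne hsh.symm
    have l1 := min_le_left δ₁ δ₂
    have l2 := min_le_right δ₁ δ₂
    refine ⟨min δ₁ δ₂, lt_min hδ₁ hδ₂, o, v, ?_, fun r hr => e3 r (hr.trans l1),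
      fun r hr => by rw [e6 r (hr.trans l2), hsh], l1.trans_lt e1, l2.trans_lt e5⟩
    exact hC.transversal hne.symm hsh (lt_min hδ₁ hδ₂) (l1.trans_lt e1) (l1.trans_lt e2)
      (l2.trans_lt e4) (l2.trans_lt e5) (fun r hr => e3 r (hr.trans l1))
      (fun r hr => e6 r (hr.trans l2))
  have hdiv : ∀ A r, (u + w * A + r - u) / w = A + r / w := fun A r => by field_simp; ring
  have hwabs : 0 < |w| := abs_pos.2 hw
  have hαne : u + w * α ≠ α := by
    have := (H.map_mem ⟨le_rfl, h1.le⟩ : u + w * α ∈ Set.Icc ν μ).1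
    intro h; linarith
  -- the radius in which the local picture at an end point is valid
  have hrad : ∀ δ > 0, ∃ ε > 0, ε ≤ δ ∧ ε * |w| ≤ δ ∧ ε / |w| ≤ δ ∧ ε ≤ β - α ∧ ε ≤ μ - ν := by
    intro δ hδ
    refine ⟨min (min δ (min (δ / |w|) (δ * |w|))) (min (β - α) (μ - ν)), ?_, ?_, ?_, ?_, ?_, ?_⟩
    · have : 0 < β - α := by linarith
      have : 0 < μ - ν := by linarith
      simp only [gt_iff_lt, lt_min_iff]
      refine ⟨⟨hδ, by positivity, by positivity⟩, ?_, ?_⟩ <;> linarith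
    · exact (min_le_left _ _).trans (min_le_left _ _)
    · rw [← le_div_iff₀ hwabs]
      exact (min_le_left _ _).trans ((min_le_right _ _).trans (min_le_left _ _))
    · rw [div_le_iff₀ hwabs]
      exact (min_le_left _ _).trans ((min_le_right _ _).trans (min_le_right _ _))
    · exact (min_le_right _ _).trans (min_le_left _ _)
    · exact (min_le_right _ _).trans (min_le_right _ _)
  -- After the exchange the upper strand arrives along its old line and leaves along the other, with
  -- corner directions `-o` and `w • v`. The lower strand takes the two opposite rays, in the order
  -- given by the sign of `w`.
  have htouchα : IsTouchingAt sh' α (u + w * α) := by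
    obtain ⟨δ, hδ, o, v, hli, hoα, hvα, -, -⟩ := hlocal α (Or.inl rfl) hα hαne
    -- For `w > 0` the partner of `α` is `ν`, and the strand just before `ν` must not run into the
    -- first arc; hence the bound `ν - β`. For `w < 0` the partner is `μ` and `β = ν` is possible.
    have hδ' : 0 < (if β < ν then min δ (ν - β) else δ) := by
      split_ifs with h
      · exact lt_min hδ (by linarith)
      · exact hδ
    obtain ⟨ε, hε, e1, e2, e3, e4, e5⟩ := hrad _ hδ'
    have hle : (if β < ν then min δ (ν - β) else δ) ≤ δ := by
      split_ifs
      · exact min_le_left _ _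
      · exact le_rfl
    have eδ := e1.trans hle
    have hli' : LinearIndependent ℝ ![-o, w • v] := by
      rw [LinearIndependent.pair_iff] at hli ⊢
      intro s t hst
      obtain ⟨l1, l2⟩ := hli (-s) (t * w) (by rw [← hst]; module)
      exact ⟨by linarith, by simpa [hw] using l2⟩
    have hw1 : ∀ r, 0 ≤ r → r ≤ ε → |w * r| ≤ δ := fun r hr hr' => by
      rw [abs_mul, abs_of_nonneg hr, mul_comm]
      exact (mul_le_mul_of_nonneg_right hr' hwabs.le).trans (e2.trans hle)
    have hw2 : ∀ r, 0 ≤ r → r ≤ ε → |r / w| ≤ δ := fun r hr hr' => by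
      rw [abs_div, abs_of_nonneg hr]
      exact (div_le_div_of_nonneg_right hr' hwabs.le).trans (e3.trans hle)
    have hA1 : ∀ r, 0 ≤ r → r ≤ ε → sh' (α - r) = sh' α + r • (-o) := by
      intro r hr hr'
      rw [hshA α (Or.inl rfl), (hout (α - r) (fun h => by linarith [h.1])
        (fun h => by linarith [h.1])).1, sub_eq_add_neg, hoα (-r) (by
          rw [abs_neg, abs_of_nonneg hr]; linarith)]
      module
    have hA2 : ∀ r, 0 ≤ r → r ≤ ε → sh' (α + r) = sh' α + r • (w • v) := by
      intro r hr hr'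
      rw [hshA α (Or.inl rfl), hval₁ (α + r) ⟨by linarith, by linarith⟩,
        show u + w * (α + r) = u + w * α + w * r by ring, hvα _ (hw1 r hr hr')]
      module
    rcases H.map with ⟨hwp, hlt, q1, q2⟩ | ⟨hwn, q1, q2⟩
    · rw [if_pos hlt] at e1
      refine IsTouchingAt.of_rays hε hli' hA1 hA2 (x₁ := -w⁻¹) (y₁ := 0) (x₂ := 0) (y₂ := -w⁻¹)
        (Or.inl (by simpa using hwp)) (Or.inr (by simpa using hwp)) ?_ ?_
      · intro r hr hr'
        rw [hshA α (Or.inl rfl), hval₂ _ (by rw [q1]; constructor <;> linarith), hdiv,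
          hoα _ (hw2 r hr hr')]
        match_scalars <;> (field_simp; try ring)
      · intro r hr hr'
        have hrν : r ≤ ν - β := hr'.trans (e1.trans (min_le_right _ _))
        rw [hshA α (Or.inl rfl), (hout (u + w * α - r) (fun h => by rw [q1] at h; linarith [h.2])
          (fun h => by rw [q1] at h; linarith [h.1])).1, sub_eq_add_neg (u + w * α),
          hvα (-r) (by rw [abs_neg, abs_of_nonneg hr]; linarith)]
        match_scalars <;> (field_simp; try ring)
    · refine IsTouchingAt.of_rays hε hli' hA1 hA2 (x₁ := 0) (y₁ := w⁻¹) (x₂ := w⁻¹) (y₂ := 0)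
        (Or.inr (by simpa using hwn)) (Or.inl (by simpa using hwn)) ?_ ?_
      · intro r hr hr'
        rw [hshA α (Or.inl rfl), (hout (u + w * α + r) (fun h => by rw [q1] at h; linarith [h.2])
          (fun h => by rw [q1] at h; linarith [h.2])).1,
          hvα r (by rw [abs_of_nonneg hr]; linarith)]
        match_scalars <;> (field_simp; try ring)
      · intro r hr hr'
        rw [hshA α (Or.inl rfl), hval₂ _ (by rw [q1]; constructor <;> linarith),
          sub_eq_add_neg (u + w * α), hdiv, hoα _ (by
            rw [neg_div, abs_neg]; exact hw2 r hr hr')]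
        match_scalars <;> (field_simp; try ring)
  have hβmem : β = α ∨ β = β := Or.inr rfl
  have htouchβ : β < ν → IsTouchingAt sh' β (u + w * β) := by
    intro hlt
    have hβne : u + w * β ≠ β := by
      have := (H.map_mem ⟨h1.le, le_rfl⟩ : u + w * β ∈ Set.Icc ν μ).1
      intro h; linarith
    obtain ⟨δ, hδ, o, v, hli, hoα, hvα, -, -⟩ := hlocal β hβmem hβ hβne
    obtain ⟨ε, hε, e1', e2', e3', e4, e5⟩ := hrad (min δ (ν - β)) (lt_min hδ (by linarith))
    have hle : min δ (ν - β) ≤ δ := min_le_left _ _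
    have e1 := e1'.trans hle
    have eν : ε ≤ ν - β := e1'.trans (min_le_right _ _)
    have hli' : LinearIndependent ℝ ![-(w • v), o] := by
      rw [LinearIndependent.pair_iff] at hli ⊢
      intro s t hst
      obtain ⟨l1, l2⟩ := hli t (-s * w) (by rw [← hst]; module)
      exact ⟨by simpa [hw] using l2, l1⟩
    have hw1 : ∀ r, 0 ≤ r → r ≤ ε → |w * r| ≤ δ := fun r hr hr' => by
      rw [abs_mul, abs_of_nonneg hr, mul_comm]
      exact (mul_le_mul_of_nonneg_right hr' hwabs.le).trans (e2'.trans hle)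
    have hw2 : ∀ r, 0 ≤ r → r ≤ ε → |r / w| ≤ δ := fun r hr hr' => by
      rw [abs_div, abs_of_nonneg hr]
      exact (div_le_div_of_nonneg_right hr' hwabs.le).trans (e3'.trans hle)
    have hA1 : ∀ r, 0 ≤ r → r ≤ ε → sh' (β - r) = sh' β + r • (-(w • v)) := by
      intro r hr hr'
      rw [hshA β hβmem, hval₁ (β - r) ⟨by linarith, by linarith⟩,
        show u + w * (β - r) = u + w * β + -(w * r) by ring, hvα _ (by
          rw [abs_neg]; exact hw1 r hr hr')]
      module
    have hA2 : ∀ r, 0 ≤ r → r ≤ ε → sh' (β + r) = sh' β + r • o := by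
      intro r hr hr'
      rw [hshA β hβmem, (hout (β + r) (fun h => by linarith [h.2])
        (fun h => by linarith [h.1])).1, hoα r (by rw [abs_of_nonneg hr]; linarith)]
    rcases H.map with ⟨hwp, -, q1, q2⟩ | ⟨hwn, q1, q2⟩
    · refine IsTouchingAt.of_rays hε hli' hA1 hA2 (x₁ := -w⁻¹) (y₁ := 0) (x₂ := 0) (y₂ := -w⁻¹)
        (Or.inl (by simpa using hwp)) (Or.inr (by simpa using hwp)) ?_ ?_
      · intro r hr hr'
        rw [hshA β hβmem, (hout (u + w * β + r) (fun h => by rw [q2] at h; linarith [h.2])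
          (fun h => by rw [q2] at h; linarith [h.2])).1,
          hvα r (by rw [abs_of_nonneg hr]; linarith)]
        match_scalars <;> (field_simp; try ring)
      · intro r hr hr'
        rw [hshA β hβmem, hval₂ _ (by rw [q2]; constructor <;> linarith),
          sub_eq_add_neg (u + w * β), hdiv, hoα _ (by
            rw [neg_div, abs_neg]; exact hw2 r hr hr')]
        match_scalars <;> (field_simp; try ring)
    · refine IsTouchingAt.of_rays hε hli' hA1 hA2 (x₁ := 0) (y₁ := w⁻¹) (x₂ := w⁻¹) (y₂ := 0)
        (Or.inr (by simpa using hwn)) (Or.inl (by simpa using hwn)) ?_ ?_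
      · intro r hr hr'
        rw [hshA β hβmem, hval₂ _ (by rw [q2]; constructor <;> linarith), hdiv,
          hoα _ (hw2 r hr hr')]
        match_scalars <;> (field_simp; try ring)
      · intro r hr hr'
        rw [hshA β hβmem, (hout (u + w * β - r) (fun h => by rw [q2] at h; linarith [h.2])
          (fun h => by rw [q2] at h; linarith [h.1])).1, sub_eq_add_neg (u + w * β),
          hvα (-r) (by rw [abs_neg, abs_of_nonneg hr]; linarith)]
        match_scalars <;> (field_simp; try ring)
  -- cutting the corners
  have hpdp : sh α ∈ doublePoints T sh :=
    ⟨α, Set.Ioo_subset_Ico_self (hAT α (Or.inl rfl)), _,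
      Set.Ioo_subset_Ico_self (hQT _ (hendQ α (Or.inl rfl))), hαne.symm, rfl, hα⟩
  have hcut : ∀ η > 0, ∃ (F₁ : Space ≃ₜ Space) (sh₁ : ℝ → Plane) (g₁ : ℝ → ℝ) (B₁ : Set ℝ),
      IsotopicToId F₁ ∧ (∀ s ∈ Set.Icc 0 T, F₁ (sh' s, h' s) = (sh₁ s, g₁ s)) ∧
      IsRegularCurve T sh₁ g₁ B₁ ({sh α, sh β} \ {sh α}) ∧
      doublePoints T sh₁ = doublePoints T sh \ {sh α} ∧
      ∀ s, η ≤ |s - α| → sh₁ s = sh' s ∧ g₁ s = h' s := by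
    intro η hη
    have := hC'.cut_corner (hAT α (Or.inl rfl)) (hQT _ (hendQ α (Or.inl rfl))) hαne.symm
      (by rw [hshA α (Or.inl rfl), hshQ α (Or.inl rfl), hα])
      (hheight α (Or.inl rfl) hα hαne) htouchα hη
    rw [hdp, hshA α (Or.inl rfl)] at this
    exact this
  have hss : ∀ {S : Set Plane}, S ⊆ doublePoints T sh \ {sh α} → S ⊂ doublePoints T sh :=
    fun hS => ⟨hS.trans Set.sdiff_subset, fun h => (hS (h hpdp)).2 rfl⟩
  rcases hβν with hlt | hβν
  · have hβne : u + w * β ≠ β := by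
      have := (H.map_mem ⟨h1.le, le_rfl⟩ : u + w * β ∈ Set.Icc ν μ).1
      intro h; linarith
    have hQα : β < u + w * β :=
      hlt.trans_le (H.map_mem ⟨h1.le, le_rfl⟩ : u + w * β ∈ Set.Icc ν μ).1
    -- The first cut stays this close to `α`, so it leaves the local pictures at `β` and at its
    -- partner intact for the second cut.
    have hηpos : 0 < (β - α) / 2 := by linarith
    obtain ⟨F₁, sh₁, g₁, B₁, hF₁, hF₁s, hC₁, hdp₁, heq₁⟩ := hcut ((β - α) / 2) hηpos
    have far : ∀ s, |s - β| ≤ (β - α) / 2 → (β - α) / 2 ≤ |s - α| := fun s hs => by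
      have := (abs_le.1 hs).1
      exact le_trans (by linarith) (le_abs_self _)
    have far' : ∀ s, |s - (u + w * β)| ≤ (β - α) / 2 → (β - α) / 2 ≤ |s - α| := fun s hs => by
      have := (abs_le.1 hs).1
      exact le_trans (by linarith) (le_abs_self _)
    have hβ₁ := heq₁ β (far β (by simpa using hηpos.le))
    have hQ₁ := heq₁ (u + w * β) (far' _ (by simpa using hηpos.le))
    obtain ⟨F₂, sh₂, g₂, B₂, hF₂, hF₂s, hC₂, hdp₂, -⟩ := hC₁.cut_corner (hAT β hβmem)
      (hQT _ (hendQ β hβmem)) hβne.symm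
      (by rw [hβ₁.1, hQ₁.1, hshA β hβmem, hshQ β hβmem, hβ])
      (by rw [hβ₁.2, hQ₁.2]; exact hheight β hβmem hβ hβne)
      ((htouchβ hlt).congr hηpos (fun s hs => (heq₁ s (far s hs)).1)
        (fun s hs => (heq₁ s (far' s hs)).1)) one_pos
    rw [hβ₁.1, hshA β hβmem] at hC₂ hdp₂
    refine ⟨(F.trans F₁).trans F₂, sh₂, g₂, B₂, (hF.trans hF₁).trans hF₂, fun s hs => ?_,
      hC₂.restrict_exceptions ?_, ?_⟩
    · simp only [Homeomorph.trans_apply, hFs s hs, hF₁s s hs, hF₂s s hs]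
    · rintro x ⟨⟨⟨hx | hx, hx1⟩, hx2⟩, -⟩
      · exact hx1 hx
      · exact hx2 hx
    · refine hss ?_
      rw [hdp₂, hdp₁]
      exact Set.sdiff_subset
  -- Here `β` lies over no double point: one cut suffices, and the exception at `sh β` is vacuous.
  · obtain ⟨F₁, sh₁, g₁, B₁, hF₁, hF₁s, hC₁, hdp₁, -⟩ := hcut 1 one_pos
    refine ⟨F.trans F₁, sh₁, g₁, B₁, hF.trans hF₁, fun s hs => ?_,
      hC₁.restrict_exceptions ?_, hss hdp₁.subset⟩
    · simp only [Homeomorph.trans_apply, hFs s hs, hF₁s s hs]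
    · rintro x ⟨⟨hx | hx, hx1⟩, hx2⟩
      · exact hx1 hx
      · rw [Set.mem_singleton_iff] at hx
        rw [hdp₁, hx] at hx2
        exact hβν hx2.1

/-- The same with the lower arc first. -/
theorem IsRegularCurve.simplify_mirror {T : ℝ} {sh : ℝ → Plane} {h : ℝ → ℝ} {B : Set ℝ}
    (hC : IsRegularCurve T sh h B ∅) {α β ν μ u w : ℝ} (H : IsSwap T α β ν μ u w)
    (hα : sh (u + w * α) = sh α) (hβ : sh (u + w * β) = sh β)
    (hU : ∀ s ∈ Set.Icc α β, ∀ t ∈ Set.Ico 0 T, sh t = sh s → h s ≤ h t)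
    (hO : ∀ s ∈ Set.Icc ν μ, ∀ t ∈ Set.Ico 0 T, sh t = sh s → h t ≤ h s)
    (hβν : β < ν ∨ sh β ∉ doublePoints T sh) :
    ∃ (F : Space ≃ₜ Space) (sh' : ℝ → Plane) (h' : ℝ → ℝ) (B' : Set ℝ), IsotopicToId F ∧
      (∀ s ∈ Set.Icc 0 T, F (sh s, h s) = (sh' s, h' s)) ∧ IsRegularCurve T sh' h' B' ∅ ∧
      doublePoints T sh' ⊂ doublePoints T sh := by
  obtain ⟨F, sh', h', B', hF, hFs, hC', hdp⟩ := hC.mirror.simplify H hα hβ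
    (fun s hs t ht e => neg_le_neg (hU s hs t ht e))
    (fun s hs t ht e => neg_le_neg (hO s hs t ht e)) hβν
  refine ⟨(KnotDiag.mirror.trans F).trans KnotDiag.mirror.symm, sh', fun s => -h' s, B',
    hF.conj KnotDiag.mirror, fun s hs => ?_, hC'.mirror, hdp⟩
  have := hFs s hs
  simp only [Homeomorph.trans_apply, mirror_apply, mirror_symm_apply, this]


/-! ### Interpolation between nodes; closed polygons -/

/-- The piecewise affine interpolation of a sequence of points. -/
noncomputable def interp {E : Type*} [AddCommGroup E] [Module ℝ E] (v : ℤ → E) (r : ℝ) : E :=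
  AffineMap.lineMap (k := ℝ) (v ⌊r⌋) (v (⌊r⌋ + 1)) (Int.fract r)

section Interp

variable {E : Type*} [AddCommGroup E] [Module ℝ E] (v : ℤ → E)

@[simp] theorem interp_intCast (i : ℤ) : interp v i = v i := by simp [interp]

theorem interp_of_mem {i : ℤ} {r : ℝ} (hr : r ∈ Set.Icc (i : ℝ) (i + 1)) :
    interp v r = AffineMap.lineMap (k := ℝ) (v i) (v (i + 1)) (r - i) := by
  rcases eq_or_lt_of_le hr.2 with h | h
  · have : r = ((i + 1 : ℤ) : ℝ) := by push_cast; exact h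
    rw [this, interp_intCast]; simp
  · have : ⌊r⌋ = i := Int.floor_eq_iff.2 ⟨hr.1, h⟩
    rw [interp, Int.fract, this]

theorem interp_add_period {n : ℤ} (hv : ∀ i, v (i + n) = v i) (r : ℝ) :
    interp v (r + n) = interp v r := by
  rw [interp, interp, Int.floor_add_intCast, Int.fract_add_intCast, hv, add_right_comm, hv]

theorem continuous_interp [TopologicalSpace E] [IsTopologicalAddGroup E] [ContinuousSMul ℝ E] :
    Continuous (interp v) := by
  have hon : ∀ i : ℤ, ContinuousOn (interp v) (Set.Icc (i : ℝ) (i + 1)) := fun i =>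
    ContinuousOn.congr (f := fun r => AffineMap.lineMap (k := ℝ) (v i) (v (i + 1)) (r - i))
      (by simp only [AffineMap.lineMap_apply_module']; fun_prop) fun r hr => interp_of_mem v hr
  rw [continuous_iff_continuousAt]
  intro r
  have h1 := (hon (⌊r⌋ - 1)).union_of_isClosed (hon ⌊r⌋) isClosed_Icc isClosed_Icc
  refine h1.continuousAt ?_
  have hlt := Int.lt_floor_add_one r
  have hle := Int.floor_le r
  refine Filter.mem_of_superset (Ioo_mem_nhds (by linarith : (⌊r⌋ : ℝ) - 1 < r) hlt) ?_
  intro x hx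
  push_cast
  rcases le_total x ⌊r⌋ with h | h
  · exact Or.inl ⟨hx.1.le, by linarith⟩
  · exact Or.inr ⟨h, hx.2.le⟩

theorem interp_strictMono_surjective {e : ℤ → ℝ} (he : StrictMono e)
    (hlo : ∀ y, ∃ i, e i ≤ y) (hhi : ∀ y, ∃ i, y < e i) :
    StrictMono (interp e) ∧ Function.Surjective (interp e) := by
  have hval : ∀ r, interp e r = e ⌊r⌋ + Int.fract r * (e (⌊r⌋ + 1) - e ⌊r⌋) := fun r => by
    rw [interp, AffineMap.lineMap_apply_module', smul_eq_mul, add_comm]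
  have hstep : ∀ i : ℤ, 0 < e (i + 1) - e i := fun i => sub_pos.2 (he (lt_add_one i))
  refine ⟨fun r r' h => ?_, fun y => ?_⟩
  · rw [hval, hval]
    rcases eq_or_lt_of_le (Int.floor_mono h.le) with h1 | h1
    · rw [← h1]
      have : Int.fract r < Int.fract r' := by
        rw [Int.fract, Int.fract, ← h1]; linarith
      nlinarith [hstep ⌊r⌋]
    · have h2 : e (⌊r⌋ + 1) ≤ e ⌊r'⌋ := he.monotone h1
      have h3 := Int.fract_lt_one r
      have h4 := mul_nonneg (Int.fract_nonneg r') (hstep ⌊r'⌋).le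
      nlinarith [hstep ⌊r⌋]
  · obtain ⟨i₀, hi₀⟩ := hlo y
    obtain ⟨i₁, hi₁⟩ := hhi y
    obtain ⟨i, hi, him⟩ := Int.exists_greatest_of_bdd (P := fun i => e i ≤ y)
      ⟨i₁, fun z hz => (he.lt_iff_lt.1 (hz.trans_lt hi₁)).le⟩ ⟨i₀, hi₀⟩
    have hlt : y < e (i + 1) := by
      by_contra hc
      have := him _ (not_lt.1 hc)
      omega
    have hs := hstep i
    refine ⟨i + (y - e i) / (e (i + 1) - e i), ?_⟩
    rw [interp_of_mem e (i := i) ⟨?_, ?_⟩, add_sub_cancel_left, AffineMap.lineMap_apply_module',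
      smul_eq_mul, div_mul_cancel₀ _ hs.ne', sub_add_cancel]
    · have := div_nonneg (sub_nonneg.2 hi) hs.le
      linarith
    · have := (div_le_one hs).2 (by linarith : y - e i ≤ e (i + 1) - e i)
      linarith

end Interp

/-- An increasing sequence of reals that grows by `T` when the index grows by `k`. -/
structure IsNodes (T : ℝ) (k : ℕ) (e : ℤ → ℝ) : Prop where
  strictMono : StrictMono e
  add_period : ∀ i, e (i + k) = e i + T

namespace IsNodes

variable {T : ℝ} {k : ℕ} {e : ℤ → ℝ} (H : IsNodes T k e) (hT : 0 < T)

include H in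
theorem add_mul_period (i : ℤ) (m : ℤ) : e (i + m * k) = e i + m * T := by
  induction m using Int.induction_on with
  | zero => simp
  | succ m ih =>
    rw [show i + ((m : ℤ) + 1) * k = (i + m * k) + k by ring, H.add_period, ih]
    push_cast; ring
  | pred m ih =>
    have := H.add_period (i + (-(m : ℤ) - 1) * k)
    rw [show i + (-(m : ℤ) - 1) * k + k = i + -(m : ℤ) * k by ring, ih] at this
    push_cast at this ⊢; linarith

include H hT

theorem exists_le (y : ℝ) : ∃ i, e i ≤ y := by
  obtain ⟨m, hm⟩ := exists_int_lt ((y - e 0) / T)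
  refine ⟨0 + m * k, ?_⟩
  rw [H.add_mul_period]
  rw [lt_div_iff₀ hT] at hm
  linarith

theorem exists_gt (y : ℝ) : ∃ i, y < e i := by
  obtain ⟨m, hm⟩ := exists_int_gt ((y - e 0) / T)
  refine ⟨0 + m * k, ?_⟩
  rw [H.add_mul_period]
  rw [div_lt_iff₀ hT] at hm
  linarith

/-- The piecewise affine reparametrization of the line that carries the integers to the nodes. -/
noncomputable def param : ℝ ≃o ℝ :=
  (interp_strictMono_surjective H.strictMono (H.exists_le hT)
    (H.exists_gt hT)).1.orderIsoOfSurjective _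
    (interp_strictMono_surjective H.strictMono (H.exists_le hT) (H.exists_gt hT)).2

theorem param_apply (r : ℝ) : H.param hT r = interp e r := rfl

theorem param_intCast (i : ℤ) : H.param hT i = e i := interp_intCast e i

theorem param_add_period (r : ℝ) : H.param hT (r + k) = H.param hT r + T := by
  have h1 : r + (k : ℝ) = r + ((k : ℤ) : ℝ) := by push_cast; rfl
  rw [H.param_apply, H.param_apply, h1, interp, interp, Int.floor_add_intCast,
    Int.fract_add_intCast, add_right_comm, H.add_period, H.add_period]
  simp only [AffineMap.lineMap_apply_module']
  simp only [smul_eq_mul]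
  ring

end IsNodes

/-- A finite set of reals in `[0, T)` is enumerated by a sequence of nodes. -/
theorem exists_nodes {T : ℝ} {S : Set ℝ} (hS : S.Finite) (hST : S ⊆ Set.Ico 0 T)
    (h0 : S.Nonempty) : ∃ e : ℤ → ℝ, IsNodes T S.ncard e ∧
      (∀ i : ℤ, 0 ≤ i → i < S.ncard → e i ∈ S) ∧
      ∀ x ∈ S, ∃ i : ℤ, 0 ≤ i ∧ i < S.ncard ∧ e i = x := by
  obtain ⟨k, hk⟩ : ∃ k, k = S.ncard := ⟨_, rfl⟩
  rw [← hk]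
  have hcard : hS.toFinset.card = k := by rw [hk, Set.ncard_eq_toFinset_card S hS]
  have hk0 : 0 < k := by rw [hk]; exact (Set.ncard_pos hS).2 h0
  have hk0' : (0 : ℤ) < k := by exact_mod_cast hk0
  let f := hS.toFinset.orderEmbOfFin hcard
  have hfS : ∀ j, f j ∈ S := fun j => hS.mem_toFinset.1 (Finset.orderEmbOfFin_mem _ hcard j)
  let m : ℤ → Fin k := fun i => ⟨(i % k).toNat, by
    have h1 := Int.emod_nonneg i hk0'.ne'
    have h2 := Int.emod_lt_of_pos i hk0'
    omega⟩
  have hmval : ∀ i, ((m i : ℕ) : ℤ) = i % k := fun i => by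
    have h1 := Int.emod_nonneg i hk0'.ne'
    simp [m, h1]
  -- The increasing enumeration of `S`, continued periodically by quotient and remainder of the
  -- index modulo `k`.
  let e : ℤ → ℝ := fun i => f (m i) + (i / k : ℤ) * T
  have hper : ∀ i, e (i + k) = e i + T := by
    intro i
    have h1 : m (i + k) = m i := by
      ext; zify; rw [hmval, hmval]; simp
    simp only [e, h1, Int.add_ediv_of_dvd_right (dvd_refl (k : ℤ)), Int.ediv_self hk0'.ne']
    push_cast; ring
  have hsm : StrictMono e := by
    refine strictMono_int_of_lt_succ fun i => ?_
    have h1 := Int.emod_nonneg i hk0'.ne'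
    have h2 := Int.emod_lt_of_pos i hk0'
    have h3 := Int.mul_ediv_add_emod i k
    by_cases h4 : i % k + 1 < k
    · have e1 : (i + 1) / k = i / k := by
        rw [Int.ediv_eq_iff_of_pos hk0']
        constructor
        · nlinarith
        · nlinarith
      have e2 : (i + 1) % k = i % k + 1 := by
        have := Int.mul_ediv_add_emod (i + 1) k
        rw [e1] at this; linarith
      have e3 : m i < m (i + 1) := by
        rw [Fin.lt_def]; zify; rw [hmval, hmval, e2]; linarith
      have := f.strictMono e3
      simp only [e, e1]
      linarith
    -- At the end of a turn the step is from the last element to `T` plus the first one, and `S ⊆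
    -- [0, T)` makes it positive.
    · have h5 : i % k = k - 1 := by omega
      have e1 : (i + 1) / k = i / k + 1 := by
        rw [Int.ediv_eq_iff_of_pos hk0']
        constructor
        · nlinarith
        · nlinarith
      have := (hST (hfS (m i))).2
      have := (hST (hfS (m (i + 1)))).1
      simp only [e, e1]
      push_cast
      nlinarith
  have hsmall : ∀ i : ℤ, 0 ≤ i → i < k → e i = f (m i) := fun i h1 h2 => by
    simp [e, Int.ediv_eq_zero_of_lt h1 h2]
  refine ⟨e, ⟨hsm, hper⟩, fun i h1 h2 => ?_, fun x hx => ?_⟩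
  · rw [hsmall i h1 h2]; exact hfS _
  · have hx' : x ∈ Set.range f := by
      rw [Finset.range_orderEmbOfFin, Set.Finite.coe_toFinset]; exact hx
    obtain ⟨j, hj⟩ := hx'
    refine ⟨(j : ℕ), by positivity, by exact_mod_cast j.2, ?_⟩
    rw [hsmall _ (by positivity) (by exact_mod_cast j.2), ← hj]
    congr 1
    ext; zify; rw [hmval]
    exact Int.emod_eq_of_lt (by positivity) (by exact_mod_cast j.2)

/-- A fine subdivision that avoids a finite set. -/
theorem exists_mesh {T : ℝ} (hT : 0 < T) {δ : ℝ} (hδ : 0 < δ) {X : Set ℝ} (hX : X.Finite) :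
    ∃ S : Set ℝ, S.Finite ∧ S ⊆ Set.Ioo 0 T ∧ Disjoint S X ∧
      ∀ a b, 0 ≤ a → a + δ ≤ b → b ≤ T → ∃ m ∈ S, a < m ∧ m < b := by
  -- Cells of length `κ ≤ δ / 2`, with one point in each: an interval of length `δ` contains a whole
  -- open cell.
  obtain ⟨N, hN⟩ := exists_nat_gt (2 * T / δ)
  have hN0 : 0 < (N : ℝ) := lt_trans (by positivity) hN
  obtain ⟨κ, hκ⟩ : ∃ κ, κ = T / N := ⟨_, rfl⟩
  have hκ0 : 0 < κ := by rw [hκ]; positivity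
  have hκN : κ * N = T := by rw [hκ]; field_simp
  have hκδ : 2 * κ ≤ δ := by
    rw [hκ, ← mul_div_assoc, div_le_iff₀ hN0]
    rw [div_lt_iff₀ hδ] at hN
    linarith
  have hch : ∀ j : ℕ, ∃ m, j * κ < m ∧ m < (j + 1) * κ ∧ m ∉ X := by
    intro j
    have : (Set.Ioo (j * κ) ((j + 1) * κ)).Infinite := Set.Ioo_infinite (by nlinarith)
    obtain ⟨m, hm⟩ := (this.sdiff hX).nonempty
    exact ⟨m, hm.1.1, hm.1.2, hm.2⟩
  choose m hm1 hm2 hm3 using hch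
  refine ⟨m '' (Finset.range N : Set ℕ), (Finset.finite_toSet _).image m, ?_, ?_, ?_⟩
  · rintro _ ⟨j, hj, rfl⟩
    rw [Finset.mem_coe, Finset.mem_range] at hj
    have hj' : (j : ℝ) + 1 ≤ N := by exact_mod_cast hj
    have := hm1 j
    have := hm2 j
    exact ⟨lt_of_le_of_lt (by positivity) (hm1 j), by nlinarith⟩
  · rw [Set.disjoint_left]
    rintro _ ⟨j, -, rfl⟩ hx
    exact hm3 j hx
  · intro a b ha hab hb
    have h1 := Nat.le_ceil (a / κ)
    have h2 := Nat.ceil_lt_add_one (div_nonneg ha hκ0.le)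
    rw [div_le_iff₀ hκ0] at h1
    have h3 : (⌈a / κ⌉₊ : ℝ) * κ < a + κ := by
      calc (⌈a / κ⌉₊ : ℝ) * κ < (a / κ + 1) * κ := mul_lt_mul_of_pos_right h2 hκ0
        _ = a + κ := by field_simp
    have h4 : (⌈a / κ⌉₊ + 1 : ℝ) * κ < b := by nlinarith
    refine ⟨m ⌈a / κ⌉₊, ⟨_, ?_, rfl⟩, h1.trans_lt (hm1 _), (hm2 _).trans h4⟩
    rw [Finset.mem_coe, Finset.mem_range]
    have : (⌈a / κ⌉₊ + 1 : ℝ) * κ < N * κ := by rw [mul_comm (N : ℝ), hκN]; linarith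
    have := lt_of_mul_lt_mul_right this hκ0.le
    exact_mod_cast lt_trans (lt_add_one _) this

namespace PolygonalKnot

theorem curve_eq_interp (P : PolygonalKnot) : P.curve = interp fun i : ℤ => P.v (i : ZMod P.n) :=
  rfl

theorem continuous_curve (P : PolygonalKnot) : Continuous P.curve := by
  rw [curve_eq_interp]; exact continuous_interp _

theorem curve_add_period (P : PolygonalKnot) (s : ℝ) : P.curve (s + P.n) = P.curve s := by
  have := interp_add_period (fun i : ℤ => P.v (i : ZMod P.n)) (n := P.n) (by simp) s
  rw [curve_eq_interp]
  exact_mod_cast this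

end PolygonalKnot

/-- A closed curve that is affine between finitely many nodes is a polygonal knot, up to
parametrization. -/
theorem exists_polygonalKnot {T : ℝ} (hT : 0 < T) {k : ℕ} (hk : 3 ≤ k) {e : ℤ → ℝ}
    (H : IsNodes T k e) (h0 : e 0 = 0) (g : ℝ → Space) (hclosed : g T = g 0)
    (hg : ∀ i : ℤ, 0 ≤ i → i < k → ∀ r : ℝ, r ∈ Set.Icc (0 : ℝ) 1 →
      g (e i + r * (e (i + 1) - e i)) = AffineMap.lineMap (k := ℝ) (g (e i)) (g (e (i + 1))) r)
    (hinj : Set.InjOn g (Set.Ico 0 T)) :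
    ∃ P : PolygonalKnot, P.n = k ∧ ∀ r ∈ Set.Icc (0 : ℝ) k, P.curve r = g (H.param hT r) := by
  have hk0 : 0 < k := by omega
  have : NeZero k := ⟨hk0.ne'⟩
  let v : ZMod k → Space := fun j => g (e (j.val : ℤ))
  have hek : e k = T := by have := H.add_period 0; rwa [zero_add, h0, zero_add] at this
  have hv : ∀ i : ℤ, 0 ≤ i → i ≤ k → v (i : ZMod k) = g (e i) := by
    intro i h1 h2
    rcases eq_or_lt_of_le h2 with rfl | h2
    · simp [v, hek, h0, hclosed]
    · simp only [v]
      rw [ZMod.val_intCast, Int.emod_eq_of_lt h1 h2]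
  have hcurve : ∀ r ∈ Set.Ico (0 : ℝ) k,
      interp (fun i : ℤ => v (i : ZMod k)) r = g (H.param hT r) := by
    intro r hr
    have h1 : 0 ≤ ⌊r⌋ := Int.floor_nonneg.2 hr.1
    have h2 : ⌊r⌋ < k := Int.floor_lt.2 (by exact_mod_cast hr.2)
    rw [interp, hv _ h1 h2.le, hv _ (by omega) (by omega),
      ← hg _ h1 h2 _ ⟨Int.fract_nonneg r, (Int.fract_lt_one r).le⟩, H.param_apply, interp,
      AffineMap.lineMap_apply_module', smul_eq_mul, add_comm]
  have hmem : ∀ r ∈ Set.Ico (0 : ℝ) k, H.param hT r ∈ Set.Ico 0 T := by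
    intro r hr
    have e1 := H.param_intCast hT 0
    have e2 := H.param_intCast hT k
    push_cast at e1 e2
    rw [h0] at e1
    rw [hek] at e2
    have a1 := (H.param hT).monotone hr.1
    have a2 := (H.param hT).strictMono hr.2
    rw [e1] at a1
    rw [e2] at a2
    exact ⟨a1, a2⟩
  refine ⟨⟨k, hk, v, fun r hr r' hr' hrr => ?_⟩, rfl, fun r hr => ?_⟩
  · have h1 : interp (fun i : ℤ => v (i : ZMod k)) r = interp (fun i : ℤ => v (i : ZMod k)) r' :=
      hrr
    rw [hcurve r hr, hcurve r' hr'] at h1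
    exact (H.param hT).injective (hinj (hmem r hr) (hmem r' hr') h1)
  · change interp (fun i : ℤ => v (i : ZMod k)) r = _
    rcases eq_or_lt_of_le hr.2 with rfl | h
    · have e1 := interp_intCast (fun i : ℤ => v (i : ZMod k)) k
      have e2 := H.param_intCast hT k
      push_cast at e1 e2
      rw [e1, e2]
      simpa using hv k (by positivity) le_rfl
    · exact hcurve r ⟨hr.1, h⟩


/-! ### From regular curves back to diagrams -/

theorem exists_pos_lower_bound {ι : Type*} {S : Set ι} (hS : S.Finite) (f : ι → ℝ)
    (hf : ∀ i ∈ S, 0 < f i) : ∃ η, 0 < η ∧ ∀ i ∈ S, η ≤ f i := by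
  rcases S.eq_empty_or_nonempty with rfl | hne
  · exact ⟨1, one_pos, by simp⟩
  · obtain ⟨i, hi, hm⟩ := Set.exists_min_image S f hS hne
    exact ⟨f i, hf i hi, hm⟩

namespace IsNodes

variable {T : ℝ} {k : ℕ} {e : ℤ → ℝ} (H : IsNodes T k e) (hT : 0 < T)

include H in
theorem apply_eq (h0 : e 0 = 0) : e k = T := by
  have := H.add_period 0; rwa [zero_add, h0, zero_add] at this

theorem param_zero (h0 : e 0 = 0) : H.param hT 0 = 0 := by
  have e1 := H.param_intCast hT 0
  push_cast at e1
  rw [e1, h0]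

theorem param_natCast (h0 : e 0 = 0) : H.param hT k = T := by
  have e1 := H.param_intCast hT k
  push_cast at e1
  rw [e1, H.apply_eq h0]

theorem param_mem_Ico (h0 : e 0 = 0) {r : ℝ} :
    H.param hT r ∈ Set.Ico 0 T ↔ r ∈ Set.Ico (0 : ℝ) k := by
  have h1 := (H.param hT).le_iff_le (x := 0) (y := r)
  have h2 := (H.param hT).lt_iff_lt (x := r) (y := k)
  rw [H.param_zero hT h0] at h1
  rw [H.param_natCast hT h0] at h2
  exact and_congr h1 h2

theorem param_mem_Icc (h0 : e 0 = 0) {r : ℝ} :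
    H.param hT r ∈ Set.Icc 0 T ↔ r ∈ Set.Icc (0 : ℝ) k := by
  have h1 := (H.param hT).le_iff_le (x := 0) (y := r)
  have h2 := (H.param hT).le_iff_le (x := r) (y := k)
  rw [H.param_zero hT h0] at h1
  rw [H.param_natCast hT h0] at h2
  exact and_congr h1 h2

theorem param_intCast_add (i : ℤ) {r : ℝ} (hr : r ∈ Set.Icc (0 : ℝ) 1) :
    H.param hT (i + r) = e i + r * (e (i + 1) - e i) := by
  rw [H.param_apply, interp_of_mem e (i := i) ⟨by linarith [hr.1], by linarith [hr.2]⟩,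
    add_sub_cancel_left, AffineMap.lineMap_apply_module', smul_eq_mul, add_comm]

end IsNodes

/-- The crossing parameters of a regular curve. -/
def crossingParams (T : ℝ) (sh : ℝ → Plane) : Set ℝ :=
  {s | s ∈ Set.Ico 0 T ∧ ∃ t ∈ Set.Ico 0 T, s ≠ t ∧ sh s = sh t}

theorem IsRegularCurve.finite_crossingParams {T : ℝ} {sh : ℝ → Plane} {h : ℝ → ℝ} {B : Set ℝ}
    {E : Set Plane} (hC : IsRegularCurve T sh h B E) : (crossingParams T sh).Finite := by
  have : crossingParams T sh ⊆ ⋃ x ∈ doublePoints T sh, {s | s ∈ Set.Ico 0 T ∧ sh s = x} := by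
    rintro s ⟨hs, t, ht, hst, h⟩
    simp only [Set.mem_iUnion]
    exact ⟨sh s, ⟨s, hs, t, ht, hst, rfl, h.symm⟩, hs, rfl⟩
  refine (hC.finite.biUnion fun x hx => ?_).subset this
  obtain ⟨a, ha, b, hb, hab, hax, hbx⟩ := hx
  refine (Set.toFinite {a, b}).subset ?_
  rintro s ⟨hs, hsx⟩
  rcases hC.double s hs a ha b hb (hsx.trans hax.symm) (hax.trans hbx.symm) with h | h | h
  · exact Or.inl h
  · exact absurd h hab
  · exact Or.inr h

/-- A regular closed curve is isotopic to a knot diagram with the same double points. -/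
theorem IsRegularCurve.exists_diagram {T : ℝ} {sh : ℝ → Plane} {h : ℝ → ℝ} {B : Set ℝ}
    (hC : IsRegularCurve T sh h B ∅) :
    ∃ (D : KnotDiagram) (F : Space ≃ₜ Space) (ψ : ℝ ≃o ℝ), IsotopicToId F ∧ ψ 0 = 0 ∧
      (∀ r, ψ (r + D.n) = ψ r + T) ∧ (∀ r ∈ Set.Icc (0 : ℝ) D.n,
        F (sh (ψ r), h (ψ r)) = D.curve r) ∧ D.multiplePoints = doublePoints T sh := by
  have hT := hC.pos
  have hX := hC.finite_crossingParams
  -- The least difference of heights at a crossing. Heights that change by at most `η / 4` keep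
  -- their order over each double point.
  obtain ⟨η, hη, hηX⟩ := exists_pos_lower_bound
    (S := {p : ℝ × ℝ | p ∈ crossingParams T sh ×ˢ crossingParams T sh ∧ p.1 ≠ p.2 ∧
      sh p.1 = sh p.2}) ((hX.prod hX).subset fun p hp => hp.1) (fun p => |h p.1 - h p.2|) (by
    rintro ⟨s, t⟩ ⟨⟨hs, ht⟩, hne, hsh⟩
    refine abs_pos.2 (sub_ne_zero.2 fun hh => hne (hC.inj s hs.1 t ht.1 hsh hh)))
  have hgap : ∀ s ∈ Set.Ico 0 T, ∀ t ∈ Set.Ico 0 T, s ≠ t → sh s = sh t → η ≤ |h s - h t| :=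
    fun s hs t ht hne hsh => hηX (s, t)
      ⟨⟨⟨hs, t, ht, hne, hsh⟩, ⟨ht, s, hs, hne.symm, hsh.symm⟩⟩, hne, hsh⟩
  have huc := Metric.uniformContinuousOn_iff.1
    (isCompact_Icc.uniformContinuousOn_of_continuous (hC.cont_h.continuousOn (s := Set.Icc 0 T)))
    (η / 4) (by positivity)
  obtain ⟨δ₀, hδ₀, huc⟩ := huc
  -- Steps shorter than `T / 3` force at least three vertices.
  obtain ⟨δ, hδ⟩ : ∃ δ, δ = min δ₀ (T / 3) := ⟨_, rfl⟩
  have hδpos : 0 < δ := by rw [hδ]; positivity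
  have hδ1 : δ ≤ δ₀ := by rw [hδ]; exact min_le_left _ _
  have hδ2 : δ ≤ T / 3 := by rw [hδ]; exact min_le_right _ _
  -- The additional vertices avoid the crossing parameters, so the projection remains regular.
  obtain ⟨M, hM, hM0, hMX, hmesh⟩ := exists_mesh hT hδpos hX
  obtain ⟨S, hS⟩ : ∃ S, S = (B ∩ Set.Ico 0 T) ∪ M := ⟨_, rfl⟩
  have hSf : S.Finite := by rw [hS]; exact (hC.finite_B.inter_of_left _).union hM
  have h0S : (0 : ℝ) ∈ S := by rw [hS]; exact Or.inl ⟨hC.zero_mem, le_rfl, hT⟩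
  have hST : S ⊆ Set.Ico 0 T := by
    rw [hS]; exact Set.union_subset Set.inter_subset_right (hM0.trans Set.Ioo_subset_Ico_self)
  obtain ⟨e, H, heS, hSe⟩ := exists_nodes hSf hST ⟨0, h0S⟩
  obtain ⟨k, hk⟩ : ∃ k, k = S.ncard := ⟨_, rfl⟩
  rw [← hk] at H heS hSe
  have hkpos : 0 < k := by rw [hk]; exact (Set.ncard_pos hSf).2 ⟨0, h0S⟩
  have h0 : e 0 = 0 := by
    obtain ⟨i, hi, -, hi0⟩ := hSe 0 h0S
    have h1 : e 0 ≤ e i := H.strictMono.monotone hi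
    exact le_antisymm (hi0 ▸ h1) (hST (heS 0 le_rfl (by exact_mod_cast hkpos))).1
  have hek := H.apply_eq h0
  have heT : ∀ i : ℤ, i ≤ k → e i ≤ T := fun i hi => hek ▸ H.strictMono.monotone hi
  have he0 : ∀ i : ℤ, 0 ≤ i → 0 ≤ e i := fun i hi => h0 ▸ H.strictMono.monotone hi
  have hno : ∀ i : ℤ, ∀ x ∈ S, ¬(e i < x ∧ x < e (i + 1)) := by
    rintro i x hx ⟨h1, h2⟩
    obtain ⟨j, -, -, rfl⟩ := hSe x hx
    have := H.strictMono.lt_iff_lt.1 h1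
    have := H.strictMono.lt_iff_lt.1 h2
    omega
  have hstep : ∀ i : ℤ, 0 ≤ i → i < k → e (i + 1) < e i + δ := by
    intro i h1 h2
    by_contra hcon
    obtain ⟨m, hm, hm1, hm2⟩ := hmesh (e i) (e (i + 1)) (he0 i h1) (not_lt.1 hcon)
      (heT _ (by omega))
    exact hno i m (by rw [hS]; exact Or.inr hm) ⟨hm1, hm2⟩
  have hk3 : 3 ≤ k := by
    by_contra hcon
    have h1 := hstep 0 le_rfl (by omega)
    rw [h0, zero_add] at h1
    interval_cases k
    · push_cast at hek; linarith
    · have h2 := hstep 1 (by norm_num) (by norm_num)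
      push_cast at hek
      norm_num at h2
      linarith
  -- every parameter lies between two consecutive nodes
  have hnode : ∀ s ∈ Set.Icc 0 T, ∃ i : ℤ, 0 ≤ i ∧ i < k ∧ ∃ r ∈ Set.Icc (0 : ℝ) 1,
      s = e i + r * (e (i + 1) - e i) := by
    intro s hs
    rcases eq_or_lt_of_le hs.2 with rfl | hlt
    · refine ⟨k - 1, by omega, by omega, 1, ⟨zero_le_one, le_rfl⟩, ?_⟩
      rw [sub_add_cancel, hek]; ring
    · obtain ⟨r, hr⟩ := (H.param hT).surjective s
      have hr' := (H.param_mem_Ico hT h0).1 (hr ▸ (⟨hs.1, hlt⟩ : s ∈ Set.Ico 0 T))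
      refine ⟨⌊r⌋, Int.floor_nonneg.2 hr'.1, Int.floor_lt.2 (by exact_mod_cast hr'.2),
        Int.fract r, ⟨Int.fract_nonneg r, (Int.fract_lt_one r).le⟩, ?_⟩
      rw [← H.param_intCast_add hT _ ⟨Int.fract_nonneg r, (Int.fract_lt_one r).le⟩,
        Int.floor_add_fract, hr]
  obtain ⟨q, hq⟩ : ∃ q : ℝ → ℝ, q = fun s => interp (fun i => h (e i)) ((H.param hT).symm s) :=
    ⟨_, rfl⟩
  have hqc : Continuous q := by
    rw [hq]
    exact (continuous_interp _).comp (H.param hT).symm.continuous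
  have hqv : ∀ i : ℤ, ∀ r ∈ Set.Icc (0 : ℝ) 1, q (e i + r * (e (i + 1) - e i)) =
      h (e i) + r * (h (e (i + 1)) - h (e i)) := by
    intro i r hr
    rw [hq, ← H.param_intCast_add hT i hr]
    dsimp only
    rw [OrderIso.symm_apply_apply,
      interp_of_mem _ (i := i) ⟨by linarith [hr.1], by linarith [hr.2]⟩, add_sub_cancel_left,
      AffineMap.lineMap_apply_module', smul_eq_mul, add_comm]
  have hqe : ∀ i : ℤ, q (e i) = h (e i) := fun i => by
    simpa using hqv i 0 ⟨le_rfl, zero_le_one⟩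
  have hq0 : q T = q 0 := by
    have h1 := hqe k
    have h2 := hqe 0
    rw [hek] at h1
    rw [h0] at h2
    rw [h1, h2, hC.closed_h]
  have hqh : ∀ s ∈ Set.Icc 0 T, |q s - h s| ≤ η / 4 := by
    intro s hs
    obtain ⟨i, hi0, hik, r, hr, rfl⟩ := hnode s hs
    have hg : 0 < e (i + 1) - e i := sub_pos.2 (H.strictMono (lt_add_one i))
    have hst := hstep i hi0 hik
    have hr1 := mul_nonneg hr.1 hg.le
    have hr2 := mul_nonneg (sub_nonneg.2 hr.2) hg.le
    have h1 := huc (e i) ⟨he0 i hi0, heT i hik.le⟩ _ hs (by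
      rw [Real.dist_eq, abs_lt]; constructor <;> nlinarith)
    have h2 := huc (e (i + 1)) ⟨he0 _ (by omega), heT _ (by omega)⟩ _ hs (by
      rw [Real.dist_eq, abs_lt]; constructor <;> nlinarith)
    rw [Real.dist_eq, abs_lt] at h1 h2
    rw [hqv i r hr, abs_le]
    have := hr.1
    have := hr.2
    constructor <;> nlinarith
  have hbar : ∀ s ∈ Set.Icc 0 T, ∃ s' ∈ Set.Ico 0 T, sh s' = sh s ∧ h s' = h s ∧ q s' = q s := by
    intro s hs
    rcases eq_or_lt_of_le hs.2 with rfl | hlt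
    · exact ⟨0, ⟨le_rfl, hT⟩, hC.closed_sh.symm, hC.closed_h.symm, hq0.symm⟩
    · exact ⟨s, ⟨hs.1, hlt⟩, rfl, rfl, rfl⟩
  -- At a crossing the difference of heights is at least `η` and changes by at most `η / 2`, so at
  -- least half of it remains; this is the hypothesis of `exists_vertical_isotopy` with `ε = 1 / 2`.
  have hmono : ∀ s ∈ Set.Icc 0 T, ∀ t ∈ Set.Icc 0 T, sh s = sh t → h s ≤ h t →
      1 / 2 * (h t - h s) ≤ q t - q s := by
    intro s hs t ht hsh hle
    obtain ⟨s', hs', e1, e2, e3⟩ := hbar s hs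
    obtain ⟨t', ht', e4, e5, e6⟩ := hbar t ht
    rw [← e2, ← e5] at hle
    rw [← e1, ← e4] at hsh
    rw [← e2, ← e3, ← e5, ← e6]
    by_cases hst : s' = t'
    · subst hst; simp
    · have h1 := hgap s' hs' t' ht' hst hsh
      have h2 := abs_le.1 (hqh s' ⟨hs'.1, hs'.2.le⟩)
      have h3 := abs_le.1 (hqh t' ⟨ht'.1, ht'.2.le⟩)
      rw [abs_sub_comm, abs_of_nonneg (sub_nonneg.2 hle)] at h1
      linarith
  obtain ⟨F, hF, hFc⟩ := exists_vertical_isotopy (S := Set.Icc 0 T) (fun s => sh s)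
    (fun s => h s) (fun s => q s) (hC.cont_sh.comp continuous_subtype_val)
    (hC.cont_h.comp continuous_subtype_val) (hqc.comp continuous_subtype_val)
    (by norm_num : (0 : ℝ) < 1 / 2) (fun s t => hmono s s.2 t t.2)
  have hinj : ∀ s ∈ Set.Ico 0 T, ∀ t ∈ Set.Ico 0 T, sh s = sh t → q s = q t → s = t :=
    inj_of_homeo hC.inj F fun s hs => hFc ⟨s, hs⟩
  obtain ⟨P, hPn, hP⟩ := exists_polygonalKnot hT hk3 H h0 (fun s => (sh s, q s))
    (by rw [hC.closed_sh, hq0]) (by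
      intro i hi0 hik r hr
      have h1 := hC.pl.affine_comb (he0 i hi0) (H.strictMono (lt_add_one i)) (heT _ (by omega))
        (fun x hx hlt => hno i x (by
          rw [hS]
          exact Or.inl ⟨hx, (he0 i hi0).trans hlt.1.le, hlt.2.trans_le (heT _ (by omega))⟩) hlt)
        hr.1 hr.2
      have h2 := hqv i r hr
      ext1
      · rw [AffineMap.lineMap_apply_module']
        simp only [Prod.fst_add, Prod.smul_fst, Prod.fst_sub]
        rw [h1, add_comm]
      · rw [AffineMap.lineMap_apply_module']
        simp only [Prod.snd_add, Prod.smul_snd, Prod.snd_sub]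
        rw [h2, hqe, hqe, add_comm, smul_eq_mul])
    (fun s hs t ht hst => hinj s hs t ht (congrArg Prod.fst hst) (congrArg Prod.snd hst))
  have hshP : ∀ r ∈ Set.Ico (0 : ℝ) k, P.shadow r = sh (H.param hT r) := fun r hr => by
    rw [PolygonalKnot.shadow, hP r ⟨hr.1, hr.2.le⟩]
  have hmp : P.multiplePoints = doublePoints T sh := by
    ext x
    constructor
    · rintro ⟨s, hs, t, ht, hst, h1, h2⟩
      rw [hPn] at hs ht
      rw [hshP s hs] at h1
      rw [hshP t ht] at h2
      exact ⟨_, (H.param_mem_Ico hT h0).2 hs, _, (H.param_mem_Ico hT h0).2 ht,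
        (H.param hT).injective.ne hst, h1, h2⟩
    · rintro ⟨s, hs, t, ht, hst, h1, h2⟩
      obtain ⟨s, rfl⟩ := (H.param hT).surjective s
      obtain ⟨t, rfl⟩ := (H.param hT).surjective t
      have hs' := (H.param_mem_Ico hT h0).1 hs
      have ht' := (H.param_mem_Ico hT h0).1 ht
      refine ⟨s, by rwa [hPn], t, by rwa [hPn], fun h => hst (h ▸ rfl), ?_, ?_⟩
      · rwa [hshP s hs']
      · rwa [hshP t ht']
  refine ⟨⟨P, ?_, ?_, ?_⟩, F, H.param hT, hF, H.param_zero hT h0, fun r => ?_, fun r hr => ?_, hmp⟩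
  · rw [hmp]; exact hC.finite
  · intro s hs t ht u hu h1 h2
    rw [hPn] at hs ht hu
    rw [hshP s hs, hshP t ht] at h1
    rw [hshP t ht, hshP u hu] at h2
    have := hC.double _ ((H.param_mem_Ico hT h0).2 hs) _ ((H.param_mem_Ico hT h0).2 ht) _
      ((H.param_mem_Ico hT h0).2 hu) h1 h2
    simpa only [(H.param hT).injective.eq_iff] using this
  · intro i hi t ht h1
    rw [hPn] at hi ht
    have hi' : (i : ℝ) ∈ Set.Ico (0 : ℝ) k := ⟨by positivity, by exact_mod_cast hi⟩
    rw [hshP t ht, hshP i hi'] at h1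
    have hei : H.param hT i = e i := by simpa using H.param_intCast hT i
    have htm := (H.param_mem_Ico hT h0).2 ht
    have him := (H.param_mem_Ico hT h0).2 hi'
    refine (H.param hT).injective ?_
    have hmem := heS i (by positivity) (by exact_mod_cast hi)
    rw [hS, ← hei] at hmem
    rcases hmem with hb | hm
    · simpa using hC.vertex _ hb.1 him _ htm h1
    · by_contra hne
      exact Set.disjoint_left.1 hMX hm ⟨him, _, htm, Ne.symm hne, h1.symm⟩
  · change H.param hT (r + P.n) = _
    rw [hPn, H.param_add_period]
  · change _ = P.curve r
    change r ∈ Set.Icc (0 : ℝ) P.n at hr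
    rw [hPn] at hr
    rw [hP r hr]
    exact hFc ⟨_, (H.param_mem_Icc hT h0).2 hr⟩


/-! ### Parameters modulo a full turn; bigons in diagrams -/

namespace PolygonalKnot

variable (P : PolygonalKnot)

theorem n_pos : (0 : ℝ) < P.n := by
  have := P.three_le
  exact_mod_cast (by omega : 0 < P.n)

/-- Two parameters describe the same point of the polygon. -/
def Cong (s t : ℝ) : Prop := ∃ m : ℤ, s = t + m * P.n

variable {P} {s t u : ℝ}

theorem Cong.symm (h : P.Cong s t) : P.Cong t s := by
  obtain ⟨m, hm⟩ := h
  exact ⟨-m, by rw [hm]; push_cast; ring⟩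

theorem Cong.trans (h : P.Cong s t) (h' : P.Cong t u) : P.Cong s u := by
  obtain ⟨m, rfl⟩ := h
  obtain ⟨m', rfl⟩ := h'
  exact ⟨m + m', by push_cast; ring⟩

theorem Cong.curve (h : P.Cong s t) : P.curve s = P.curve t := by
  obtain ⟨m, rfl⟩ := h
  exact (Function.Periodic.int_mul P.curve_add_period m) t

theorem Cong.shadow (h : P.Cong s t) : P.shadow s = P.shadow t := congrArg Prod.fst h.curve

theorem Cong.height (h : P.Cong s t) : P.height s = P.height t := congrArg Prod.snd h.curve

theorem Cong.eq (h : P.Cong s t) (h1 : s - t < P.n) (h2 : t - s < P.n) : s = t := by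
  obtain ⟨m, rfl⟩ := h
  have hn := P.n_pos
  have h3 : (m : ℝ) < 1 := by nlinarith
  have h4 : (-1 : ℝ) < m := by nlinarith
  have h5 : m < 1 := by exact_mod_cast h3
  have h6 : -1 < m := by exact_mod_cast h4
  have : m = 0 := by omega
  simp [this]

theorem exists_cong (P : PolygonalKnot) (s a : ℝ) :
    ∃ t ∈ Set.Ico a (a + P.n), P.Cong s t := by
  refine ⟨toIcoMod P.n_pos a s, toIcoMod_mem_Ico _ _ _, toIcoDiv P.n_pos a s, ?_⟩
  have := toIcoMod_add_toIcoDiv_zsmul P.n_pos a s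
  rw [zsmul_eq_mul] at this
  exact this.symm

theorem Cong.eq_of_mem {a : ℝ} (h : P.Cong s t) (hs : s ∈ Set.Ico a (a + P.n))
    (ht : t ∈ Set.Ico a (a + P.n)) : s = t :=
  h.eq (by linarith [hs.2, ht.1]) (by linarith [hs.1, ht.2])

theorem exists_cong' (P : PolygonalKnot) (s : ℝ) : ∃ t ∈ Set.Ico (0 : ℝ) P.n, P.Cong s t := by
  simpa using P.exists_cong s 0

theorem cong_of_curve_eq (h : P.curve s = P.curve t) : P.Cong s t := by
  obtain ⟨s', hs', e1⟩ := P.exists_cong' s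
  obtain ⟨t', ht', e2⟩ := P.exists_cong' t
  rw [e1.curve, e2.curve] at h
  have : s' = t' := P.simple hs' ht' h
  subst this
  exact e1.trans e2.symm

theorem mem_multiplePoints_iff {x : Plane} : x ∈ P.multiplePoints ↔
    ∃ s t, ¬ P.Cong s t ∧ P.shadow s = x ∧ P.shadow t = x := by
  constructor
  · rintro ⟨s, hs, t, ht, hst, h1, h2⟩
    exact ⟨s, t, fun h => hst (Cong.eq_of_mem (a := 0) h (by simpa using hs) (by simpa using ht)),
      h1, h2⟩
  · rintro ⟨s, t, hst, h1, h2⟩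
    obtain ⟨s', hs', e1⟩ := P.exists_cong' s
    obtain ⟨t', ht', e2⟩ := P.exists_cong' t
    refine ⟨s', hs', t', ht', ?_, by rw [← e1.shadow, h1], by rw [← e2.shadow, h2]⟩
    rintro rfl
    exact hst (e1.trans e2.symm)

theorem continuous_shadow (P : PolygonalKnot) : Continuous P.shadow := P.continuous_curve.fst

theorem continuous_height (P : PolygonalKnot) : Continuous P.height := P.continuous_curve.snd

theorem plOn_curve (P : PolygonalKnot) {a b : ℝ} :
    PLOn P.curve {x | ∃ i : ℤ, x = i} a b := by
  intro c d hc hcd hd hx s hs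
  have h1 := Int.floor_le c
  have h2 : d ≤ ⌊c⌋ + 1 := by
    by_contra h
    exact hx (⌊c⌋ + 1 : ℤ) ⟨_, rfl⟩ ⟨by push_cast; exact Int.lt_floor_add_one c,
      by push_cast; exact not_le.1 h⟩
  rw [curve_eq_interp, interp_of_mem _ (i := ⌊c⌋) ⟨h1.trans hs.1, hs.2.trans h2⟩,
    interp_of_mem _ (i := ⌊c⌋) ⟨h1, hcd.le.trans h2⟩,
    interp_of_mem _ (i := ⌊c⌋) ⟨h1.trans hcd.le, h2⟩]
  generalize P.v (⌊c⌋ : ℤ) = x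
  generalize P.v ((⌊c⌋ + 1 : ℤ)) = y
  have hdc : d - c ≠ 0 := by linarith
  have e1 : s - ⌊c⌋ = (c - ⌊c⌋) + (s - c) / (d - c) * ((d - ⌊c⌋) - (c - ⌊c⌋)) := by
    field_simp; ring
  rw [e1]
  simp only [AffineMap.lineMap_apply_module']
  module

/-- A match over one turn extends to the whole line by periodicity; the shift by `a` allows the
curve to be read from any starting point. -/
theorem isotopic_of_curve {P Q : PolygonalKnot} {F : Space ≃ₜ Space} (hF : IsotopicToId F)
    {a : ℝ} {ψ : ℝ ≃o ℝ} (hψ : ∀ r, ψ (r + Q.n) = ψ r + P.n)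
    (h : ∀ r ∈ Set.Icc (0 : ℝ) Q.n, F (P.curve (a + ψ r)) = Q.curve r) : P.Isotopic Q := by
  obtain ⟨H, hc, h0, rfl⟩ := hF
  have hper : ∀ r, H 1 (P.curve (a + ψ r)) = Q.curve r := by
    intro r
    obtain ⟨r', hr', m, rfl⟩ := Q.exists_cong' r
    have h1 : Function.Periodic (fun r => H 1 (P.curve (a + ψ r))) Q.n := fun r => by
      simp only [hψ, ← add_assoc, P.curve_add_period]
    rw [(Function.Periodic.int_mul Q.curve_add_period m) r', ← h r' ⟨hr'.1, hr'.2.le⟩]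
    exact (h1.int_mul m) r'
  refine ⟨H, hc, h0, (OrderIso.addRight (-a)).trans ψ.symm, fun s => ?_⟩
  rw [← hper]
  simp

end PolygonalKnot

open PolygonalKnot

namespace KnotDiagram

variable {D : KnotDiagram} {s t u : ℝ}

/-- The point with parameter `s` lies over no double point. -/
def IsPlain (D : KnotDiagram) (s : ℝ) : Prop := ¬ D.IsOvercrossing s ∧ ¬ D.IsUndercrossing s

theorem cong_of_shadow_of_height (h1 : D.shadow s = D.shadow t) (h2 : D.height s = D.height t) :
    D.Cong s t := cong_of_curve_eq (Prod.ext h1 h2)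

theorem IsPlain.cong (hs : D.IsPlain s) (h : D.shadow t = D.shadow s) : D.Cong t s := by
  refine cong_of_shadow_of_height h ?_
  exact le_antisymm (not_lt.1 fun h' => hs.2 ⟨t, h, h'⟩) (not_lt.1 fun h' => hs.1 ⟨t, h, h'⟩)

theorem cong_of_double (h1 : D.shadow s = D.shadow t) (h2 : D.shadow t = D.shadow u) :
    D.Cong s t ∨ D.Cong t u ∨ D.Cong s u := by
  obtain ⟨s', hs', e1⟩ := D.exists_cong' s
  obtain ⟨t', ht', e2⟩ := D.exists_cong' t
  obtain ⟨u', hu', e3⟩ := D.exists_cong' u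
  rw [e1.shadow, e2.shadow] at h1
  rw [e2.shadow, e3.shadow] at h2
  rcases D.double s' hs' t' ht' u' hu' h1 h2 with rfl | rfl | rfl
  · exact Or.inl (e1.trans e2.symm)
  · exact Or.inr (Or.inl (e2.trans e3.symm))
  · exact Or.inr (Or.inr (e1.trans e3.symm))

theorem cong_vertex (i : ℤ) (h : D.shadow t = D.shadow i) : D.Cong t i := by
  obtain ⟨t', ht', e1⟩ := D.exists_cong' t
  have hn := D.three_le
  have hn0 : (D.n : ℤ) ≠ 0 := by omega
  have e2 : D.Cong i ((i % D.n).toNat : ℝ) := by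
    refine ⟨i / D.n, ?_⟩
    have h1 := Int.emod_add_mul_ediv i D.n
    have h2 : ((i % D.n).toNat : ℤ) = i % D.n := Int.toNat_of_nonneg (Int.emod_nonneg _ hn0)
    have h3 : (((i % D.n).toNat : ℤ) : ℝ) + (i / (D.n : ℤ) : ℤ) * ((D.n : ℤ) : ℝ) = i := by
      rw [h2]; exact_mod_cast (by rw [mul_comm]; exact h1)
    push_cast at h3
    exact h3.symm
  rw [e1.shadow, e2.shadow] at h
  have hlt := Int.emod_lt_of_pos i (by omega : (0 : ℤ) < D.n)
  rw [D.vertex _ (by omega) t' ht' h] at e1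
  exact e1.trans e2.symm

theorem shadow_mem_multiplePoints (h : ¬ D.Cong s t) (hst : D.shadow s = D.shadow t) :
    D.shadow s ∈ D.multiplePoints := mem_multiplePoints_iff.2 ⟨s, t, h, rfl, hst.symm⟩

theorem doublePoints_eq (D : KnotDiagram) (a : ℝ) :
    doublePoints D.n (fun s => D.shadow (a + s)) = D.multiplePoints := by
  ext x
  rw [mem_multiplePoints_iff]
  constructor
  · rintro ⟨s, hs, t, ht, hst, h1, h2⟩
    refine ⟨a + s, a + t, fun h => hst ?_, h1, h2⟩
    have := h.eq_of_mem (a := a) ⟨by linarith [hs.1], by linarith [hs.2]⟩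
      ⟨by linarith [ht.1], by linarith [ht.2]⟩
    linarith
  · rintro ⟨s, t, hst, h1, h2⟩
    obtain ⟨s', hs', e1⟩ := D.exists_cong s a
    obtain ⟨t', ht', e2⟩ := D.exists_cong t a
    refine ⟨s' - a, ⟨by linarith [hs'.1], by linarith [hs'.2]⟩, t' - a,
      ⟨by linarith [ht'.1], by linarith [ht'.2]⟩, fun h => hst ?_, ?_, ?_⟩
    · have : s' = t' := by linarith
      subst this
      exact e1.trans e2.symm
    · simp only [add_sub_cancel]; rw [← e1.shadow, h1]
    · simp only [add_sub_cancel]; rw [← e2.shadow, h2]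

/-- A diagram, read from a point that is not a crossing, is a regular closed curve. -/
theorem isRegularCurve (D : KnotDiagram) {a : ℝ} (ha : D.IsPlain a) :
    IsRegularCurve D.n (fun s => D.shadow (a + s)) (fun s => D.height (a + s))
      (insert 0 {x | x ∈ Set.Icc (0 : ℝ) D.n ∧ ∃ i : ℤ, a + x = i}) ∅ where
  pos := D.n_pos
  cont_sh := D.continuous_shadow.comp (by fun_prop)
  cont_h := D.continuous_height.comp (by fun_prop)
  closed_sh := congrArg Prod.fst (by simpa using D.curve_add_period a)
  closed_h := congrArg Prod.snd (by simpa using D.curve_add_period a)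
  finite_B := by
    refine Set.Finite.insert _ (((Set.finite_Icc ⌊a⌋ ⌈a + D.n⌉).image fun i : ℤ =>
      (i : ℝ) - a).subset ?_)
    rintro x ⟨hx, i, hi⟩
    refine ⟨i, ⟨?_, ?_⟩, by dsimp only; linarith⟩
    · exact Int.floor_le_iff.2 (by linarith [hx.1])
    · exact Int.le_ceil_iff.2 (by linarith [hx.2])
  zero_mem := Set.mem_insert _ _
  pl := by
    intro c d hc hcd hd hx s hs
    have h1 := D.plOn_curve (a := a) (b := a + D.n) (a + c) (a + d) (by linarith) (by linarith)
      (by linarith) (by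
        rintro _ ⟨i, rfl⟩ hlt
        exact hx (i - a) (Or.inr ⟨⟨by linarith [hlt.1], by linarith [hlt.2]⟩, i, by ring⟩)
          ⟨by linarith [hlt.1], by linarith [hlt.2]⟩) (a + s)
      ⟨by linarith [hs.1], by linarith [hs.2]⟩
    have h2 := congrArg Prod.fst h1
    rw [AffineMap.lineMap_apply_module'] at h2
    simp only [Prod.fst_add, Prod.smul_fst, Prod.fst_sub, add_sub_add_left_eq_sub] at h2
    rw [AffineMap.lineMap_apply_module']
    exact h2
  inj := by
    intro s hs t ht h1 h2
    have := (cong_of_shadow_of_height h1 h2).eq_of_mem (a := a)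
      ⟨by linarith [hs.1], by linarith [hs.2]⟩ ⟨by linarith [ht.1], by linarith [ht.2]⟩
    linarith
  finite := by rw [doublePoints_eq]; exact D.finite_multiplePoints
  double := by
    have key : ∀ s ∈ Set.Ico (0 : ℝ) D.n, ∀ t ∈ Set.Ico (0 : ℝ) D.n, D.Cong (a + s) (a + t) →
        s = t := fun s hs t ht h => by
      have := h.eq_of_mem (a := a)
        ⟨by linarith [hs.1], by linarith [hs.2]⟩ ⟨by linarith [ht.1], by linarith [ht.2]⟩
      linarith
    intro s hs t ht u hu h1 h2
    rcases cong_of_double h1 h2 with h | h | h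
    · exact Or.inl (key _ hs _ ht h)
    · exact Or.inr (Or.inl (key _ ht _ hu h))
    · exact Or.inr (Or.inr (key _ hs _ hu h))
  vertex := by
    intro b hb hbT t ht h
    left
    have : D.Cong (a + t) (a + b) := by
      -- The starting point counts as a breakpoint without being a vertex; it is harmless because
      -- `a` is plain.
      rcases hb with rfl | ⟨-, i, hi⟩
      · simp only [add_zero] at h ⊢
        exact ha.cong h
      · simp only [hi] at h ⊢
        exact cong_vertex i h
    have := this.eq_of_mem (a := a)
      ⟨by linarith [ht.1], by linarith [ht.2]⟩ ⟨by linarith [hbT.1], by linarith [hbT.2]⟩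
    linarith

/-- A diagram that can be deformed to a regular curve with fewer crossings is isotopic to a diagram
with fewer crossings. -/
theorem exists_fewer_of_isRegularCurve {a : ℝ} {F : Space ≃ₜ Space} (hF : IsotopicToId F)
    {sh : ℝ → Plane} {h : ℝ → ℝ} {B : Set ℝ} (hC : IsRegularCurve D.n sh h B ∅)
    (hFc : ∀ s ∈ Set.Icc (0 : ℝ) D.n, F (D.curve (a + s)) = (sh s, h s))
    (hlt : doublePoints D.n sh ⊂ D.multiplePoints) :
    ∃ D' : KnotDiagram, D.Isotopic D'.toPolygonalKnot ∧ D'.c < D.c := by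
  obtain ⟨D', G, ψ, hG, hψ0, hψ, hcurve, hmp⟩ := hC.exists_diagram
  refine ⟨D', isotopic_of_curve (hF.trans hG) (a := a) hψ fun r hr => ?_, ?_⟩
  · have hψn : ψ D'.n = D.n := by have := hψ 0; rwa [zero_add, hψ0, zero_add] at this
    have h1 : ψ r ∈ Set.Icc (0 : ℝ) D.n := by
      rw [← hψ0, ← hψn]
      exact ⟨ψ.monotone hr.1, ψ.monotone hr.2⟩
    rw [← hcurve r hr, ← hFc _ h1]
    rfl
  · rw [c, c, hmp]
    exact Set.ncard_lt_ncard hlt D.finite_multiplePoints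

theorem height_le_of_not_under (h : ¬ D.IsUndercrossing s) (hst : D.shadow t = D.shadow s) :
    D.height t ≤ D.height s := not_lt.1 fun h' => h ⟨t, hst, h'⟩

theorem le_height_of_not_over (h : ¬ D.IsOvercrossing s) (hst : D.shadow t = D.shadow s) :
    D.height s ≤ D.height t := not_lt.1 fun h' => h ⟨t, hst, h'⟩

theorem IsPlain.not_mem (hs : D.IsPlain s) : D.shadow s ∉ D.multiplePoints := by
  rw [mem_multiplePoints_iff]
  rintro ⟨t, u, htu, h1, h2⟩
  exact htu ((hs.cong h1).trans (hs.cong h2).symm)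

/-- If an arc without undercrossings and an arc without overcrossings have the same end points in
the projection, then the diagram has too many crossings. -/
theorem exists_fewer_of_bigon {p α β ν μ : ℝ} (hp : D.IsPlain p) (hα : p < α) (hαβ : α < β)
    (hβν : β ≤ ν) (hνμ : ν < μ) (hμ : μ < p + D.n)
    (hends : (β < ν ∧ D.shadow α = D.shadow ν ∧ D.shadow β = D.shadow μ) ∨
      (D.shadow α = D.shadow μ ∧ D.shadow β = D.shadow ν))
    (hx : β < ν ∨ D.IsPlain β)
    (hpass : ((∀ s ∈ Set.Icc α β, ¬ D.IsUndercrossing s) ∧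
        ∀ s ∈ Set.Icc ν μ, ¬ D.IsOvercrossing s) ∨
      ((∀ s ∈ Set.Icc α β, ¬ D.IsOvercrossing s) ∧
        ∀ s ∈ Set.Icc ν μ, ¬ D.IsUndercrossing s)) :
    ∃ D' : KnotDiagram, D.Isotopic D'.toPolygonalKnot ∧ D'.c < D.c := by
  have hC := D.isRegularCurve hp
  have hba : 0 < (β - p) - (α - p) := by linarith
  have hba' : (β - p) - (α - p) ≠ 0 := hba.ne'
  -- The affine map between the arcs: increasing if their end points match in order, decreasing if
  -- they match in reverse order.
  obtain ⟨u, w, hS, h1, h2⟩ : ∃ u w,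
      IsSwap (D.n : ℝ) (α - p) (β - p) (ν - p) (μ - p) u w ∧
      D.shadow (p + (u + w * (α - p))) = D.shadow (p + (α - p)) ∧
      D.shadow (p + (u + w * (β - p))) = D.shadow (p + (β - p)) := by
    rcases hends with ⟨hlt, h1, h2⟩ | ⟨h1, h2⟩
    · obtain ⟨w, hw⟩ : ∃ w, w = (μ - ν) / ((β - p) - (α - p)) := ⟨_, rfl⟩
      have hw0 : 0 < w := by rw [hw]; exact div_pos (by linarith) hba
      have e1 : (ν - p) - w * (α - p) + w * (α - p) = ν - p := by ring
      have e2 : (ν - p) - w * (α - p) + w * (β - p) = μ - p := by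
        rw [hw]; field_simp; ring
      refine ⟨(ν - p) - w * (α - p), w, ⟨by linarith, by linarith, by linarith, by linarith,
        by linarith, Or.inl ⟨hw0, by linarith, e1, e2⟩⟩, ?_, ?_⟩
      · rw [e1, add_sub_cancel, add_sub_cancel, h1]
      · rw [e2, add_sub_cancel, add_sub_cancel, h2]
    · obtain ⟨w, hw⟩ : ∃ w, w = (ν - μ) / ((β - p) - (α - p)) := ⟨_, rfl⟩
      have hw0 : w < 0 := by rw [hw]; exact div_neg_of_neg_of_pos (by linarith) hba
      have e1 : (μ - p) - w * (α - p) + w * (α - p) = μ - p := by ring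
      have e2 : (μ - p) - w * (α - p) + w * (β - p) = ν - p := by
        rw [hw]; field_simp; ring
      refine ⟨(μ - p) - w * (α - p), w, ⟨by linarith, by linarith, by linarith, by linarith,
        by linarith, Or.inr ⟨hw0, e1, e2⟩⟩, ?_, ?_⟩
      · rw [e1, add_sub_cancel, add_sub_cancel, h1]
      · rw [e2, add_sub_cancel, add_sub_cancel, h2]
  have hx' : β - p < ν - p ∨
      D.shadow (p + (β - p)) ∉ doublePoints D.n (fun s => D.shadow (p + s)) := by
    rcases hx with hx | hx
    · exact Or.inl (by linarith)
    · right; rw [doublePoints_eq, add_sub_cancel]; exact hx.not_mem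
  have key : ∃ F sh' h' B', IsotopicToId F ∧
      (∀ s ∈ Set.Icc (0 : ℝ) D.n, F (D.shadow (p + s), D.height (p + s)) = (sh' s, h' s)) ∧
      IsRegularCurve D.n sh' h' B' ∅ ∧ doublePoints D.n sh' ⊂
        doublePoints D.n (fun s => D.shadow (p + s)) := by
    rcases hpass with ⟨ho, hu⟩ | ⟨ho, hu⟩
    · exact hC.simplify hS h1 h2
        (fun s hs t _ hst => height_le_of_not_under
          (ho _ ⟨by linarith [hs.1], by linarith [hs.2]⟩) hst)
        (fun s hs t _ hst => le_height_of_not_over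
          (hu _ ⟨by linarith [hs.1], by linarith [hs.2]⟩) hst) hx'
    · exact hC.simplify_mirror hS h1 h2
        (fun s hs t _ hst => le_height_of_not_over
          (ho _ ⟨by linarith [hs.1], by linarith [hs.2]⟩) hst)
        (fun s hs t _ hst => height_le_of_not_under
          (hu _ ⟨by linarith [hs.1], by linarith [hs.2]⟩) hst) hx'
  obtain ⟨F, sh', h', B', hF, hFc, hC', hlt⟩ := key
  rw [doublePoints_eq] at hlt
  exact exists_fewer_of_isRegularCurve hF hC' hFc hlt

end KnotDiagram


/-! ### Diagrams without crossings -/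

theorem exists_nodes_zero {T : ℝ} {S : Set ℝ} (hS : S.Finite) (hST : S ⊆ Set.Ico 0 T)
    (h0 : (0 : ℝ) ∈ S) : ∃ e : ℤ → ℝ, IsNodes T S.ncard e ∧ e 0 = 0 ∧
      ∀ i : ℤ, ∀ x ∈ S, ¬(e i < x ∧ x < e (i + 1)) := by
  obtain ⟨e, H, heS, hSe⟩ := exists_nodes hS hST ⟨0, h0⟩
  refine ⟨e, H, ?_, ?_⟩
  · obtain ⟨i, hi, -, hi0⟩ := hSe 0 h0
    have h1 : e 0 ≤ e i := H.strictMono.monotone hi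
    exact le_antisymm (hi0 ▸ h1)
      (hST (heS 0 le_rfl (by exact_mod_cast (Set.ncard_pos hS).2 ⟨0, h0⟩))).1
  · rintro i x hx ⟨h1, h2⟩
    obtain ⟨j, -, -, rfl⟩ := hSe x hx
    have := H.strictMono.lt_iff_lt.1 h1
    have := H.strictMono.lt_iff_lt.1 h2
    omega

namespace KnotDiagram

open PolygonalKnot

/-- A diagram without crossings represents the trivial knot. -/
theorem exists_isotopic_triangle {D : KnotDiagram} (hc : D.c = 0) :
    ∃ Q : PolygonalKnot, Q.n = 3 ∧ D.Isotopic Q := by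
  have hn3 : (3 : ℝ) ≤ D.n := by exact_mod_cast D.three_le
  have hnpos := D.n_pos
  have hcong : ∀ s t, D.shadow s = D.shadow t → D.Cong s t := by
    intro s t hst
    by_contra h
    have h1 := shadow_mem_multiplePoints h hst
    rw [c, Set.ncard_eq_zero D.finite_multiplePoints] at hc
    rw [hc] at h1
    exact h1
  -- No point of the curve lies above another, so all heights can be brought to `0`.
  obtain ⟨F₁, hF₁, hF₁c⟩ := exists_vertical_isotopy (S := Set.Icc (0 : ℝ) D.n)
    (fun s => D.shadow s) (fun s => D.height s) (fun _ => 0)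
    (D.continuous_shadow.comp continuous_subtype_val)
    (D.continuous_height.comp continuous_subtype_val) continuous_const one_pos
    (fun s t hst _ => by simp [(hcong s t hst).height])
  -- The last edge is kept fixed while the rest becomes two edges over an apex.
  obtain ⟨R, hR⟩ : ∃ R : Set Space,
    R = (fun s => ((D.shadow s, 0) : Space)) '' Set.Icc ((D.n : ℝ) - 1) D.n := ⟨_, rfl⟩
  have hpl : ∀ a b : ℝ, 0 ≤ a → b ≤ D.n →
      PLOn D.shadow {x | x ∈ Set.Icc (0 : ℝ) D.n ∧ ∃ i : ℤ, x = i} a b := by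
    intro a b ha hb c d hc hcd hd hx s hs
    have h1 := D.plOn_curve (a := a) (b := b) c d hc hcd hd (by
      rintro x hi hlt
      exact hx x ⟨⟨by linarith [hlt.1], by linarith [hlt.2]⟩, hi⟩ hlt) s hs
    have h2 := congrArg Prod.fst h1
    rw [AffineMap.lineMap_apply_module'] at h2
    rw [AffineMap.lineMap_apply_module']
    exact h2
  have hfin : {x : ℝ | x ∈ Set.Icc (0 : ℝ) D.n ∧ ∃ i : ℤ, x = i}.Finite := by
    refine ((Set.finite_Icc (0 : ℤ) D.n).image fun i : ℤ => (i : ℝ)).subset ?_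
    rintro _ ⟨hx, i, rfl⟩
    exact ⟨i, ⟨by exact_mod_cast hx.1, by exact_mod_cast hx.2⟩, rfl⟩
  obtain ⟨m₀, hm₀, hm₀n, hcone⟩ := exists_cone_isotopy D.continuous_shadow
    (by linarith : (0 : ℝ) < D.n - 1) hfin (hpl 0 (D.n - 1) le_rfl (by linarith))
    (fun s hs t ht hst => (hcong s t hst).eq (by linarith [hs.2, ht.1]) (by linarith [hs.1, ht.2]))
    (R := R) (by
      rw [hR]
      exact (isCompact_Icc.image (D.continuous_shadow.prodMk continuous_const)).isClosed)
    (by rw [hR]; rintro _ ⟨s, -, rfl⟩; exact le_rfl)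
    (by
      rw [hR]
      rintro s hs ⟨t, ht, hts⟩
      have h1 := hcong t s (Prod.ext_iff.1 hts).1
      by_cases h2 : s = 0
      · exact Or.inl h2
      · right
        have h3 : 0 < s := lt_of_le_of_ne hs.1 (Ne.symm h2)
        have h4 := h1.eq (by linarith [ht.2]) (by linarith [ht.1, hs.2])
        exact le_antisymm hs.2 (h4 ▸ ht.1)) 0
  obtain ⟨m, hm0, hmm⟩ := exists_between hm₀
  obtain ⟨F₂, hF₂, hF₂R, hF₂a, hF₂b⟩ := hcone m hm0 hmm
  obtain ⟨g, hg⟩ : ∃ g : ℝ → Space, g = fun s => F₂ (D.shadow s, 0) := ⟨_, rfl⟩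
  have hgR : ∀ s ∈ Set.Icc ((D.n : ℝ) - 1) D.n, g s = (D.shadow s, 0) := by
    intro s hs
    rw [hg]
    exact hF₂R _ (hR ▸ ⟨s, hs, rfl⟩)
  -- Three straight pieces remain, with vertices at `0`, `m` and `n - 1`.
  have hgpl : PLOn g {m, (D.n : ℝ) - 1} 0 D.n := by
    intro c d hc hcd hd hx s hs
    have hxm := hx m (by simp)
    have hxn := hx (D.n - 1) (by simp)
    by_cases h1 : d ≤ m
    · have := (PLOn.id_affine ((D.shadow 0, 0) : Space) (0, 1) 0 m 0 (m - 0)).congr (g := g)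
        (fun s hs => by rw [hg]; exact hF₂a s hs)
      exact this c d hc hcd h1 (fun x hx => absurd hx (Set.notMem_empty x)) s hs
    have h2 : m ≤ c := not_lt.1 fun h => hxm ⟨h, not_le.1 h1⟩
    by_cases h3 : d ≤ D.n - 1
    · have := (PLOn.id_affine ((0, 1) : Space) (D.shadow (D.n - 1), 0) m (D.n - 1) m
        (D.n - 1 - m)).congr (g := g) (fun s hs => by rw [hg]; exact hF₂b s hs)
      exact this c d h2 hcd h3 (fun x hx => absurd hx (Set.notMem_empty x)) s hs
    have h4 : (D.n : ℝ) - 1 ≤ c := not_lt.1 fun h => hxn ⟨h, not_le.1 h3⟩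
    have h5 := hpl (D.n - 1) D.n (by linarith) le_rfl c d h4 hcd hd (by
      rintro _ ⟨-, i, rfl⟩ hlt
      have e1 : (D.n : ℝ) - 1 < i := h4.trans_lt hlt.1
      have e2 : (i : ℝ) < D.n := hlt.2.trans_le hd
      have e3 : (D.n : ℤ) - 1 < i := by exact_mod_cast e1
      have e4 : i < (D.n : ℤ) := by exact_mod_cast e2
      omega) s hs
    rw [hgR s ⟨h4.trans hs.1, hs.2.trans hd⟩, hgR c ⟨h4, hcd.le.trans hd⟩,
      hgR d ⟨h4.trans hcd.le, hd⟩, h5]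
    ext1
    · simp [AffineMap.lineMap_apply_module']
    · simp [AffineMap.lineMap_apply_module']
  obtain ⟨S, hS⟩ : ∃ S : Set ℝ, S = {0, m, (D.n : ℝ) - 1} := ⟨_, rfl⟩
  have hcard : S.ncard = 3 := by
    rw [hS, Set.ncard_eq_three]
    exact ⟨0, m, D.n - 1, hm0.ne, by linarith, by linarith, rfl⟩
  have hSf : S.Finite := by rw [hS]; exact Set.toFinite _
  have hST : S ⊆ Set.Ico (0 : ℝ) D.n := by
    rw [hS]
    rintro x (rfl | rfl | rfl)
    · exact ⟨le_rfl, hnpos⟩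
    · exact ⟨hm0.le, by linarith⟩
    · exact ⟨by linarith, by linarith⟩
  obtain ⟨e, H, he0, hno⟩ := exists_nodes_zero hSf hST (by rw [hS]; simp)
  rw [hcard] at H
  have he3 := H.apply_eq he0
  obtain ⟨Q, hQn, hQ⟩ := exists_polygonalKnot hnpos le_rfl H he0 g (by
      rw [hg]; dsimp only
      rw [Cong.shadow (P := D.toPolygonalKnot) (s := D.n) (t := 0) ⟨1, by simp⟩]) (by
      intro i hi hi3 r hr
      have h1 := hgpl.affine_comb (r := r) (he0 ▸ H.strictMono.monotone hi)
        (H.strictMono (lt_add_one i)) (he3 ▸ H.strictMono.monotone (by omega))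
        (fun x hx => hno i x (by rw [hS]; exact Or.inr hx)) hr.1 hr.2
      rw [h1, AffineMap.lineMap_apply_module', add_comm]) (by
      intro s hs t ht hst
      rw [hg] at hst
      have h1 := F₂.injective hst
      exact (hcong s t (Prod.ext_iff.1 h1).1).eq_of_mem (a := 0) (by simpa using hs)
        (by simpa using ht))
  refine ⟨Q, hQn, isotopic_of_curve (hF₁.trans hF₂) (a := 0) (ψ := H.param hnpos) ?_ ?_⟩
  · intro r
    rw [hQn]
    exact H.param_add_period hnpos r
  · intro r hr
    rw [hQn] at hr
    rw [hQ r hr, zero_add, Homeomorph.trans_apply, hg]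
    exact congrArg F₂ (hF₁c ⟨_, (H.param_mem_Icc hnpos he0).2 hr⟩)

end KnotDiagram


/-! ### Decomposition into overpasses and underpasses -/

namespace IsNodes

variable {T : ℝ} {k : ℕ} {e : ℤ → ℝ} (H : IsNodes T k e) (hT : 0 < T)

include H hT in
theorem exists_between (y : ℝ) : ∃ i, e i ≤ y ∧ y < e (i + 1) := by
  obtain ⟨i₀, hi₀⟩ := H.exists_le hT y
  obtain ⟨i₁, hi₁⟩ := H.exists_gt hT y
  obtain ⟨i, hi, him⟩ := Int.exists_greatest_of_bdd (P := fun i => e i ≤ y)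
    ⟨i₁, fun z hz => (H.strictMono.lt_iff_lt.1 (hz.trans_lt hi₁)).le⟩ ⟨i₀, hi₀⟩
  refine ⟨i, hi, ?_⟩
  by_contra hc
  have := him _ (not_lt.1 hc)
  omega

end IsNodes

open PolygonalKnot

namespace KnotDiagram

variable {D : KnotDiagram} {s t u : ℝ}

theorem IsOvercrossing.congr (h : D.IsOvercrossing s) (hst : D.Cong s t) : D.IsOvercrossing t := by
  obtain ⟨x, h1, h2⟩ := h
  exact ⟨x, h1.trans hst.shadow, hst.height ▸ h2⟩

theorem IsUndercrossing.congr (h : D.IsUndercrossing s) (hst : D.Cong s t) :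
    D.IsUndercrossing t := by
  obtain ⟨x, h1, h2⟩ := h
  exact ⟨x, h1.trans hst.shadow, hst.height ▸ h2⟩

theorem IsPlain.congr (h : D.IsPlain s) (hst : D.Cong s t) : D.IsPlain t :=
  ⟨fun h' => h.1 (h'.congr hst.symm), fun h' => h.2 (h'.congr hst.symm)⟩

theorem cong_add_n (D : KnotDiagram) (s : ℝ) : D.Cong (s + D.n) s := ⟨1, by simp⟩

theorem IsOvercrossing.not_under (h : D.IsOvercrossing s) : ¬ D.IsUndercrossing s := by
  rintro ⟨u, h1, h2⟩
  obtain ⟨t, h3, h4⟩ := h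
  rcases cong_of_double h3 h1.symm with h | h | h
  · exact h4.ne h.height
  · exact h2.ne h.height
  · exact (h4.trans h2).ne h.height

/-- As there are no triple points, two incongruent overcrossings would each be the lower strand
under the other. -/
theorem IsOvercrossing.cong (h : D.IsOvercrossing s) (h' : D.IsOvercrossing t)
    (hst : D.shadow s = D.shadow t) : D.Cong s t := by
  obtain ⟨x, h1, h2⟩ := h
  obtain ⟨y, h3, h4⟩ := h'
  rcases cong_of_double h1 hst with h | h | h
  · exact absurd h.height h2.ne
  · exact h
  · rcases cong_of_double h3 hst.symm with h5 | h5 | h5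
    · exact absurd h5.height h4.ne
    · exact h5.symm
    · have := h.height
      have := h5.height
      linarith

theorem not_isPlain_iff : ¬ D.IsPlain s ↔ D.shadow s ∈ D.multiplePoints := by
  refine ⟨fun h => ?_, fun h h' => h'.not_mem h⟩
  rw [IsPlain, not_and_or, not_not, not_not] at h
  rcases h with ⟨t, h1, h2⟩ | ⟨t, h1, h2⟩
  · exact shadow_mem_multiplePoints (t := t) (fun h => h2.ne' h.height) h1.symm
  · exact shadow_mem_multiplePoints (t := t) (fun h => h2.ne h.height) h1.symm

theorem finite_cong (D : KnotDiagram) (p a b : ℝ) : {s | s ∈ Set.Icc a b ∧ D.Cong s p}.Finite := by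
  have hn := D.n_pos
  refine ((Set.finite_Icc ⌊(a - p) / D.n⌋ ⌈(b - p) / D.n⌉).image
    fun m : ℤ => p + m * (D.n : ℝ)).subset ?_
  rintro _ ⟨hs, m, rfl⟩
  refine ⟨m, ⟨?_, ?_⟩, rfl⟩
  · exact Int.floor_le_iff.2 (by
      have : (a - p) / D.n ≤ m := by rw [div_le_iff₀ hn]; linarith [hs.1]
      linarith)
  · exact Int.le_ceil_iff.2 (by
      have : (m : ℝ) ≤ (b - p) / D.n := by rw [le_div_iff₀ hn]; linarith [hs.2]
      linarith)

theorem finite_crossings (D : KnotDiagram) (a b : ℝ) :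
    {s | s ∈ Set.Icc a b ∧ ¬ D.IsPlain s}.Finite := by
  have h1 : {s | s ∈ Set.Icc a b ∧ ¬ D.IsPlain s} ⊆
      ⋃ x ∈ D.multiplePoints, {s | s ∈ Set.Icc a b ∧ D.shadow s = x} := by
    rintro s ⟨hs, hp⟩
    simp only [Set.mem_iUnion]
    exact ⟨_, not_isPlain_iff.1 hp, hs, rfl⟩
  refine (D.finite_multiplePoints.biUnion fun x hx => ?_).subset h1
  obtain ⟨p, q, hpq, hp, hq⟩ := mem_multiplePoints_iff.1 hx
  refine ((D.finite_cong p a b).union (D.finite_cong q a b)).subset ?_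
  rintro s ⟨hs, hsx⟩
  rcases cong_of_double (hsx.trans hp.symm) (hp.trans hq.symm) with h | h | h
  · exact Or.inl ⟨hs, h⟩
  · exact absurd h hpq
  · exact Or.inr ⟨hs, h⟩

/-- The crossings of a diagram keep a distance from each other. -/
theorem exists_gap (D : KnotDiagram) : ∃ ε, 0 < ε ∧
    ∀ s t, ¬ D.IsPlain s → ¬ D.IsPlain t → s < t → ε ≤ t - s := by
  have hn := D.n_pos
  -- Two crossings less than a turn apart can be shifted together into a window of two turns.
  have hfin := D.finite_crossings 0 (2 * D.n)
  obtain ⟨ε, hε, h⟩ := exists_pos_lower_bound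
    (S := {p : ℝ × ℝ | p ∈ {s | s ∈ Set.Icc 0 (2 * (D.n : ℝ)) ∧ ¬ D.IsPlain s} ×ˢ
      {s | s ∈ Set.Icc 0 (2 * (D.n : ℝ)) ∧ ¬ D.IsPlain s} ∧ p.1 < p.2})
    ((hfin.prod hfin).subset fun p hp => hp.1) (fun p => p.2 - p.1)
    (fun p hp => sub_pos.2 hp.2)
  refine ⟨min ε D.n, lt_min hε hn, fun s t hs ht hst => ?_⟩
  by_cases hlt : t - s < D.n
  · obtain ⟨s', hs', m, hm⟩ := D.exists_cong' s
    have h1 : D.Cong t (t - s + s') := ⟨m, by linarith⟩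
    have h2 : D.Cong s s' := ⟨m, hm⟩
    have := h (s', t - s + s') ⟨⟨⟨⟨hs'.1, by linarith [hs'.2]⟩, fun h => hs (h.congr h2.symm)⟩,
      ⟨⟨by linarith [hs'.1], by linarith [hs'.2]⟩, fun h => ht (h.congr h1.symm)⟩⟩,
      by dsimp only; linarith⟩
    dsimp only at this
    exact (min_le_left _ _).trans (by linarith)
  · exact (min_le_right _ _).trans (not_lt.1 hlt)

/-- The first crossing of a kind after a given point. -/
theorem exists_next {p : ℝ → Prop} (hp : ∀ s, p s → ¬ D.IsPlain s)
    (hper : ∀ s t, D.Cong s t → p s → p t) (hne : ∃ s, p s) (a : ℝ) :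
    ∃ v, IsLeast {s | a < s ∧ p s} v := by
  obtain ⟨s, hs⟩ := hne
  obtain ⟨t, ht, hst⟩ := D.exists_cong s (a + 1)
  obtain ⟨v, hv, hmin⟩ := Set.exists_min_image {s | s ∈ Set.Icc a t ∧ (a < s ∧ p s)} id
    ((D.finite_crossings a t).subset fun s hs => ⟨hs.1, hp s hs.2.2⟩)
    ⟨t, ⟨⟨by linarith [ht.1], le_rfl⟩, by linarith [ht.1], hper _ _ hst hs⟩⟩
  refine ⟨v, hv.2, fun x hx => ?_⟩
  rcases le_total x t with h | h
  · exact hmin x ⟨⟨hx.1.le, h⟩, hx⟩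
  · exact hv.1.2.trans h

/-- An overcrossing that follows an undercrossing. -/
def IsStart (D : KnotDiagram) (s : ℝ) : Prop :=
  D.IsOvercrossing s ∧ ∃ u < s, D.IsUndercrossing u ∧ ∀ t ∈ Set.Ioo u s, D.IsPlain t

theorem IsStart.congr (h : D.IsStart s) (hst : D.Cong s t) : D.IsStart t := by
  obtain ⟨ho, u, hu, hund, hpl⟩ := h
  obtain ⟨m, rfl⟩ := hst
  refine ⟨ho.congr ⟨m, rfl⟩, u - m * D.n, by linarith, hund.congr ⟨m, by ring⟩, fun x hx => ?_⟩
  exact (hpl (x + m * D.n) ⟨by linarith [hx.1], by linarith [hx.2]⟩).congr ⟨m, rfl⟩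

theorem IsStart.not_isPlain (h : D.IsStart s) : ¬ D.IsPlain s := fun h' => h'.1 h.1

/-- The last crossing before the first overcrossing after `u` is not an overcrossing, or is `u`
itself; so it is an undercrossing. -/
theorem exists_start_after (hne : ∃ s, D.IsOvercrossing s) (hu : D.IsUndercrossing u) :
    ∃ v, D.IsStart v ∧ IsLeast {s | u < s ∧ D.IsOvercrossing s} v := by
  obtain ⟨v, hv⟩ := exists_next (D := D) (p := D.IsOvercrossing) (fun s h h' => h'.1 h)
    (fun s t h h' => h'.congr h) hne u
  refine ⟨v, ⟨hv.1.2, ?_⟩, hv⟩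
  obtain ⟨w, hw, hmax⟩ := Set.exists_max_image
    {s | s ∈ Set.Icc u v ∧ (s < v ∧ ¬ D.IsPlain s)} id
    ((D.finite_crossings u v).subset fun s hs => ⟨hs.1, hs.2.2⟩)
    ⟨u, ⟨le_rfl, hv.1.1.le⟩, hv.1.1, fun h => h.2 hu⟩
  refine ⟨w, hw.2.1, ?_, fun t ht => ?_⟩
  · rcases eq_or_lt_of_le hw.1.1 with h | h
    · exact h ▸ hu
    · by_contra hund
      exact hw.2.2 ⟨fun ho => absurd (hv.2 ⟨h, ho⟩) (not_le.2 hw.2.1), hund⟩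
  · by_contra hpl
    exact absurd (hmax t ⟨⟨hw.1.1.trans ht.1.le, ht.2.le⟩, ht.2, hpl⟩) (not_le.2 ht.1)

theorem exists_over_and_under (hc : D.c ≠ 0) :
    (∃ s, D.IsOvercrossing s) ∧ ∃ s, D.IsUndercrossing s := by
  obtain ⟨x, hx⟩ := Set.nonempty_of_ncard_ne_zero hc
  obtain ⟨s, t, hst, h1, h2⟩ := mem_multiplePoints_iff.1 hx
  have h3 : D.shadow s = D.shadow t := h1.trans h2.symm
  rcases lt_trichotomy (D.height s) (D.height t) with h | h | h
  · exact ⟨⟨t, s, h3, h⟩, ⟨s, t, h3.symm, h⟩⟩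
  · exact absurd (cong_of_shadow_of_height h3 h) hst
  · exact ⟨⟨s, t, h3.symm, h⟩, ⟨t, s, h3, h⟩⟩

/-- A diagram with crossings decomposes into overpasses and underpasses. -/
theorem exists_isOverUnderpassSequence (hc : D.c ≠ 0) :
    ∃ k, 1 ≤ k ∧ ∃ s f : ℤ → ℝ, D.IsOverUnderpassSequence k s f := by
  obtain ⟨hover, hunder⟩ := exists_over_and_under hc
  have hn := D.n_pos
  obtain ⟨ε, hε, hgap⟩ := D.exists_gap
  -- The overpasses are determined by their first overcrossings; there is one overpass for each
  -- start in a turn.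
  obtain ⟨S, hS⟩ : ∃ S, S = {s | s ∈ Set.Ico (0 : ℝ) D.n ∧ D.IsStart s} := ⟨_, rfl⟩
  have hSf : S.Finite := (D.finite_crossings 0 D.n).subset (by
    rw [hS]; exact fun s hs => ⟨⟨hs.1.1, hs.1.2.le⟩, hs.2.not_isPlain⟩)
  have hSne : S.Nonempty := by
    obtain ⟨u, hu⟩ := hunder
    obtain ⟨v, hv, -⟩ := exists_start_after hover hu
    obtain ⟨v', hv', h⟩ := D.exists_cong' v
    exact ⟨v', by rw [hS]; exact ⟨hv', hv.congr h⟩⟩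
  obtain ⟨y, H, hyS, hSy⟩ := exists_nodes hSf (by rw [hS]; exact fun s hs => hs.1) hSne
  have hkpos := (Set.ncard_pos hSf).2 hSne
  generalize S.ncard = k at H hyS hSy hkpos
  have hy : ∀ i, D.IsStart (y i) := by
    intro i
    have hk0 : (0 : ℤ) < k := by exact_mod_cast hkpos
    have h1 := H.add_mul_period (i % k) (i / k)
    have h2 : i % k + i / k * k = i := by rw [mul_comm]; exact Int.emod_add_mul_ediv i k
    rw [h2] at h1
    have h3 := hyS (i % k) (Int.emod_nonneg _ hk0.ne') (Int.emod_lt_of_pos _ hk0)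
    rw [hS] at h3
    exact h3.2.congr (Cong.symm ⟨i / k, h1⟩)
  have hally : ∀ t, D.IsStart t → ∃ i, y i = t := by
    intro t ht
    obtain ⟨t', ht', m, hm⟩ := D.exists_cong' t
    obtain ⟨i, -, -, hi⟩ := hSy t' (by rw [hS]; exact ⟨ht', ht.congr ⟨m, hm⟩⟩)
    exact ⟨i + m * k, by rw [H.add_mul_period, hi, hm]⟩
  have hnext : ∀ i, ∃ v, IsLeast {s | y i < s ∧ D.IsUndercrossing s} v := fun i =>
    exists_next (fun s h h' => h'.2 h) (fun s t h h' => h'.congr h) hunder (y i)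
  choose v hv using hnext
  have hvper : ∀ i, v (i + k) = v i + D.n := by
    intro i
    refine (hv (i + k)).unique ⟨⟨?_, ?_⟩, fun x hx => ?_⟩
    · rw [H.add_period]; linarith [(hv i).1.1]
    · exact (hv i).1.2.congr (D.cong_add_n _).symm
    · have h1 := hx.1
      rw [H.add_period] at h1
      have : v i ≤ x - D.n := (hv i).2 ⟨by linarith, hx.2.congr ⟨1, by simp⟩⟩
      linarith
  -- The undercrossing just before `y (i + 1)` comes after `y i`, since `y i` is itself a crossing
  -- and cannot lie strictly between the two.
  have hvy : ∀ i, v i < y (i + 1) := by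
    intro i
    obtain ⟨ho, u, hu, hund, hpl⟩ := hy (i + 1)
    have hlt := H.strictMono (lt_add_one i)
    have h1 : y i < u := by
      rcases lt_trichotomy u (y i) with h | h | h
      · exact absurd (hpl (y i) ⟨h, hlt⟩) (hy i).not_isPlain
      · exact absurd (h ▸ hund) (hy i).1.not_under
      · exact h
    exact ((hv i).2 ⟨h1, hund⟩).trans_lt hu
  have hclose : ∀ s t, ¬ D.IsPlain s → s - ε < t → t < s + ε → ¬ D.IsPlain t → t = s := by
    intro s t hs h1 h2 ht
    rcases lt_trichotomy s t with h | h | h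
    · linarith [hgap s t hs ht h]
    · exact h.symm
    · linarith [hgap t s ht hs h]
  have hypl : ∀ i, ¬ D.IsPlain (y i) := fun i => (hy i).not_isPlain
  have hvpl : ∀ i, ¬ D.IsPlain (v i) := fun i h => h.2 (hv i).1.2
  have hplain : ∀ s, ¬ D.IsPlain s → D.IsPlain (s - ε / 2) := by
    intro s hs
    by_contra h
    linarith [hclose s _ hs (by linarith) (by linarith) h]
  -- Half the gap before the first overcrossing, and half the gap before the first undercrossing
  -- after it: plain points with no crossing between them and the next start or undercrossing.
  refine ⟨k, hkpos, fun i => y i - ε / 2, fun i => v i - ε / 2, ?_, ?_, ?_, ?_, ?_, ?_, ?_, ?_⟩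
  · intro i; simp only [H.add_period]; ring
  · intro i; simp only [hvper]; ring
  · intro i; linarith [(hv i).1.1]
  · intro i; linarith [hvy i]
  · exact fun i => hplain _ (hypl i)
  · exact fun i => hplain _ (hvpl i)
  · refine fun i => ⟨⟨y i, ⟨by linarith, ?_⟩, (hy i).1⟩, fun x hx hxu => ?_⟩
    · linarith [hgap _ _ (hypl i) (hvpl i) (hv i).1.1]
    · have hxp : ¬ D.IsPlain x := fun h => h.2 hxu
      rcases le_or_gt x (y i) with h | h
      · have := hclose (y i) x (hypl i) (by linarith [hx.1]) (by linarith) hxp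
        exact (hy i).1.not_under (this ▸ hxu)
      · linarith [(hv i).2 ⟨h, hxu⟩, hx.2]
  · refine fun i => ⟨⟨v i, ⟨by linarith, ?_⟩, (hv i).1.2⟩, fun x hx hxo => ?_⟩
    · linarith [hgap _ _ (hvpl i) (hypl (i + 1)) (hvy i)]
    · have hxp : ¬ D.IsPlain x := fun h => h.1 hxo
      rcases le_or_gt x (v i) with h | h
      · have := hclose (v i) x (hvpl i) (by linarith [hx.1]) (by linarith) hxp
        exact hxo.not_under (this ▸ (hv i).1.2)
      -- An overcrossing between `v i` and the next start would produce a start strictly between `y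
      -- i` and `y (i + 1)`.
      · obtain ⟨w, hw, hwl⟩ := exists_start_after hover (hv i).1.2
        obtain ⟨j, rfl⟩ := hally w hw
        have h1 := hwl.2 ⟨h, hxo⟩
        have h2 : y i < y j := (hv i).1.1.trans hwl.1.1
        have h3 : y j < y (i + 1) := by linarith [hx.2]
        have := H.strictMono.lt_iff_lt.1 h2
        have := H.strictMono.lt_iff_lt.1 h3
        omega

/-! ### Counting crossings by overpasses and underpasses -/

namespace IsOverUnderpassSequence

variable {k : ℕ} {a f : ℤ → ℝ} (H : D.IsOverUnderpassSequence k a f)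

include H

theorem isNodes : IsNodes D.n k a :=
  ⟨strictMono_int_of_lt_succ fun i => (H.s_lt_f i).trans (H.f_lt_s i), H.s_add⟩

theorem isNodes_end : IsNodes D.n k f :=
  ⟨strictMono_int_of_lt_succ fun i => (H.f_lt_s i).trans (H.s_lt_f (i + 1)), H.f_add⟩

/-- One overcrossing is chosen on each overpass of a turn. They are incongruent, and a double point
has only one overcrossing, so they lie over different double points. -/
theorem le_c : k ≤ D.c := by
  choose x hx hxo using fun i => (H.overpass i).1
  have h1 : Set.InjOn (fun i : ℤ => D.shadow (x i)) (Set.Ico (0 : ℤ) k) := by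
    have hmem : ∀ i ∈ Set.Ico (0 : ℤ) k, x i ∈ Set.Ico (a 0) (a 0 + D.n) := by
      intro i hi
      refine ⟨(H.isNodes.strictMono.monotone hi.1).trans (hx i).1, ?_⟩
      have h2 := (hx i).2.trans_lt (H.f_lt_s i)
      have h3 : a (i + 1) ≤ a (0 + k) := H.isNodes.strictMono.monotone (by linarith [hi.2])
      rw [H.s_add] at h3
      linarith
    have hmono : StrictMono x := strictMono_int_of_lt_succ fun i =>
      ((hx i).2.trans_lt (H.f_lt_s i)).trans_le (hx (i + 1)).1
    intro i hi j hj hij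
    exact hmono.injective (((hxo i).cong (hxo j) hij).eq_of_mem (hmem i hi) (hmem j hj))
  have h2 := Set.ncard_le_ncard_of_injOn (t := D.multiplePoints) (s := Set.Ico (0 : ℤ) k) _
    (fun i _ => not_isPlain_iff.1 fun h => h.1 (hxo i)) h1 D.finite_multiplePoints
  rw [KnotDiagram.c]
  simpa [Set.ncard_eq_toFinset_card'] using h2

theorem exists_overpass (hs : D.IsOvercrossing s) : ∃ i, s ∈ Set.Ioo (a i) (f i) := by
  obtain ⟨i, hi1, hi2⟩ := H.isNodes.exists_between D.n_pos s
  refine ⟨i, lt_of_le_of_ne hi1 ?_, not_le.1 fun h => (H.underpass i).2 s ⟨h, hi2.le⟩ hs⟩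
  rintro rfl
  exact (H.s_not i).1 hs

theorem exists_underpass (hs : D.IsUndercrossing s) : ∃ i, s ∈ Set.Ioo (f i) (a (i + 1)) := by
  obtain ⟨i, hi1, hi2⟩ := H.isNodes.exists_between D.n_pos s
  exact ⟨i, not_le.1 fun h => (H.overpass i).2 s ⟨hi1, h⟩ hs, hi2⟩

theorem f_le_of_le {i j : ℤ} (h : i ≤ j) : f i ≤ f j := H.isNodes_end.strictMono.monotone h

theorem s_le_of_le {i j : ℤ} (h : i ≤ j) : a i ≤ a j := H.isNodes.strictMono.monotone h

/-- In a diagram with as few crossings as possible, an overpass and an underpass cross at most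
once, and not at all if they are adjacent. -/
theorem c_le (hk : 1 ≤ k)
    (hmin : ∀ D' : KnotDiagram, D.Isotopic D'.toPolygonalKnot → D.c ≤ D'.c) :
    D.c ≤ k * (k - 2) := by
  have hkpos : (0 : ℤ) < k := by exact_mod_cast hk
  have hmin' : ¬ ∃ D' : KnotDiagram, D.Isotopic D'.toPolygonalKnot ∧ D'.c < D.c := by
    rintro ⟨D', h1, h2⟩
    exact absurd (hmin D' h1) (not_le.2 h2)
  -- The undercrossing is represented in the turn that begins with overpass `i`, so `i ≤ j < i + k`.
  -- Thus `j = i` is the underpass following overpass `i`, and `j = i + k - 1` the one preceding it.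
  have hloc : ∀ x ∈ D.multiplePoints, ∃ i j : ℤ, ∃ p q : ℝ, 0 ≤ i ∧ i < k ∧ i ≤ j ∧ j < i + k ∧
      p ∈ Set.Ioo (a i) (f i) ∧ q ∈ Set.Ioo (f j) (a (j + 1)) ∧ D.shadow p = x ∧
      D.shadow q = x := by
    intro x hx
    obtain ⟨s, t, hst, h1, h2⟩ := mem_multiplePoints_iff.1 hx
    obtain ⟨p, q, hp, hq, hpo, hqu⟩ : ∃ p q, D.shadow p = x ∧ D.shadow q = x ∧
        D.IsOvercrossing p ∧ D.IsUndercrossing q := by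
      rcases lt_trichotomy (D.height s) (D.height t) with h | h | h
      · exact ⟨t, s, h2, h1, ⟨s, h1.trans h2.symm, h⟩, ⟨t, h2.trans h1.symm, h⟩⟩
      · exact absurd (cong_of_shadow_of_height (h1.trans h2.symm) h) hst
      · exact ⟨s, t, h1, h2, ⟨t, h2.trans h1.symm, h⟩, ⟨s, h1.trans h2.symm, h⟩⟩
    obtain ⟨p', hp', e1⟩ := D.exists_cong p (a 0)
    obtain ⟨i, hi⟩ := H.exists_overpass (hpo.congr e1)
    obtain ⟨q', hq', e2⟩ := D.exists_cong q (a i)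
    obtain ⟨j, hj⟩ := H.exists_underpass (hqu.congr e2)
    have hsm := H.isNodes.strictMono
    refine ⟨i, j, p', q', ?_, ?_, ?_, ?_, hi, hj, ?_, ?_⟩
    · have : a 0 < a (i + 1) := hp'.1.trans_lt (hi.2.trans (H.f_lt_s i))
      have := hsm.lt_iff_lt.1 this
      omega
    · have : a i < a (0 + k) := by rw [H.s_add]; exact hi.1.trans hp'.2
      have := hsm.lt_iff_lt.1 this
      omega
    · have : a i < a (j + 1) := hq'.1.trans_lt hj.2
      have := hsm.lt_iff_lt.1 this
      omega
    · have : a j < a (i + k) := by rw [H.s_add]; exact (H.s_lt_f j).trans (hj.1.trans hq'.2)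
      exact hsm.lt_iff_lt.1 this
    · rw [← e1.shadow, hp]
    · rw [← e2.shadow, hq]
  choose! i j p q hi0 hik hij hjk hp hq hpx hqx using hloc
  have hover : ∀ i, ∀ u v, a i < u → v ≤ f i → ∀ s ∈ Set.Icc u v, ¬ D.IsUndercrossing s :=
    fun i u v hu hv s hs => (H.overpass i).2 s ⟨hu.le.trans hs.1, hs.2.trans hv⟩
  have hunder : ∀ i, ∀ u v, f i ≤ u → v ≤ a (i + 1) → ∀ s ∈ Set.Icc u v, ¬ D.IsOvercrossing s :=
    fun i u v hu hv s hs => (H.underpass i).2 s ⟨hu.trans hs.1, hs.2.trans hv⟩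
  -- an overpass does not cross the next underpass
  have hne0 : ∀ x ∈ D.multiplePoints, j x ≠ i x := by
    intro x hx hji
    have h1 := hp x hx
    have h2 := hq x hx
    rw [hji] at h2
    have h3 : a (i x + 1) ≤ a (i x) + D.n := by
      rw [← H.s_add]; exact H.s_le_of_le (by omega)
    -- The degenerate bigon runs from the crossing along the overpass to its end `f i` and along the
    -- underpass back to the crossing.
    exact hmin' (exists_fewer_of_bigon (H.s_not (i x)) h1.1 h1.2 le_rfl h2.1
      (h2.2.trans_le h3) (Or.inr ⟨(hpx x hx).trans (hqx x hx).symm, rfl⟩)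
      (Or.inr (H.f_not (i x))) (Or.inl ⟨hover _ _ _ h1.1 le_rfl, hunder _ _ _ le_rfl h2.2.le⟩))
  -- an overpass does not cross the previous underpass
  have hne1 : ∀ x ∈ D.multiplePoints, j x ≠ i x + k - 1 := by
    intro x hx hji
    have h1 := hp x hx
    have h2 := hq x hx
    have e1 := H.s_add (i x)
    have e2 := H.f_add (i x - 1)
    rw [hji, sub_add_cancel, e1, show i x + (k : ℤ) - 1 = i x - 1 + k by ring, e2] at h2
    have h3 : f (i x) ≤ f (i x - 1) + D.n := by
      rw [← e2]; exact H.f_le_of_le (by omega)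
    -- Shifted back by a turn, the underpass ends where the overpass begins; the bigon is read from
    -- `f (i - 1)`, with the lower arc first.
    have h4 : f (i x - 1) < q x - D.n := by linarith [h2.1]
    have h5 : q x - D.n < a (i x) := by linarith [h2.2]
    have h6 : D.shadow (q x - D.n) = D.shadow (q x) := Cong.shadow ⟨-1, by push_cast; ring⟩
    exact hmin' (exists_fewer_of_bigon (H.f_not (i x - 1)) h4 h5 le_rfl h1.1
      (h1.2.trans_le h3) (Or.inr ⟨h6.trans ((hqx x hx).trans (hpx x hx).symm), rfl⟩)
      (Or.inr (H.s_not (i x)))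
      (Or.inr ⟨hunder (i x - 1) _ _ h4.le (by rw [sub_add_cancel]),
        fun s hs => (H.overpass (i x)).2 s ⟨hs.1, hs.2.trans h1.2.le⟩⟩))
  -- an overpass and an underpass cross at most once
  have hinj : ∀ x ∈ D.multiplePoints, ∀ y ∈ D.multiplePoints, i x = i y → j x = j y →
      ¬ p x < p y := by
    intro x hx y hy hii hjj hlt
    have h1 := hp x hx
    have h2 := hp y hy
    have h3 := hq x hx
    have h4 := hq y hy
    rw [← hii] at h2
    rw [← hjj] at h4
    have h5 : f (i x) ≤ f (j x) := H.f_le_of_le (hij x hx)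
    have h6 : a (j x + 1) ≤ a (i x) + D.n := by
      rw [← H.s_add]; exact H.s_le_of_le (by linarith [hjk x hx])
    have hpass : ∀ s ∈ Set.Icc (p x) (p y), ¬ D.IsUndercrossing s := hover _ _ _ h1.1 h2.2.le
    have e1 := (hpx x hx).trans (hqx x hx).symm
    have e2 := (hpx y hy).trans (hqx y hy).symm
    -- The underpass may visit the two crossings in the same order as the overpass or in the
    -- opposite one; these are the two kinds of bigons.
    rcases lt_trichotomy (q x) (q y) with h | h | h
    · have h7 : p y < q x := h2.2.trans_le (h5.trans h3.1.le)
      exact hmin' (exists_fewer_of_bigon (H.s_not (i x)) h1.1 hlt h7.le h (h4.2.trans_le h6)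
        (Or.inl ⟨h7, e1, e2⟩) (Or.inl h7) (Or.inl ⟨hpass, hunder _ _ _ h3.1.le h4.2.le⟩))
    · have hxy : x = y := by rw [← hqx x hx, h, hqx y hy]
      exact absurd hlt (hxy ▸ lt_irrefl _)
    · have h7 : p y < q y := h2.2.trans_le (h5.trans h4.1.le)
      exact hmin' (exists_fewer_of_bigon (H.s_not (i x)) h1.1 hlt h7.le h (h3.2.trans_le h6)
        (Or.inr ⟨e1, e2⟩) (Or.inl h7) (Or.inl ⟨hpass, hunder _ _ _ h4.1.le h3.2.le⟩))
  -- A crossing is determined by its overpass and the offset `j - i`, which takes only the `k - 2`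
  -- values from `1` to `k - 2`; there are none if `k = 1`.
  have hcard := Set.ncard_le_ncard_of_injOn (s := D.multiplePoints)
    (t := ((Finset.Ico (0 : ℤ) k ×ˢ Finset.Ico (1 : ℤ) (k - 1) : Finset (ℤ × ℤ)) : Set (ℤ × ℤ)))
    (fun x => (i x, j x - i x)) (fun x hx => by
      have := hi0 x hx
      have := hik x hx
      have := hij x hx
      have := hjk x hx
      have := hne0 x hx
      have := hne1 x hx
      rw [Finset.mem_coe, Finset.mem_product, Finset.mem_Ico, Finset.mem_Ico]
      dsimp only
      omega) (fun x hx y hy hxy => by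
      have h1 : i x = i y := congrArg Prod.fst hxy
      have h2 : j x - i x = j y - i y := congrArg Prod.snd hxy
      have h3 : j x = j y := by omega
      have h4 : p x = p y := le_antisymm (not_lt.1 (hinj y hy x hx h1.symm h3.symm))
        (not_lt.1 (hinj x hx y hy h1 h3))
      rw [← hpx x hx, h4, hpx y hy]) (Finset.finite_toSet _)
  rw [Set.ncard_coe_finset, Finset.card_product, Int.card_Ico, Int.card_Ico] at hcard
  have e1 : ((k : ℤ) - 0).toNat = k := by omega
  have e2 : ((k : ℤ) - 1 - 1).toNat = k - 2 := by omega
  rwa [e1, e2] at hcard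

end IsOverUnderpassSequence

theorem IsMinimalDiagramOf.c_le {K : Knot} (hD : D.IsMinimalDiagramOf K) {D' : KnotDiagram}
    (h : D.Isotopic D'.toPolygonalKnot) : D.c ≤ D'.c := by
  rw [hD.2]
  refine Nat.sInf_le ⟨D', ?_, rfl⟩
  rw [← hD.1]
  exact Quotient.sound (Isotopic.symm h)

end KnotDiagram

end KnotDiag

theorem theorem2p10 (K : KnotDiag.Knot) (hK : ¬ K.IsTrivial)
    (D : KnotDiag.KnotDiagram) (hD : D.IsMinimalDiagramOf K) :
    1 + Real.sqrt (1 + (D.c : ℝ)) ≤ (D.b : ℝ) ∧ D.b ≤ D.c := by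
  have hc : D.c ≠ 0 := fun h => hK ⟨D, hD.1, KnotDiag.KnotDiagram.exists_isotopic_triangle h⟩
  -- The set is nonempty, so the infimum is attained; uniqueness of `k` is not needed.
  have hb : D.b ∈ {k : ℕ | 1 ≤ k ∧ ∃ s f : ℤ → ℝ, D.IsOverUnderpassSequence k s f} :=
    Nat.sInf_mem (KnotDiag.KnotDiagram.exists_isOverUnderpassSequence hc)
  obtain ⟨hb1, s, f, H⟩ := hb
  refine ⟨?_, H.le_c⟩
  have h1 := H.c_le hb1 fun D' h => hD.c_le h
  -- For `b = 1` the truncated difference `b - 2` is `0`, which would leave no crossing at all.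
  have h2 : 2 ≤ D.b := by
    by_contra h
    have : D.b - 2 = 0 := by omega
    rw [this, mul_zero] at h1
    omega
  have h3 : (D.c : ℝ) ≤ D.b * (D.b - 2) := by
    have : ((D.b - 2 : ℕ) : ℝ) = (D.b : ℝ) - 2 := by push_cast [Nat.cast_sub h2]; ring
    rw [← this]
    exact_mod_cast h1
  have h4 : (2 : ℝ) ≤ D.b := by exact_mod_cast h2
  -- Completing the square: `1 + c ≤ 1 + b * (b - 2) = (b - 1)²`.
  have h5 : Real.sqrt (1 + (D.c : ℝ)) ≤ D.b - 1 :=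
    Real.sqrt_le_iff.2 ⟨by linarith, by nlinarith⟩
  linarith
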